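/- Let $X$ be a finite set, $F_X$ the free group with basis $X$, $A$ a finitely generated abelian group (written additively; in $F_X\times A$ we write $u\,t^{a}$ for $(u,a)$), and $\preccurlyeq$ a total order on $X^{\pm}=X\sqcup X^{-1}$. An \emph{$A$-enriched $X$-automaton} $\Gamma$ is a digraph with a distinguished vertex (the basepoint), a subgroup $L_\Gamma\le A$ (the basepoint subgroup), and for each (positive) arc $e$ a label $(\lambda_1(e),x,\lambda_2(e))\in A\times X\times A$; the arc reads $t^{-\lambda_1(e)}\,x\,t^{\lambda_2(e)}$ when crossed forwards, and the inverse $t^{-\lambda_2(e)}\,x^{-1}\,t^{\lambda_1(e)}$ when crossed backwards (i.e. along the formal inverse arc $e^{-1}$, whose free label is $x^{-1}$). The recognized subgroup $\langle\Gamma\rangle\le F_X\times A$ consists of the elements $g\,t^{c}$ with $g$ the label of a closed walk at the basepoint and $c\in L_\Gamma$. $\Gamma$ is \emph{reduced} if it is deterministic (no two arcs, positive or inverse, with the same label in $X^\pm$ start at the same vertex) and core (every vertex lies on a closed walk at the basepoint without backtracking). Let $T_\preccurlyeq(\Gamma)$ be the spanning tree grown from the basepoint by repeatedly taking the oldest vertex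 in the tree from which some arc leads outside the tree, and adding, among those arcs, the one with $\preccurlyeq$-smallest label, together with its end. $\Gamma$ is \emph{$\preccurlyeq$-normalized} if it is reduced, $\lambda_1(e)=0$ for all positive arcs $e$, and $\lambda_2(e)=0$ for all positive arcs $e$ in $T_\preccurlyeq(\Gamma)$. Two enriched automata are \emph{isomorphic modulo the basepoint subgroup} if they have the same basepoint subgroup $L$ and there is an isomorphism of the underlying pointed $X$-labelled digraphs under which corresponding labels $\lambda_1$, $\lambda_2$ are congruent modulo $L$. For $H\le F_X\times A$ with projection $\overline H\le F_X$, let $\mathrm{St}_\preccurlyeq(H,X)$ be the following enriched automaton: its underlying $X$-automaton is the Stallings automaton of $\overline H$ (the core of the Schreier automaton of right cosets of $\overline H$), its basepoint subgroup is $H\cap A$, all its abelian labels are zero except that $\lambda_2(e)=c$ for $e\notin T_\preccurlyeq$, where $c\in A$ is any element with $u\,t^{c}\in H$ and $u\in F_X$ is the free label of the walk that goes in $T_\preccurlyeq$ from the basepoint to the origin of $e$, crosses $e$, and returns in $T_\preccurlyeq$ to the basepoint. \textbf{Theorem.} The map $H\mapsto \mathrm{St}_\preccurlyeq(H,X)$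 is a bijection from the set of subgroups of $F_X\times A$ onto the set of isomorphism classes, modulo the basepoint subgroup, of $\preccurlyeq$-normalized $A$-enriched $X$-automata. The automaton $\mathrm{St}_\preccurlyeq(H,X)$ is itself $\preccurlyeq$-normalized, and the inverse map is $\Gamma\mapsto\langle\Gamma\rangle$. A subgroup $H$ is finitely generated if and only if $\mathrm{St}_\preccurlyeq(H,X)$ is finite. For finitely generated subgroups the bijection is algorithmic: for fixed $X$, $\preccurlyeq$ and $A$ (with elements of $A$ given by integer vectors of exponents with respect to a finite generating family), there is an algorithm that, given a finite list of elements generating $H\le F_X\times A$, outputs a finite $\preccurlyeq$-normalized automaton in the class of $\mathrm{St}_\preccurlyeq(H,X)$; and there is an algorithm that, given a finite $\preccurlyeq$-normalized automaton $\Gamma$ (with its basepoint subgroup given by a finite list of generators), outputs a finite list of generators of $\langle\Gamma\rangle$. -/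

import Mathlib

universe u v w

/-- A pointed involutive `X`-automaton, presented by its positive arcs: `E` is the set of arcs with
a label in `X`, and each `e : E` comes with a formal inverse arc, see `XAutomaton.Arc`. -/
structure XAutomaton (X : Type u) where
  /-- vertices -/
  V : Type v
  /-- positive arcs -/
  E : Type v
  src : E → V
  tgt : E → V
  lab : E → X
  base : V

namespace XAutomaton

variable {X : Type u}

/-- All arcs of the involutive automaton: `(e, true)` is the positive arc `e` and `(e, false)` is
its inverse arc. -/
abbrev Arc (Γ : XAutomaton.{u, v} X) : Type v := Γ.E × Bool

variable (Γ : XAutomaton.{u, v} X)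

def origin (a : Γ.Arc) : Γ.V := if a.2 then Γ.src a.1 else Γ.tgt a.1

def terminus (a : Γ.Arc) : Γ.V := if a.2 then Γ.tgt a.1 else Γ.src a.1

/-- The label of an arc in `X^±`. As in `FreeGroup`, `X^±` is `X × Bool`, where `(x, true)` is the
letter `x` and `(x, false)` is its formal inverse. -/
def letter (a : Γ.Arc) : X × Bool := (Γ.lab a.1, a.2)

def invArc (a : Γ.Arc) : Γ.Arc := (a.1, !a.2)

/-- `Γ.IsWalk p l q`: the list of arcs `l` is a walk from `p` to `q`. -/
def IsWalk : Γ.V → List Γ.Arc → Γ.V → Prop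
  | p, [], q => p = q
  | p, a :: l, q => Γ.origin a = p ∧ IsWalk (Γ.terminus a) l q

/-- No two consecutive arcs are inverse to each other. -/
def NoBacktrack (l : List Γ.Arc) : Prop := l.IsChain fun a b => b ≠ Γ.invArc a

/-- The element of the free group represented by the labels of the arcs. -/
def freeLabel (l : List Γ.Arc) : FreeGroup X := FreeGroup.mk (l.map Γ.letter)

/-- No two arcs with the same label in `X^±` depart from the same vertex (by taking inverse arcs,
none arrive at the same vertex either). -/
def IsDeterministic : Prop :=
  ∀ a b : Γ.Arc, Γ.origin a = Γ.origin b → Γ.letter a = Γ.letter b → a = b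

/-- The vertex `p` appears in some reduced walk from the basepoint to the basepoint. -/
def OnReducedBaseWalk (p : Γ.V) : Prop :=
  ∃ l₁ l₂ : List Γ.Arc, Γ.IsWalk Γ.base l₁ p ∧ Γ.IsWalk p l₂ Γ.base ∧ Γ.NoBacktrack (l₁ ++ l₂)

def IsCore : Prop := ∀ p : Γ.V, Γ.OnReducedBaseWalk p

/-- Deterministic and core. -/
def IsReduced : Prop := Γ.IsDeterministic ∧ Γ.IsCore

/-- Both the vertex set and the arc set are finite. -/
def IsFinite : Prop := Finite Γ.V ∧ Finite Γ.E

theorem onReducedBaseWalk_base : Γ.OnReducedBaseWalk Γ.base :=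
  ⟨[], [], rfl, rfl, by simp [NoBacktrack]⟩

/-- The core: the full subautomaton on the vertices that appear in some reduced walk from the
basepoint to the basepoint. -/
def core : XAutomaton.{u, v} X where
  V := {p : Γ.V // Γ.OnReducedBaseWalk p}
  E := {e : Γ.E // Γ.OnReducedBaseWalk (Γ.src e) ∧ Γ.OnReducedBaseWalk (Γ.tgt e)}
  src e := ⟨Γ.src e.1, e.2.1⟩
  tgt e := ⟨Γ.tgt e.1, e.2.2⟩
  lab e := Γ.lab e.1
  base := ⟨Γ.base, Γ.onReducedBaseWalk_base⟩

/-- The right Schreier automaton of `H`: its vertices are the right cosets `Hg`, there is a positive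
arc labelled `x` from `Hg` to `Hgx` for every coset `Hg` and every `x : X`, and the basepoint is
the coset `H`. -/
def schreier (H : Subgroup (FreeGroup X)) : XAutomaton.{u, u} X where
  V := Quotient (QuotientGroup.rightRel H)
  E := Quotient (QuotientGroup.rightRel H) × X
  src e := e.1
  tgt e := Quotient.map' (· * FreeGroup.of e.2) (fun a b h => by
    rw [QuotientGroup.rightRel_apply] at h ⊢
    simpa [mul_assoc] using h) e.1
  lab e := e.2
  base := Quotient.mk _ 1

/-- The stages of the construction of the spanning tree determined by the total order `ord` on
`X^±`. A stage is the list of the vertices reached so far, oldest first, with the set of the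
(positive) arcs used so far. One starts with the basepoint and no arc; at each step, let `p` be the
oldest reached vertex from which some arc leads to a vertex not reached yet, and add, among these
arcs, the one with the smallest label together with its end. -/
inductive TreeStage (ord : LinearOrder (X × Bool)) : List Γ.V → Set Γ.E → Prop
  | start : TreeStage ord [Γ.base] ∅
  | grow (l₁ l₂ : List Γ.V) (p : Γ.V) (T : Set Γ.E) (a : Γ.Arc)
      (stage : TreeStage ord (l₁ ++ p :: l₂) T)
      (oldest : ∀ b : Γ.Arc, Γ.origin b ∈ l₁ → Γ.terminus b ∈ l₁ ++ p :: l₂)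
      (start_eq : Γ.origin a = p)
      (end_new : Γ.terminus a ∉ l₁ ++ p :: l₂)
      (smallest : ∀ b : Γ.Arc, Γ.origin b = p → Γ.terminus b ∉ l₁ ++ p :: l₂ →
        ord.le (Γ.letter a) (Γ.letter b)) :
      TreeStage ord ((l₁ ++ p :: l₂) ++ [Γ.terminus a]) (insert a.1 T)

/-- The arcs of the spanning tree determined by the total order `ord` on `X^±`. -/
def orderTree (ord : LinearOrder (X × Bool)) : Set Γ.E :=
  {e | ∃ (l : List Γ.V) (T : Set Γ.E), Γ.TreeStage ord l T ∧ e ∈ T}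

/-- A reduced walk all of whose arcs (up to inversion) lie in `T`. -/
def IsTreeWalk (T : Set Γ.E) (p : Γ.V) (l : List Γ.Arc) (q : Γ.V) : Prop :=
  Γ.IsWalk p l q ∧ Γ.NoBacktrack l ∧ ∀ a ∈ l, a.1 ∈ T

/-- `l` is the `T`-petal of the arc `e`: the walk in `T` from the basepoint to the origin of `e`,
then `e`, then the walk in `T` from the end of `e` to the basepoint. -/
def IsPetal (T : Set Γ.E) (e : Γ.E) (l : List Γ.Arc) : Prop :=
  ∃ l₁ l₂ : List Γ.Arc, Γ.IsTreeWalk T Γ.base l₁ (Γ.src e) ∧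
    Γ.IsTreeWalk T (Γ.tgt e) l₂ Γ.base ∧ l = l₁ ++ (e, true) :: l₂

variable {Γ}

theorem IsWalk.append {p q r : Γ.V} {l₁ l₂ : List Γ.Arc} (h₁ : Γ.IsWalk p l₁ q)
    (h₂ : Γ.IsWalk q l₂ r) : Γ.IsWalk p (l₁ ++ l₂) r := by
  induction l₁ generalizing p with
  | nil => cases h₁; exact h₂
  | cons a l ih => exact ⟨h₁.1, ih h₁.2⟩

theorem IsWalk.reverse {p q : Γ.V} {l : List Γ.Arc} (h : Γ.IsWalk p l q) :
    Γ.IsWalk q (l.map Γ.invArc).reverse p := by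
  induction l generalizing p with
  | nil => exact Eq.symm h
  | cons a l ih =>
    rw [List.map_cons, List.reverse_cons]
    refine (ih h.2).append ⟨?_, ?_⟩
    · cases a with | mk e b => cases b <;> rfl
    · rw [← h.1]
      cases a with | mk e b => cases b <;> rfl

end XAutomaton

/-- An `A`-enriched `X`-automaton, presented by its positive arcs: each positive arc carries an
initial and a final label in `A`, and a subgroup of `A` is attached to the basepoint. -/
structure EnrichedAutomaton (X : Type u) (A : Type w) [AddCommGroup A] extends
    XAutomaton.{u, v} X where
  lab₁ : E → A
  lab₂ : E → A
  baseSubgroup : AddSubgroup A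

namespace EnrichedAutomaton

variable {X : Type u} {A : Type w} [AddCommGroup A]

variable (Γ : EnrichedAutomaton.{u, v, w} X A)

/-- The element of `F_X × A` read along an arc: a positive arc labelled `(a, x, b)` reads
`t^{-a} x t^b` when crossed forwards and `t^{-b} x⁻¹ t^a` when crossed backwards. -/
def arcLabel (a : Γ.Arc) : FreeGroup X × Multiplicative A :=
  if a.2 then (FreeGroup.of (Γ.lab a.1), Multiplicative.ofAdd (-Γ.lab₁ a.1 + Γ.lab₂ a.1))
  else ((FreeGroup.of (Γ.lab a.1))⁻¹, Multiplicative.ofAdd (-Γ.lab₂ a.1 + Γ.lab₁ a.1))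

/-- The enriched label of a walk. -/
def walkLabel (l : List Γ.Arc) : FreeGroup X × Multiplicative A := (l.map Γ.arcLabel).prod

theorem walkLabel_reverse (l : List Γ.Arc) :
    Γ.walkLabel (l.map Γ.invArc).reverse = (Γ.walkLabel l)⁻¹ := by
  have key : ∀ a : Γ.Arc, Γ.arcLabel (Γ.invArc a) = (Γ.arcLabel a)⁻¹ := by
    rintro ⟨e, _ | _⟩ <;> simp [arcLabel, XAutomaton.invArc, mul_comm]
  induction l with
  | nil => simp [walkLabel]
  | cons a l ih =>
    simp only [walkLabel] at ih ⊢
    simp only [List.map_cons, List.reverse_cons, List.map_append, List.prod_append, ih,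
      List.map_nil, List.prod_cons, List.prod_nil, mul_one, key, mul_inv_rev]

/-- The subgroup recognized by `Γ`: the labels of the walks from the basepoint to the basepoint,
where elements of the basepoint subgroup may be picked up at the basepoint. As `A` is central,
these are the products of the label of such a walk with an element of the basepoint subgroup. -/
def recognized : Subgroup (FreeGroup X × Multiplicative A) where
  carrier := {g | ∃ l : List Γ.Arc, Γ.IsWalk Γ.base l Γ.base ∧
    ∃ c ∈ Γ.baseSubgroup, g = Γ.walkLabel l * (1, Multiplicative.ofAdd c)}
  one_mem' := ⟨[], rfl, 0, zero_mem _, by simp [walkLabel, Prod.one_eq_mk]⟩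
  mul_mem' := by
    rintro _ _ ⟨l, hl, c, hc, rfl⟩ ⟨l', hl', c', hc', rfl⟩
    refine ⟨l ++ l', hl.append hl', c + c', add_mem hc hc', ?_⟩
    ext1 <;> simp [walkLabel, mul_mul_mul_comm]
  inv_mem' := by
    rintro _ ⟨l, hl, c, hc, rfl⟩
    refine ⟨(l.map Γ.invArc).reverse, hl.reverse, -c, neg_mem hc, ?_⟩
    rw [walkLabel_reverse]
    ext1 <;> simp [mul_comm]

/-- `Γ` is normalized with respect to the spanning tree with arc set `T`: it is reduced, the
initial abelian label of every positive arc is zero, and the final abelian label of every positive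
arc in `T` is zero. -/
def IsNormalizedWrt (T : Set Γ.E) : Prop :=
  Γ.IsReduced ∧ (∀ e, Γ.lab₁ e = 0) ∧ ∀ e ∈ T, Γ.lab₂ e = 0

/-- `Γ` is normalized with respect to the spanning tree determined by `ord`. -/
def IsNormalized (ord : LinearOrder (X × Bool)) : Prop :=
  Γ.IsNormalizedWrt (Γ.orderTree ord)

/-- Isomorphism modulo the basepoint subgroup: an isomorphism of the skeletons, where the
basepoint subgroups are equal and corresponding abelian labels are congruent modulo it. -/
def IsoModBase (Γ Δ : EnrichedAutomaton.{u, v, w} X A) : Prop :=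
  ∃ (f : Γ.V ≃ Δ.V) (g : Γ.E ≃ Δ.E),
    f Γ.base = Δ.base ∧
    (∀ e, Δ.src (g e) = f (Γ.src e)) ∧
    (∀ e, Δ.tgt (g e) = f (Γ.tgt e)) ∧
    (∀ e, Δ.lab (g e) = Γ.lab e) ∧
    Γ.baseSubgroup = Δ.baseSubgroup ∧
    (∀ e, Δ.lab₁ (g e) - Γ.lab₁ e ∈ Γ.baseSubgroup) ∧
    (∀ e, Δ.lab₂ (g e) - Γ.lab₂ e ∈ Γ.baseSubgroup)

theorem isoModBase_equivalence :
    Equivalence (IsoModBase (X := X) (A := A) : EnrichedAutomaton.{u, v, w} X A → _ → Prop) where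
  refl Γ := ⟨Equiv.refl _, Equiv.refl _, by simp⟩
  symm := by
    rintro Γ Δ ⟨f, g, hb, hs, ht, hl, hL, h₁, h₂⟩
    refine ⟨f.symm, g.symm, by simp [← hb], fun e => ?_, fun e => ?_, fun e => ?_, hL.symm,
      fun e => ?_, fun e => ?_⟩
    · rw [Equiv.eq_symm_apply, ← hs, Equiv.apply_symm_apply]
    · rw [Equiv.eq_symm_apply, ← ht, Equiv.apply_symm_apply]
    · rw [← hl, Equiv.apply_symm_apply]
    · have h := neg_mem (h₁ (g.symm e))
      rwa [neg_sub, Equiv.apply_symm_apply, hL] at h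
    · have h := neg_mem (h₂ (g.symm e))
      rwa [neg_sub, Equiv.apply_symm_apply, hL] at h
  trans := by
    rintro Γ Δ Θ ⟨f, g, hb, hs, ht, hl, hL, h₁, h₂⟩ ⟨f', g', hb', hs', ht', hl', hL', h₁', h₂'⟩
    refine ⟨f.trans f', g.trans g', by simp [hb, hb'], by simp [hs, hs'], by simp [ht, ht'],
      by simp [hl, hl'], hL.trans hL', fun e => ?_, fun e => ?_⟩
    · have h := add_mem (hL ▸ h₁' (g e)) (h₁ e)
      rwa [sub_add_sub_cancel] at h
    · have h := add_mem (hL ▸ h₂' (g e)) (h₂ e)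
      rwa [sub_add_sub_cancel] at h

instance isoSetoid : Setoid (EnrichedAutomaton.{u, v, w} X A) where
  r := IsoModBase
  iseqv := isoModBase_equivalence

/-- Isomorphism classes of enriched automata modulo the basepoint subgroup. -/
def IsoClass (X : Type u) (A : Type w) [AddCommGroup A] : Type (max u (v + 1) w) :=
  Quotient (isoSetoid : Setoid (EnrichedAutomaton.{u, v, w} X A))

/-- The isomorphism class of `Γ` modulo the basepoint subgroup. -/
def isoClass : IsoClass.{u, v, w} X A := Quotient.mk _ Γ

open Classical in
/-- The enriched Stallings automaton of `H` for the total order `ord` on `X^±`. Its skeleton is the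
Stallings automaton of the projection of `H` to `F_X`, its basepoint subgroup is `H ∩ A`, and all
abelian labels are zero except that the final label of a positive arc outside the spanning tree
determined by `ord` is some `c` such that `u t^c ∈ H`, where `u` is the free label of the petal of
that arc. -/
noncomputable def stallings (ord : LinearOrder (X × Bool))
    (H : Subgroup (FreeGroup X × Multiplicative A)) : EnrichedAutomaton.{u, u, w} X A where
  toXAutomaton := (XAutomaton.schreier (H.map (MonoidHom.fst _ _))).core
  lab₁ _ := 0
  lab₂ e :=
    let S₀ := (XAutomaton.schreier (H.map (MonoidHom.fst _ _))).core
    if e ∈ S₀.orderTree ord then 0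
    else Classical.epsilon fun c : A => ∃ l : List S₀.Arc,
      S₀.IsPetal (S₀.orderTree ord) e l ∧ (S₀.freeLabel l, Multiplicative.ofAdd c) ∈ H
  baseSubgroup :=
    { carrier := {c | (1, Multiplicative.ofAdd c) ∈ H}
      zero_mem' := H.one_mem
      add_mem' := fun {a b} ha hb => by simpa using H.mul_mem ha hb
      neg_mem' := fun {a} ha => by simpa using H.inv_mem ha }

end EnrichedAutomaton

/-! ### Finite descriptions, for the algorithmic statements

Elements of `X` are given by their index in a fixed enumeration, and elements of `A` by integer
vectors of exponents with respect to a fixed finite family of generators. -/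

/-- A finite list of pairs (word in `X^±`, integer vector), describing a finite list of elements
`u t^c` of `F_X × A`. -/
abbrev GenCode (n m : ℕ) : Type := List (List (Fin n × Bool) × (Fin m → ℤ))

/-- A triple `(k, arcs, gens)` describing a finite enriched automaton with vertices `0, …, k` and
basepoint `0`; an arc is given by origin, end, label in `X`, initial and final abelian label; the
last component is a list of generators of the basepoint subgroup. -/
abbrev AutomatonCode (n m : ℕ) : Type :=
  ℕ × List (ℕ × ℕ × Fin n × (Fin m → ℤ) × (Fin m → ℤ)) × List (Fin m → ℤ)

section Decode

variable {X : Type u} {A : Type w} [AddCommGroup A] {n m : ℕ}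

/-- The subgroup generated by the elements that `S` describes. -/
def GenCode.subgroup (enum : Fin n ≃ X) (π : (Fin m → ℤ) →+ A) (S : GenCode n m) :
    Subgroup (FreeGroup X × Multiplicative A) :=
  Subgroup.closure {g | ∃ s ∈ S,
    g = (FreeGroup.mk (s.1.map fun y => (enum y.1, y.2)), Multiplicative.ofAdd (π s.2))}

/-- The finite enriched automaton that `c` describes (vertex numbers are read modulo the number of
vertices). -/
def AutomatonCode.automaton (enum : Fin n ≃ X) (π : (Fin m → ℤ) →+ A) (c : AutomatonCode n m) :
    EnrichedAutomaton.{u, v, w} X A where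
  V := ULift.{v} (Fin (c.1 + 1))
  E := ULift.{v} (Fin c.2.1.length)
  src e := ULift.up (Fin.ofNat (c.1 + 1) (c.2.1.get e.down).1)
  tgt e := ULift.up (Fin.ofNat (c.1 + 1) (c.2.1.get e.down).2.1)
  lab e := enum (c.2.1.get e.down).2.2.1
  base := ULift.up 0
  lab₁ e := π (c.2.1.get e.down).2.2.2.1
  lab₂ e := π (c.2.1.get e.down).2.2.2.2
  baseSubgroup := AddSubgroup.closure {b | ∃ z ∈ c.2.2, b = π z}

end Decode

/-! In a deterministic automaton a walk without backtracking spells a reduced word, so it is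
determined by its origin and its free label (`IsWalk.eq_of_freeLabel`). Two facts follow. A closed
walk at the basepoint with trivial free label cancels to the empty walk, and cancellation preserves
enriched labels; hence ⟨Γ⟩ meets A exactly in the basepoint subgroup (`mem_baseSubgroup_iff`). And a
reduced automaton is the core of the Schreier automaton of the projection of ⟨Γ⟩
(`nonempty_iso_core_schreier`).

The order tree is canonical: each stage is determined by its length, isomorphisms carry stages to
stages, and every vertex is reached. A potential along the tree, namely the free label of the tree
walk from the basepoint, turns every closed walk into a product of petals, so the petals outside the
tree and the basepoint subgroup generate ⟨Γ⟩ (`recognized_le`). In a normalized automaton the petal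
of `e` reads u t^c with c = λ₂(e). Membership in H therefore fixes λ₂(e) modulo H ∩ A and nothing
more, which gives ⟨St(H)⟩ = H (`recognized_stallings`) and Γ ≅ St(⟨Γ⟩) modulo the basepoint subgroup
(`isoModBase_stallings_recognized`).

If H is finitely generated, closed walks spelling generators of its projection use finitely many
arcs; every reduced closed walk arises from these by cancellation, so there are no other arcs.
Conversely a finite automaton has finitely many petals, and subgroups of A are finitely generated.

Generators of ⟨Γ⟩ are read off the closed walks of length at most 2k + 1, where k + 1 is the number
of vertices. The opposite algorithm does no folding: it searches through all pairs of an automaton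
and a bound until the bound certifies that the automaton is normalized and that its generators and
the given ones express each other modulo the relations of A. The test is primitive recursive. The
search stops because St(H) is finite and can be numbered in tree order; whatever it finds recognizes
H, hence lies in the class of St(H). -/

namespace XAutomaton

variable {X : Type u} {Γ : XAutomaton.{u, v} X}

/-! ### Walks -/

@[simp] theorem origin_invArc (a : Γ.Arc) : Γ.origin (Γ.invArc a) = Γ.terminus a := by
  rcases a with ⟨e, _ | _⟩ <;> rfl

@[simp] theorem terminus_invArc (a : Γ.Arc) : Γ.terminus (Γ.invArc a) = Γ.origin a := by
  rcases a with ⟨e, _ | _⟩ <;> rfl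

@[simp] theorem invArc_invArc (a : Γ.Arc) : Γ.invArc (Γ.invArc a) = a := by
  rcases a with ⟨e, _ | _⟩ <;> rfl

theorem letter_invArc (a : Γ.Arc) :
    Γ.letter (Γ.invArc a) = ((Γ.letter a).1, !(Γ.letter a).2) := rfl

theorem isWalk_append {p r : Γ.V} {l₁ l₂ : List Γ.Arc} :
    Γ.IsWalk p (l₁ ++ l₂) r ↔ ∃ q, Γ.IsWalk p l₁ q ∧ Γ.IsWalk q l₂ r := by
  induction l₁ generalizing p with
  | nil => simp [IsWalk]
  | cons a l ih => simp [IsWalk, ih, and_assoc]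

theorem IsWalk.end_unique {p q r : Γ.V} {l : List Γ.Arc} (h : Γ.IsWalk p l q)
    (h' : Γ.IsWalk p l r) : q = r := by
  induction l generalizing p with
  | nil => exact Eq.trans (Eq.symm h) h'
  | cons a l ih => exact ih h.2 h'.2

theorem isWalk_singleton (a : Γ.Arc) : Γ.IsWalk (Γ.origin a) [a] (Γ.terminus a) := ⟨rfl, rfl⟩

theorem IsWalk.eq_of_map_letter (hd : Γ.IsDeterministic) {p q q' : Γ.V} {l l' : List Γ.Arc}
    (h : Γ.IsWalk p l q) (h' : Γ.IsWalk p l' q') (hl : l.map Γ.letter = l'.map Γ.letter) :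
    l = l' := by
  induction l generalizing p l' with
  | nil => cases l' with
    | nil => rfl
    | cons b l' => simp at hl
  | cons a l ih => cases l' with
    | nil => simp at hl
    | cons b l' =>
      simp only [List.map_cons, List.cons.injEq] at hl
      obtain rfl : a = b := hd a b (h.1.trans h'.1.symm) hl.1
      rw [ih h.2 h'.2 hl.2]

theorem NoBacktrack.reverse {l : List Γ.Arc} (h : Γ.NoBacktrack l) :
    Γ.NoBacktrack (l.map Γ.invArc).reverse := by
  unfold NoBacktrack at *
  rw [List.isChain_reverse, List.isChain_map]
  refine h.imp fun a b hab hba => hab ?_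
  simpa using hba.symm

/-- The values along a walk of a function on positive arcs, extended to inverse arcs. -/
def arcVal {G : Type*} [Group G] (φ : Γ.E → G) (a : Γ.Arc) : G := if a.2 then φ a.1 else (φ a.1)⁻¹

theorem arcVal_invArc {G : Type*} [Group G] (φ : Γ.E → G) (a : Γ.Arc) :
    arcVal φ (Γ.invArc a) = (arcVal φ a)⁻¹ := by
  rcases a with ⟨e, _ | _⟩ <;> simp [arcVal, invArc]

theorem freeLabel_eq_prod (l : List Γ.Arc) :
    Γ.freeLabel l = (l.map (arcVal fun e => FreeGroup.of (Γ.lab e))).prod := by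
  induction l with
  | nil => rfl
  | cons a l ih =>
    rw [List.map_cons, List.prod_cons, ← ih, freeLabel, List.map_cons, ← List.singleton_append,
      ← FreeGroup.mul_mk]
    rcases a with ⟨e, _ | _⟩ <;> rfl

theorem freeLabel_append (l₁ l₂ : List Γ.Arc) :
    Γ.freeLabel (l₁ ++ l₂) = Γ.freeLabel l₁ * Γ.freeLabel l₂ := by
  simp [freeLabel_eq_prod]

theorem freeLabel_reverse (l : List Γ.Arc) :
    Γ.freeLabel (l.map Γ.invArc).reverse = (Γ.freeLabel l)⁻¹ := by
  simp only [freeLabel_eq_prod]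
  induction l with
  | nil => simp
  | cons a l ih =>
    rw [List.map_cons, List.reverse_cons, List.map_append, List.prod_append, ih]
    simp [arcVal_invArc]

/-- Deleting the backtrackings of a walk. -/
theorem IsWalk.exists_noBacktrack {G : Type*} [Group G] (φ : Γ.Arc → G)
    (hφ : ∀ a, φ (Γ.invArc a) = (φ a)⁻¹) {p q : Γ.V} {l : List Γ.Arc} (h : Γ.IsWalk p l q) :
    ∃ l', Γ.IsWalk p l' q ∧ Γ.NoBacktrack l' ∧ l' ⊆ l ∧ (l'.map φ).prod = (l.map φ).prod := by
  induction l generalizing p with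
  | nil => exact ⟨[], h, List.isChain_nil, by simp, rfl⟩
  | cons a l ih =>
    obtain ⟨l', hw, hn, hs, hp⟩ := ih h.2
    by_cases hb : ∃ t, l' = Γ.invArc a :: t
    · obtain ⟨t, rfl⟩ := hb
      refine ⟨t, ?_, hn.tail, fun x hx => ?_, ?_⟩
      · rw [← h.1, ← terminus_invArc]; exact hw.2
      · exact List.mem_cons_of_mem _ (hs (List.mem_cons_of_mem _ hx))
      · rw [List.map_cons, List.prod_cons, ← hp, List.map_cons, List.prod_cons, hφ,
          mul_inv_cancel_left]
    · refine ⟨a :: l', ⟨h.1, hw⟩, ?_, List.cons_subset_cons _ hs, by simp [hp]⟩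
      refine List.isChain_cons.2 ⟨?_, hn⟩
      rintro b hb' rfl
      exact hb ⟨l'.tail, List.eq_cons_of_mem_head? hb'⟩

/-- If two consecutive letters cancelled, the second arc and the inverse of the first would start at
the same vertex with the same letter. Determinism would make them equal, which is a backtracking. -/
theorem isReduced_map_letter (hd : Γ.IsDeterministic) {p q : Γ.V} {l : List Γ.Arc}
    (h : Γ.IsWalk p l q) (hn : Γ.NoBacktrack l) : FreeGroup.IsReduced (l.map Γ.letter) := by
  induction l generalizing p with
  | nil => exact FreeGroup.IsReduced.nil
  | cons a l ih =>
    refine List.isChain_cons.2 ⟨?_, ih h.2 hn.tail⟩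
    cases l with
    | nil => simp
    | cons b l =>
      simp only [List.map_cons, List.head?_cons, Option.mem_some_iff, forall_eq']
      intro hab
      by_contra hne
      refine (List.isChain_cons_cons.1 hn).1 (hd _ _ ?_ ?_)
      · rw [origin_invArc]; exact h.2.1
      · rw [letter_invArc]
        refine Prod.ext hab.symm ?_
        revert hne
        cases (Γ.letter a).2 <;> cases (Γ.letter b).2 <;> simp

theorem noBacktrack_of_isReduced {l : List Γ.Arc} (h : FreeGroup.IsReduced (l.map Γ.letter)) :
    Γ.NoBacktrack l := by
  refine ((List.isChain_map _).1 h).imp ?_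
  rintro a b hab rfl
  have := hab rfl
  simp [letter_invArc] at this

/-- Both words are reduced and represent the same element, so they agree letter by letter, and
determinism then leaves no choice of arcs. This is the rigidity behind every uniqueness statement
below. -/
theorem IsWalk.eq_of_freeLabel (hd : Γ.IsDeterministic) {p q q' : Γ.V} {l l' : List Γ.Arc}
    (h : Γ.IsWalk p l q) (h' : Γ.IsWalk p l' q') (hn : Γ.NoBacktrack l) (hn' : Γ.NoBacktrack l')
    (hl : Γ.freeLabel l = Γ.freeLabel l') : l = l' := by
  classical
  refine h.eq_of_map_letter hd h' ?_
  rw [← (isReduced_map_letter hd h hn).reduce_eq, ← (isReduced_map_letter hd h' hn').reduce_eq]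
  exact FreeGroup.reduce.sound hl

theorem IsWalk.exists_noBacktrack_freeLabel {p q : Γ.V} {l : List Γ.Arc} (h : Γ.IsWalk p l q) :
    ∃ l', Γ.IsWalk p l' q ∧ Γ.NoBacktrack l' ∧ l' ⊆ l ∧ Γ.freeLabel l' = Γ.freeLabel l := by
  simp only [freeLabel_eq_prod]
  exact h.exists_noBacktrack _ (arcVal_invArc _)

theorem IsWalk.end_eq_of_freeLabel (hd : Γ.IsDeterministic) {p q q' : Γ.V} {l l' : List Γ.Arc}
    (h : Γ.IsWalk p l q) (h' : Γ.IsWalk p l' q') (hl : Γ.freeLabel l = Γ.freeLabel l') :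
    q = q' := by
  obtain ⟨m, hm, hn, -, hf⟩ := h.exists_noBacktrack_freeLabel
  obtain ⟨m', hm', hn', -, hf'⟩ := h'.exists_noBacktrack_freeLabel
  obtain rfl := hm.eq_of_freeLabel hd hm' hn hn' (by rw [hf, hf', hl])
  exact hm.end_unique hm'

/-- If both ends of an arc lie on reduced closed walks at the basepoint, then so does the arc, up
to inversion. -/
theorem exists_closed_of_onReducedBaseWalk {a : Γ.Arc} (ho : Γ.OnReducedBaseWalk (Γ.origin a))
    (ht : Γ.OnReducedBaseWalk (Γ.terminus a)) :
    ∃ l, Γ.IsWalk Γ.base l Γ.base ∧ Γ.NoBacktrack l ∧ (a ∈ l ∨ Γ.invArc a ∈ l) := by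
  obtain ⟨l₁, l₂, h₁, h₂, hl⟩ := ho
  obtain ⟨m₁, m₂, k₁, k₂, hm⟩ := ht
  -- Splicing `l₁`, `a`, `m₂` can backtrack only at the two joints, and a backtracking there means
  -- that one of the two given closed walks already crosses the inverse of `a`.
  by_cases c₁ : l₁.getLast? = some (Γ.invArc a)
  · exact ⟨l₁ ++ l₂, h₁.append h₂, hl, .inr (List.mem_append_left _ (List.mem_of_getLast? c₁))⟩
  by_cases c₂ : m₂.head? = some (Γ.invArc a)
  · exact ⟨m₁ ++ m₂, k₁.append k₂, hm, .inr (List.mem_append_right _ (List.mem_of_head? c₂))⟩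
  refine ⟨l₁ ++ a :: m₂, h₁.append ⟨rfl, k₂⟩, ?_, .inl (by simp)⟩
  refine List.isChain_append.2 ⟨(List.isChain_append.1 hl).1, List.isChain_cons.2
    ⟨?_, (List.isChain_append.1 hm).2.1⟩, ?_⟩
  · rintro b hb rfl
    exact c₂ hb
  · rintro b hb c hc rfl
    simp only [List.head?_cons, Option.mem_some_iff] at hc
    exact c₁ (by rw [hc, invArc_invArc]; exact hb)

theorem onReducedBaseWalk_of_mem {l : List Γ.Arc} (h : Γ.IsWalk Γ.base l Γ.base)
    (hn : Γ.NoBacktrack l) {a : Γ.Arc} (ha : a ∈ l) :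
    Γ.OnReducedBaseWalk (Γ.origin a) ∧ Γ.OnReducedBaseWalk (Γ.terminus a) := by
  obtain ⟨l₁, l₂, rfl⟩ := List.append_of_mem ha
  obtain ⟨q, h₁, rfl, h₂⟩ := isWalk_append.1 h
  exact ⟨⟨l₁, a :: l₂, h₁, ⟨rfl, h₂⟩, hn⟩,
    ⟨l₁ ++ [a], l₂, h₁.append (isWalk_singleton a), h₂, by simpa using hn⟩⟩

/-! ### The order tree -/

section Tree

variable {ord : LinearOrder (X × Bool)}

theorem TreeStage.nodup {l : List Γ.V} {T : Set Γ.E} (h : Γ.TreeStage ord l T) : l.Nodup := by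
  induction h with
  | start => simp
  | grow l₁ l₂ p T a _ _ _ hnew _ ih => rw [← List.concat_eq_append]; exact ih.concat hnew

theorem TreeStage.base_mem {l : List Γ.V} {T : Set Γ.E} (h : Γ.TreeStage ord l T) :
    Γ.base ∈ l := by
  induction h with
  | start => simp
  | grow l₁ l₂ p T a _ _ _ hnew _ ih => exact List.mem_append_left _ ih

theorem mem_ends_of_arc {a : Γ.Arc} {P : Γ.V → Prop} (ho : P (Γ.origin a))
    (ht : P (Γ.terminus a)) : P (Γ.src a.1) ∧ P (Γ.tgt a.1) := by
  rcases a with ⟨e, _ | _⟩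
  · exact ⟨ht, ho⟩
  · exact ⟨ho, ht⟩

theorem TreeStage.ends_mem {l : List Γ.V} {T : Set Γ.E} (h : Γ.TreeStage ord l T) :
    ∀ e ∈ T, Γ.src e ∈ l ∧ Γ.tgt e ∈ l := by
  induction h with
  | start => simp
  | grow l₁ l₂ p T a _ _ hp hnew _ ih =>
    rintro e (rfl | he)
    · refine mem_ends_of_arc (P := (· ∈ _)) ?_ ?_
      · rw [hp]; simp
      · simp
    · exact ⟨List.mem_append_left _ (ih e he).1, List.mem_append_left _ (ih e he).2⟩

theorem TreeStage.exists_treeWalk {l : List Γ.V} {T : Set Γ.E} (h : Γ.TreeStage ord l T) :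
    ∀ v ∈ l, ∃ m, Γ.IsTreeWalk T Γ.base m v := by
  induction h with
  | start => simpa using ⟨[], rfl, List.isChain_nil, by simp⟩
  | grow l₁ l₂ p T a hst _ hp hnew _ ih =>
    intro v hv
    rcases List.mem_append.1 hv with hv | hv
    · obtain ⟨m, hm, hn, hT⟩ := ih v hv
      exact ⟨m, hm, hn, fun b hb => .inr (hT b hb)⟩
    · obtain rfl : v = Γ.terminus a := by simpa using hv
      obtain ⟨m, hm, hn, hT⟩ := ih p (by simp)
      refine ⟨m ++ [a], hm.append ⟨hp, rfl⟩, ?_, ?_⟩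
      · refine List.isChain_append.2 ⟨hn, List.isChain_singleton _, ?_⟩
        rintro b hb c hc rfl
        simp only [List.head?_cons, Option.mem_some_iff] at hc
        have hbT := hst.ends_mem _ (hT b (List.mem_of_getLast? hb))
        have : Γ.terminus a ∈ l₁ ++ p :: l₂ := by
          rw [hc]
          rcases b with ⟨e, _ | _⟩
          · exact hbT.2
          · exact hbT.1
        exact hnew this
      · intro b hb
        rcases List.mem_append.1 hb with hb | hb
        · exact .inr (hT b hb)
        · exact .inl (by rw [List.mem_singleton.1 hb])

/-- Each stage adds a vertex that was not reached before, so the value there can be prescribed by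
the new arc without disturbing the older equations. Potentials take over the role of uniqueness of
paths in a tree. -/
theorem TreeStage.exists_potential {G : Type*} [Group G] (φ : Γ.E → G) {l : List Γ.V}
    {T : Set Γ.E} (h : Γ.TreeStage ord l T) :
    ∃ τ : Γ.V → G, τ Γ.base = 1 ∧ ∀ e ∈ T, τ (Γ.src e) * φ e = τ (Γ.tgt e) := by
  classical
  induction h with
  | start => exact ⟨fun _ => 1, rfl, by simp⟩
  | grow l₁ l₂ p T a hst _ hp hnew _ ih =>
    obtain ⟨τ, hb, hτ⟩ := ih
    have key : ∀ v ∈ l₁ ++ p :: l₂,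
        Function.update τ (Γ.terminus a) (τ p * arcVal φ a) v = τ v := fun v hv =>
      Function.update_of_ne (by rintro rfl; exact hnew hv) _ _
    refine ⟨Function.update τ (Γ.terminus a) (τ p * arcVal φ a), ?_, ?_⟩
    · rw [key _ hst.base_mem, hb]
    · rintro e (rfl | he)
      · have h₁ := key (Γ.origin a) (by rw [hp]; simp)
        have h₂ := Function.update_self (Γ.terminus a) (τ p * arcVal φ a) τ
        rw [← hp] at h₁ h₂ ⊢
        rcases a with ⟨e, _ | _⟩
        · change _ * φ e = Function.update τ _ _ (Γ.origin (e, false))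
          rw [h₁]
          change Function.update τ _ _ (Γ.terminus (e, false)) * φ e = _
          rw [h₂]
          simp [arcVal]
        · change Function.update τ _ _ (Γ.origin (e, true)) * φ e =
            Function.update τ _ _ (Γ.terminus (e, true))
          rw [h₁, h₂]
          simp [arcVal]
      · rw [key _ (hst.ends_mem e he).1, key _ (hst.ends_mem e he).2, hτ e he]

/-- The product along the walk telescopes. -/
theorem IsWalk.potential {G : Type*} [Group G] {φ : Γ.E → G} {T : Set Γ.E} {τ : Γ.V → G}
    (hτ : ∀ e ∈ T, τ (Γ.src e) * φ e = τ (Γ.tgt e)) {p q : Γ.V} {l : List Γ.Arc}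
    (h : Γ.IsWalk p l q) (hT : ∀ a ∈ l, a.1 ∈ T) : τ p * (l.map (arcVal φ)).prod = τ q := by
  induction l generalizing p with
  | nil => obtain rfl : p = q := h; simp
  | cons a l ih =>
    rw [← ih h.2 fun b hb => hT b (List.mem_cons_of_mem _ hb), List.map_cons, List.prod_cons,
      ← mul_assoc, ← h.1]
    congr 1
    have := hτ a.1 (hT a (by simp))
    rcases a with ⟨e, _ | _⟩
    · simpa [arcVal, origin, terminus, mul_inv_eq_iff_eq_mul] using this.symm
    · simpa [arcVal, origin, terminus] using this

theorem eq_split_of_first {α : Type*} {P : α → Prop} {l₁ l₂ m₁ m₂ : List α} {x y : α}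
    (h : l₁ ++ x :: l₂ = m₁ ++ y :: m₂) (hx : P x) (hy : P y) (hl : ∀ z ∈ l₁, ¬ P z)
    (hm : ∀ z ∈ m₁, ¬ P z) : l₁ = m₁ ∧ x = y ∧ l₂ = m₂ := by
  induction l₁ generalizing m₁ with
  | nil => cases m₁ with
    | nil => simpa using h
    | cons z m₁ =>
      simp only [List.nil_append, List.cons_append, List.cons.injEq] at h
      exact absurd (h.1 ▸ hx) (hm z (by simp))
  | cons z l₁ ih => cases m₁ with
    | nil =>
      simp only [List.nil_append, List.cons_append, List.cons.injEq] at h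
      exact absurd (h.1 ▸ hy) (hl z (by simp))
    | cons z' m₁ =>
      simp only [List.cons_append, List.cons.injEq] at h
      obtain ⟨rfl, rfl, rfl⟩ := ih h.2 (fun z hz => hl z (by simp [hz]))
        fun z hz => hm z (by simp [hz])
      simp [h.1]

theorem exists_split_first {α : Type*} {P : α → Prop} {l : List α} (h : ∃ x ∈ l, P x) :
    ∃ l₁ x l₂, l = l₁ ++ x :: l₂ ∧ P x ∧ ∀ z ∈ l₁, ¬ P z := by
  induction l with
  | nil => simp at h
  | cons y l ih =>
    by_cases hy : P y
    · exact ⟨[], y, l, rfl, hy, by simp⟩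
    · obtain ⟨l₁, x, l₂, rfl, hx, hl⟩ := ih (by simpa [hy] using h)
      exact ⟨y :: l₁, x, l₂, rfl, hx, by simpa [hy] using hl⟩

/-- The next arc is forced: its origin is the first vertex of the list with an arc leading outside,
its letter is the smallest available one, and determinism singles out the arc with that letter. -/
theorem TreeStage.unique (hd : Γ.IsDeterministic) {l l' : List Γ.V} {T T' : Set Γ.E}
    (h : Γ.TreeStage ord l T) (h' : Γ.TreeStage ord l' T') (hl : l.length = l'.length) :
    l = l' ∧ T = T' := by
  induction h generalizing l' T' with
  | start => cases h' with
    | start => exact ⟨rfl, rfl⟩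
    | grow => simp at hl; omega
  | grow l₁ l₂ p T a hst hold hp hnew hsm ih => cases h' with
    | start => simp at hl; omega
    | grow m₁ m₂ q T' b hst' hold' hq hnew' hsm' =>
      obtain ⟨he, rfl⟩ := ih hst' (by simp at hl ⊢; omega)
      obtain ⟨rfl, rfl, rfl⟩ := eq_split_of_first
        (P := fun v => ∃ c : Γ.Arc, Γ.origin c = v ∧ Γ.terminus c ∉ l₁ ++ p :: l₂) he
        ⟨a, hp, hnew⟩ ⟨b, hq, he ▸ hnew'⟩ (fun z hz ⟨c, hc, hc'⟩ => hc' (hold c (hc ▸ hz)))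
        (fun z hz ⟨c, hc, hc'⟩ => (he ▸ hc') (hold' c (hc ▸ hz)))
      obtain rfl : a = b := hd a b (hp.trans hq.symm)
        (ord.le_antisymm _ _ (hsm b hq hnew') (hsm' a hp hnew))
      exact ⟨rfl, rfl⟩

theorem TreeStage.prefix (hd : Γ.IsDeterministic) {l l' : List Γ.V} {T T' : Set Γ.E}
    (h : Γ.TreeStage ord l T) (h' : Γ.TreeStage ord l' T') (hl : l.length ≤ l'.length) :
    l <+: l' ∧ T ⊆ T' := by
  induction h' with
  | start =>
    obtain ⟨rfl, rfl⟩ := h.unique hd .start (le_antisymm hl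
      (List.length_pos_of_mem h.base_mem))
    simp
  | grow l₁ l₂ p T' a hst hold hp hnew hsm ih =>
    rcases Nat.lt_or_ge (l₁ ++ p :: l₂).length l.length with hlt | hge
    · obtain ⟨rfl, rfl⟩ := h.unique hd (.grow l₁ l₂ p T' a hst hold hp hnew hsm)
        (le_antisymm hl (by simp at hlt ⊢; omega))
      simp
    · obtain ⟨h₁, h₂⟩ := ih hge
      exact ⟨h₁.trans (List.prefix_append _ _), h₂.trans (Set.subset_insert _ _)⟩

/-- Finiteness of `X` provides a smallest letter among the arcs leaving the oldest unfinished
vertex. -/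
theorem TreeStage.exists_grow [Finite X] {l : List Γ.V} {T : Set Γ.E}
    (h : Γ.TreeStage ord l T) (hex : ∃ a : Γ.Arc, Γ.origin a ∈ l ∧ Γ.terminus a ∉ l) :
    ∃ (l₁ l₂ : List Γ.V) (a : Γ.Arc), l = l₁ ++ Γ.origin a :: l₂ ∧
      (∀ b : Γ.Arc, Γ.origin b ∈ l₁ → Γ.terminus b ∈ l) ∧ Γ.terminus a ∉ l ∧
      Γ.TreeStage ord (l ++ [Γ.terminus a]) (insert a.1 T) := by
  obtain ⟨a₀, ha₀, ha₀'⟩ := hex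
  obtain ⟨l₁, p, l₂, rfl, ⟨a₁, rfl, ha₁⟩, hold⟩ := exists_split_first
    (P := fun v => ∃ c : Γ.Arc, Γ.origin c = v ∧ Γ.terminus c ∉ l) ⟨_, ha₀, a₀, rfl, ha₀'⟩
  set l := l₁ ++ Γ.origin a₁ :: l₂ with hl
  have hold' : ∀ b : Γ.Arc, Γ.origin b ∈ l₁ → Γ.terminus b ∈ l := fun b hb => by
    by_contra hb'
    exact hold _ hb ⟨b, rfl, hb'⟩
  let S : Set (X × Bool) := Γ.letter '' {b | Γ.origin b = Γ.origin a₁ ∧ Γ.terminus b ∉ l}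
  obtain ⟨_, ⟨a, ⟨ha, ha'⟩, rfl⟩, hmin⟩ := @Set.exists_min_image _ _ ord S id S.toFinite
    ⟨_, a₁, ⟨rfl, ha₁⟩, rfl⟩
  refine ⟨l₁, l₂, a, by rw [ha], hold', ha', ?_⟩
  exact .grow l₁ l₂ _ T a h hold' ha ha' fun b hb hb' => hmin _ ⟨b, ⟨hb, hb'⟩, rfl⟩

theorem finite_arcs_of_origin_mem [Finite X] (hd : Γ.IsDeterministic) {S : Set Γ.V}
    (hS : S.Finite) : {b : Γ.Arc | Γ.origin b ∈ S}.Finite := by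
  refine Set.Finite.of_injOn (f := fun b => (Γ.origin b, Γ.letter b)) (t := S ×ˢ Set.univ) ?_ ?_
    (hS.prod Set.finite_univ)
  · exact fun b hb => ⟨hb, trivial⟩
  · intro b _ c _ hbc
    simp only [Prod.mk.injEq] at hbc
    exact hd _ _ hbc.1 hbc.2

/-- Every vertex is reached by the order tree. -/
theorem exists_treeStage_mem [Finite X] (hd : Γ.IsDeterministic)
    (hc : ∀ v, ∃ l, Γ.IsWalk Γ.base l v) (ord : LinearOrder (X × Bool)) (v : Γ.V) :
    ∃ l T, Γ.TreeStage ord l T ∧ v ∈ l := by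
  suffices key : ∀ a : Γ.Arc, (∃ l T, Γ.TreeStage ord l T ∧ Γ.origin a ∈ l) →
      ∃ l T, Γ.TreeStage ord l T ∧ Γ.terminus a ∈ l by
    obtain ⟨m, hm⟩ := hc v
    have : ∀ p, (∃ l T, Γ.TreeStage ord l T ∧ p ∈ l) → Γ.IsWalk p m v →
        ∃ l T, Γ.TreeStage ord l T ∧ v ∈ l := by
      clear hm
      induction m with
      | nil => rintro p hp rfl; exact hp
      | cons a m ih => rintro p hp ⟨rfl, h⟩; exact ih _ (key a hp) h
    exact this _ ⟨_, _, .start, by simp⟩ hm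
  rintro a ⟨l, T, hst, ha⟩
  by_contra hno
  push Not at hno
  -- If the end of `a` is never reached, the origin of `a` stays unfinished, so growth never stops
  -- and only ever uses vertices of `l` as origins. All later vertices are then ends of arcs issuing
  -- from `l`, and there are finitely many of these.
  have grow : ∀ n, ∃ l' T', Γ.TreeStage ord l' T' ∧ l'.length = l.length + n ∧ l <+: l' ∧
      ∀ v ∈ l', v ∈ l ∨ ∃ b : Γ.Arc, Γ.origin b ∈ l ∧ Γ.terminus b = v := by
    intro n
    induction n with
    | zero => exact ⟨l, T, hst, rfl, List.prefix_rfl, fun v hv => .inl hv⟩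
    | succ n ih =>
      obtain ⟨l', T', hst', hlen, hpre, hv⟩ := ih
      obtain ⟨l₁, l₂, b, hl', hold, hnew, hst''⟩ := hst'.exists_grow
        ⟨a, hpre.subset ha, hno _ _ hst'⟩
      have hal₁ : Γ.origin a ∉ l₁ := fun h => hno _ _ hst' (hold a h)
      have hb : Γ.origin b ∈ l := by
        obtain ⟨r, hr⟩ := hpre
        rw [← hr] at hl'
        rcases List.append_eq_append_iff.1 hl' with ⟨s, rfl, -⟩ | ⟨s, rfl, hs⟩
        · exact absurd (List.mem_append_left _ ha) hal₁
        · cases s with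
          | nil => simp only [List.append_nil] at ha; exact absurd ha hal₁
          | cons c s =>
            simp only [List.cons_append, List.cons.injEq] at hs
            rw [hs.1]; simp
      refine ⟨_, _, hst'', by simp [hlen, add_assoc], hpre.trans (List.prefix_append _ _), ?_⟩
      intro v hv'
      rcases List.mem_append.1 hv' with h | h
      · exact hv v h
      · exact .inr ⟨b, hb, (by simpa using h : v = _).symm⟩
  have hfin : ({v | v ∈ l} ∪ Γ.terminus '' {b | Γ.origin b ∈ {v | v ∈ l}}).Finite :=
    l.finite_toSet.union ((finite_arcs_of_origin_mem hd l.finite_toSet).image _)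
  obtain ⟨l', T', hst', hlen, -, hv⟩ := grow (hfin.toFinset.card + 1)
  classical
  have h₁ : l'.toFinset ⊆ hfin.toFinset := by
    intro v hv'
    rw [Set.Finite.mem_toFinset]
    rcases hv v (List.mem_toFinset.1 hv') with h | ⟨b, h, h'⟩
    · exact .inl h
    · exact .inr ⟨b, h, h'⟩
  have h₂ := Finset.card_le_card h₁
  rw [List.toFinset_card_of_nodup hst'.nodup] at h₂
  omega

/-- Stages form a chain under inclusion, so finitely many tree arcs lie in a common stage. -/
theorem exists_treeStage_of_forall_mem (hd : Γ.IsDeterministic) {l : List Γ.E}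
    (hl : ∀ e ∈ l, e ∈ Γ.orderTree ord) :
    ∃ m T, Γ.TreeStage ord m T ∧ ∀ e ∈ l, e ∈ T := by
  induction l with
  | nil => exact ⟨_, _, .start, by simp⟩
  | cons e l ih =>
    obtain ⟨m, T, h, hT⟩ := ih fun e he => hl e (by simp [he])
    obtain ⟨m', T', h', hT'⟩ := hl e (by simp)
    rcases le_total m.length m'.length with hle | hle
    · have := (h.prefix hd h' hle).2
      refine ⟨m', T', h', ?_⟩
      rintro e he
      rcases List.mem_cons.1 he with rfl | he
      · exact hT'
      · exact this (hT e he)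
    · have := (h'.prefix hd h hle).2 hT'
      refine ⟨m, T, h, ?_⟩
      rintro e he
      rcases List.mem_cons.1 he with rfl | he
      · exact this
      · exact hT e he

theorem IsTreeWalk.mono {T T' : Set Γ.E} (hT : T ⊆ T') {p q : Γ.V} {l : List Γ.Arc}
    (h : Γ.IsTreeWalk T p l q) : Γ.IsTreeWalk T' p l q :=
  ⟨h.1, h.2.1, fun a ha => hT (h.2.2 a ha)⟩

theorem exists_isTreeWalk [Finite X] (hd : Γ.IsDeterministic)
    (hc : ∀ v, ∃ l, Γ.IsWalk Γ.base l v) (ord : LinearOrder (X × Bool)) (v : Γ.V) :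
    ∃ l, Γ.IsTreeWalk (Γ.orderTree ord) Γ.base l v := by
  obtain ⟨l, T, h, hv⟩ := exists_treeStage_mem hd hc ord v
  obtain ⟨m, hm⟩ := h.exists_treeWalk v hv
  exact ⟨m, hm.mono (T' := Γ.orderTree ord) fun e he => ⟨l, T, h, he⟩⟩

theorem IsTreeWalk.reverse {T : Set Γ.E} {p q : Γ.V} {l : List Γ.Arc}
    (h : Γ.IsTreeWalk T p l q) : Γ.IsTreeWalk T q (l.map Γ.invArc).reverse p := by
  refine ⟨h.1.reverse, h.2.1.reverse, fun a ha => ?_⟩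
  obtain ⟨b, hb, rfl⟩ := List.mem_map.1 (List.mem_reverse.1 ha)
  exact h.2.2 b hb

/-- A function on positive arcs has a potential along the order tree. -/
theorem exists_potential_orderTree [Finite X] {G : Type*} [Group G] (hd : Γ.IsDeterministic)
    (hc : ∀ v, ∃ l, Γ.IsWalk Γ.base l v) (ord : LinearOrder (X × Bool)) (φ : Γ.E → G) :
    ∃ τ : Γ.V → G, τ Γ.base = 1 ∧ ∀ e ∈ Γ.orderTree ord, τ (Γ.src e) * φ e = τ (Γ.tgt e) := by
  choose m hm using exists_isTreeWalk hd hc ord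
  have key : ∀ s : List Γ.E, (∀ e ∈ s, e ∈ Γ.orderTree ord) →
      ∃ σ : Γ.V → G, σ Γ.base = 1 ∧ ∀ e ∈ s, σ (Γ.src e) * φ e = σ (Γ.tgt e) := by
    intro s hs
    obtain ⟨l, T, h, hT⟩ := exists_treeStage_of_forall_mem hd hs
    obtain ⟨σ, h₁, h₂⟩ := h.exists_potential φ
    exact ⟨σ, h₁, fun e he => h₂ e (hT e he)⟩
  -- A potential is available only for finitely many tree arcs at a time. It is forced, however, on
  -- every vertex whose chosen tree walk stays within these arcs, so the products along the chosen
  -- walks fit together into a global potential.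
  have key₂ : ∀ σ : Γ.V → G, ∀ s : List Γ.E, σ Γ.base = 1 →
      (∀ e ∈ s, σ (Γ.src e) * φ e = σ (Γ.tgt e)) → ∀ v, (∀ a ∈ m v, a.1 ∈ s) →
      σ v = ((m v).map (arcVal φ)).prod := by
    intro σ s h₁ h₂ v hv
    rw [← (hm v).1.potential (T := {e | e ∈ s}) h₂ hv, h₁, one_mul]
  refine ⟨fun v => ((m v).map (arcVal φ)).prod, ?_, fun e he => ?_⟩
  · obtain ⟨σ, h₁, h₂⟩ := key ((m Γ.base).map Prod.fst) (by
      intro e he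
      obtain ⟨a, ha, rfl⟩ := List.mem_map.1 he
      exact (hm _).2.2 a ha)
    dsimp only
    rw [← key₂ σ _ h₁ h₂ Γ.base (fun a ha => List.mem_map_of_mem ha), h₁]
  · obtain ⟨σ, h₁, h₂⟩ := key (e :: ((m (Γ.src e)).map Prod.fst ++ (m (Γ.tgt e)).map Prod.fst)) (by
      intro e' he'
      simp only [List.mem_cons, List.mem_append, List.mem_map] at he'
      rcases he' with rfl | ⟨a, ha, rfl⟩ | ⟨a, ha, rfl⟩
      · exact he
      · exact (hm _).2.2 a ha
      · exact (hm _).2.2 a ha)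
    dsimp only
    rw [← key₂ σ _ h₁ h₂ (Γ.src e), ← key₂ σ _ h₁ h₂ (Γ.tgt e), h₂ e (by simp)]
    · intro a ha; simp [List.mem_map_of_mem ha]
    · intro a ha; simp [List.mem_map_of_mem ha]

end Tree

end XAutomaton

namespace XAutomaton

variable {X : Type u}

/-! ### Isomorphisms -/

/-- Isomorphisms of pointed automata. -/
structure Iso (Γ : XAutomaton.{u, v} X) (Δ : XAutomaton.{u, w} X) where
  onV : Γ.V ≃ Δ.V
  onE : Γ.E ≃ Δ.E
  map_base : onV Γ.base = Δ.base
  map_src : ∀ e, Δ.src (onE e) = onV (Γ.src e)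
  map_tgt : ∀ e, Δ.tgt (onE e) = onV (Γ.tgt e)
  map_lab : ∀ e, Δ.lab (onE e) = Γ.lab e

namespace Iso

variable {Γ : XAutomaton.{u, v} X} {Δ : XAutomaton.{u, w} X} (f : Iso Γ Δ)

/-- The inverse isomorphism. -/
def symm : Iso Δ Γ where
  onV := f.onV.symm
  onE := f.onE.symm
  map_base := by rw [← f.map_base, Equiv.symm_apply_apply]
  map_src e := by rw [Equiv.eq_symm_apply, ← f.map_src, Equiv.apply_symm_apply]
  map_tgt e := by rw [Equiv.eq_symm_apply, ← f.map_tgt, Equiv.apply_symm_apply]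
  map_lab e := by rw [← f.map_lab, Equiv.apply_symm_apply]

/-- The action on arcs. -/
def arc (a : Γ.Arc) : Δ.Arc := (f.onE a.1, a.2)

theorem arc_injective : Function.Injective f.arc := fun a b h => by
  simp only [arc, Prod.mk.injEq, EmbeddingLike.apply_eq_iff_eq] at h
  exact Prod.ext h.1 h.2

theorem arc_symm_arc (b : Δ.Arc) : f.arc (f.symm.arc b) = b := by simp [arc, symm]

@[simp] theorem origin_arc (a : Γ.Arc) : Δ.origin (f.arc a) = f.onV (Γ.origin a) := by
  rcases a with ⟨e, _ | _⟩
  · exact f.map_tgt e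
  · exact f.map_src e

@[simp] theorem terminus_arc (a : Γ.Arc) : Δ.terminus (f.arc a) = f.onV (Γ.terminus a) := by
  rcases a with ⟨e, _ | _⟩
  · exact f.map_src e
  · exact f.map_tgt e

@[simp] theorem letter_arc (a : Γ.Arc) : Δ.letter (f.arc a) = Γ.letter a := by
  simp [letter, arc, f.map_lab]

theorem invArc_arc (a : Γ.Arc) : Δ.invArc (f.arc a) = f.arc (Γ.invArc a) := rfl

theorem isWalk_map {p q : Γ.V} {l : List Γ.Arc} (h : Γ.IsWalk p l q) :
    Δ.IsWalk (f.onV p) (l.map f.arc) (f.onV q) := by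
  induction l generalizing p with
  | nil => exact congrArg f.onV h
  | cons a l ih => exact ⟨by rw [origin_arc, h.1], by rw [terminus_arc]; exact ih h.2⟩

theorem noBacktrack_map {l : List Γ.Arc} (h : Γ.NoBacktrack l) : Δ.NoBacktrack (l.map f.arc) := by
  unfold NoBacktrack at *
  rw [List.isChain_map]
  refine h.imp fun a b hab => ?_
  rw [invArc_arc]
  exact fun h => hab (f.arc_injective h)

theorem onReducedBaseWalk_map {p : Γ.V} (h : Γ.OnReducedBaseWalk p) :
    Δ.OnReducedBaseWalk (f.onV p) := by
  obtain ⟨l₁, l₂, h₁, h₂, h₃⟩ := h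
  refine ⟨l₁.map f.arc, l₂.map f.arc, ?_, ?_, ?_⟩
  · rw [← f.map_base]; exact f.isWalk_map h₁
  · rw [← f.map_base]; exact f.isWalk_map h₂
  · rw [← List.map_append]; exact f.noBacktrack_map h₃

theorem isDeterministic (f : Iso Γ Δ) (h : Γ.IsDeterministic) : Δ.IsDeterministic := by
  intro a b hab hl
  refine f.symm.arc_injective (h _ _ ?_ ?_)
  · rw [origin_arc, origin_arc, hab]
  · rw [letter_arc, letter_arc, hl]

theorem isCore (f : Iso Γ Δ) (h : Γ.IsCore) : Δ.IsCore := by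
  intro p
  rw [← f.onV.apply_symm_apply p]
  exact f.onReducedBaseWalk_map (h _)

/-- The growth rule mentions only incidence and letters, both preserved by isomorphisms. This makes
the order tree, and hence normalization, an invariant notion. -/
theorem treeStage_map {ord : LinearOrder (X × Bool)} {l : List Γ.V} {T : Set Γ.E}
    (h : Γ.TreeStage ord l T) : Δ.TreeStage ord (l.map f.onV) (f.onE '' T) := by
  induction h with
  | start =>
    rw [Set.image_empty, List.map_singleton, f.map_base]
    exact .start
  | grow l₁ l₂ p T a hst hold hp hnew hsm ih =>
    have mem : ∀ b : Δ.Arc, ∀ l : List Γ.V, Δ.terminus b ∈ l.map f.onV ↔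
        Γ.terminus (f.symm.arc b) ∈ l := by
      intro b l
      conv_lhs => rw [← f.arc_symm_arc b, terminus_arc, List.mem_map_of_injective f.onV.injective]
    rw [Set.image_insert_eq, List.map_append, List.map_append, List.map_cons, List.map_singleton,
      ← terminus_arc]
    rw [List.map_append, List.map_cons] at ih
    refine .grow (l₁.map f.onV) (l₂.map f.onV) (f.onV p) _ (f.arc a) ih ?_ ?_ ?_ ?_
    · intro b hb
      rw [← List.map_cons, ← List.map_append, mem]
      rw [← f.arc_symm_arc b, origin_arc, List.mem_map_of_injective f.onV.injective] at hb
      exact hold _ hb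
    · rw [origin_arc, hp]
    · rw [← List.map_cons, ← List.map_append, terminus_arc,
        List.mem_map_of_injective f.onV.injective]
      exact hnew
    · intro b hb hb'
      rw [← List.map_cons, ← List.map_append, mem] at hb'
      rw [← f.arc_symm_arc b, origin_arc, f.onV.injective.eq_iff] at hb
      have := hsm _ hb hb'
      rwa [letter_arc] at this ⊢

theorem mem_orderTree {ord : LinearOrder (X × Bool)} {e : Γ.E} (h : e ∈ Γ.orderTree ord) :
    f.onE e ∈ Δ.orderTree ord := by
  obtain ⟨l, T, hst, he⟩ := h
  exact ⟨_, _, f.treeStage_map hst, Set.mem_image_of_mem _ he⟩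

theorem mem_orderTree_iff {ord : LinearOrder (X × Bool)} {e : Γ.E} :
    f.onE e ∈ Δ.orderTree ord ↔ e ∈ Γ.orderTree ord := by
  refine ⟨fun h => ?_, f.mem_orderTree⟩
  have := f.symm.mem_orderTree h
  rwa [symm, Equiv.symm_apply_apply] at this

end Iso

/-! ### The core -/

theorem IsCore.exists_walk {Γ : XAutomaton.{u, v} X} (h : Γ.IsCore) (p : Γ.V) :
    ∃ l, Γ.IsWalk Γ.base l p :=
  let ⟨l, _, h, _⟩ := h p
  ⟨l, h⟩

section Core

variable {Γ : XAutomaton.{u, v} X}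

/-- The inclusion of the arcs of the core. -/
def coreArc (a : Γ.core.Arc) : Γ.Arc := (a.1.1, a.2)

theorem coreArc_injective : Function.Injective (coreArc (Γ := Γ)) := fun a b h => by
  simp only [coreArc, Prod.mk.injEq] at h
  exact Prod.ext (Subtype.ext h.1) h.2

theorem origin_coreArc (a : Γ.core.Arc) : Γ.origin (coreArc a) = (Γ.core.origin a).1 := by
  rcases a with ⟨e, _ | _⟩ <;> rfl

theorem terminus_coreArc (a : Γ.core.Arc) : Γ.terminus (coreArc a) = (Γ.core.terminus a).1 := by
  rcases a with ⟨e, _ | _⟩ <;> rfl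

theorem freeLabel_map_coreArc (l : List Γ.core.Arc) :
    Γ.freeLabel (l.map coreArc) = Γ.core.freeLabel l := by
  rw [freeLabel, freeLabel, List.map_map]; rfl

theorem isWalk_map_coreArc {p q : Γ.core.V} {l : List Γ.core.Arc} (h : Γ.core.IsWalk p l q) :
    Γ.IsWalk p.1 (l.map coreArc) q.1 := by
  induction l generalizing p with
  | nil => exact congrArg Subtype.val h
  | cons a l ih =>
    exact ⟨by rw [origin_coreArc, h.1], by rw [terminus_coreArc]; exact ih h.2⟩

theorem noBacktrack_map_coreArc {l : List Γ.core.Arc} :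
    Γ.NoBacktrack (l.map coreArc) ↔ Γ.core.NoBacktrack l := by
  unfold NoBacktrack
  rw [List.isChain_map]
  have : ∀ a b : Γ.core.Arc, coreArc b ≠ Γ.invArc (coreArc a) ↔ b ≠ Γ.core.invArc a := fun a b =>
    (coreArc_injective.ne_iff (y := Γ.core.invArc a))
  simp only [this]

theorem exists_core_walk {p q : Γ.V} {l : List Γ.Arc} (hp : Γ.OnReducedBaseWalk p)
    (hq : Γ.OnReducedBaseWalk q) (h : Γ.IsWalk p l q)
    (hl : ∀ a ∈ l, Γ.OnReducedBaseWalk (Γ.origin a) ∧ Γ.OnReducedBaseWalk (Γ.terminus a)) :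
    ∃ l', Γ.core.IsWalk ⟨p, hp⟩ l' ⟨q, hq⟩ ∧ l'.map coreArc = l := by
  induction l generalizing p with
  | nil => exact ⟨[], Subtype.ext h, rfl⟩
  | cons a l ih =>
    have ha := hl a (by simp)
    obtain ⟨l', h', rfl⟩ := ih ha.2 h.2 fun b hb => hl b (by simp [hb])
    let a' : Γ.core.Arc := (⟨a.1, mem_ends_of_arc ha.1 ha.2⟩, a.2)
    refine ⟨a' :: l', ⟨?_, ?_⟩, rfl⟩
    · refine Subtype.ext ?_
      rw [← origin_coreArc]
      exact h.1
    · have : Γ.core.terminus a' = ⟨Γ.terminus a, ha.2⟩ := by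
        refine Subtype.ext ?_
        rw [← terminus_coreArc]
        rfl
      rw [this]
      exact h'

theorem exists_core_closed {l : List Γ.Arc} (h : Γ.IsWalk Γ.base l Γ.base)
    (hn : Γ.NoBacktrack l) :
    ∃ l', Γ.core.IsWalk Γ.core.base l' Γ.core.base ∧ l'.map coreArc = l :=
  exists_core_walk _ _ h fun _ ha => onReducedBaseWalk_of_mem h hn ha

theorem isDeterministic_core (hd : Γ.IsDeterministic) : Γ.core.IsDeterministic := by
  intro a b hab hl
  refine coreArc_injective (hd _ _ ?_ hl)
  rw [origin_coreArc, origin_coreArc, hab]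

/-- A reduced closed walk that witnesses a vertex also witnesses all vertices it meets, so it lies
inside the core. -/
theorem isCore_core (Γ : XAutomaton.{u, v} X) : Γ.core.IsCore := by
  rintro ⟨p, l₁, l₂, h₁, h₂, hn⟩
  have hl : ∀ a ∈ l₁ ++ l₂, _ := fun a ha => onReducedBaseWalk_of_mem (h₁.append h₂) hn ha
  obtain ⟨l₁', h₁', rfl⟩ := exists_core_walk Γ.onReducedBaseWalk_base ⟨l₁, l₂, h₁, h₂, hn⟩ h₁
    fun a ha => hl a (List.mem_append_left _ ha)
  obtain ⟨l₂', h₂', rfl⟩ := exists_core_walk ⟨_, l₂, h₁, h₂, hn⟩ Γ.onReducedBaseWalk_base h₂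
    fun a ha => hl a (List.mem_append_right _ ha)
  refine ⟨l₁', l₂', h₁', h₂', ?_⟩
  rwa [← List.map_append, noBacktrack_map_coreArc] at hn

end Core

/-! ### The Schreier automaton -/

section Schreier

variable (K : Subgroup (FreeGroup X))

/-- The coset `Kg` as a vertex of the Schreier automaton. -/
def coset (g : FreeGroup X) : (schreier K).V := Quotient.mk _ g

variable {K}

theorem coset_eq_iff {g g' : FreeGroup X} : coset K g = coset K g' ↔ g' * g⁻¹ ∈ K := by
  exact (Quotient.eq (r := QuotientGroup.rightRel K)).trans QuotientGroup.rightRel_apply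

theorem exists_coset (v : (schreier K).V) : ∃ g, v = coset K g :=
  Quotient.inductionOn v fun g => ⟨g, rfl⟩

theorem base_schreier : (schreier K).base = coset K 1 := rfl

theorem terminus_schreier {a : (schreier K).Arc} {g : FreeGroup X}
    (h : (schreier K).origin a = coset K g) :
    (schreier K).terminus a = coset K (g * FreeGroup.mk [(schreier K).letter a]) := by
  rcases a with ⟨⟨p, x⟩, _ | _⟩
  · obtain ⟨g', rfl⟩ := exists_coset p
    change coset K (g' * FreeGroup.of x) = coset K g at h
    change coset K g' = coset K (g * (FreeGroup.of x)⁻¹)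
    rw [coset_eq_iff] at h ⊢
    simpa [mul_assoc] using h
  · obtain rfl : p = coset K g := h
    rfl

theorem isWalk_schreier {g : FreeGroup X} {l : List (schreier K).Arc} {q : (schreier K).V}
    (h : (schreier K).IsWalk (coset K g) l q) : q = coset K (g * (schreier K).freeLabel l) := by
  induction l generalizing g with
  | nil =>
    obtain rfl : coset K g = q := h
    exact congrArg _ (mul_one g).symm
  | cons a l ih =>
    have h₂ := h.2
    rw [terminus_schreier h.1] at h₂
    rw [ih h₂, ← List.singleton_append (l := l), freeLabel_append, mul_assoc]
    rfl

/-- The Schreier automaton is complete: every letter can be read from every coset. -/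
theorem exists_walk_schreier (g : FreeGroup X) (w : List (X × Bool)) :
    ∃ l, (schreier K).IsWalk (coset K g) l (coset K (g * FreeGroup.mk w)) ∧
      l.map (schreier K).letter = w := by
  induction w generalizing g with
  | nil => exact ⟨[], congrArg _ (mul_one g).symm, rfl⟩
  | cons y w ih =>
    obtain ⟨l, hl, rfl⟩ := ih (g * FreeGroup.mk [y])
    have : ∃ a : (schreier K).Arc, (schreier K).origin a = coset K g ∧
        (schreier K).letter a = y := by
      rcases y with ⟨x, _ | _⟩
      · refine ⟨((coset K (g * (FreeGroup.of x)⁻¹), x), false), ?_, rfl⟩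
        change coset K (g * (FreeGroup.of x)⁻¹ * FreeGroup.of x) = _
        rw [inv_mul_cancel_right]
      · exact ⟨((coset K g, x), true), rfl, rfl⟩
    obtain ⟨a, ha, rfl⟩ := this
    refine ⟨a :: l, ⟨ha, ?_⟩, rfl⟩
    rw [terminus_schreier ha]
    convert hl using 2
    rw [mul_assoc, FreeGroup.mul_mk]
    rfl

theorem isDeterministic_schreier : (schreier K).IsDeterministic := by
  rintro ⟨⟨p, x⟩, s⟩ ⟨⟨q, y⟩, t⟩ ho hl
  obtain ⟨rfl, rfl⟩ : x = y ∧ s = t := by simpa [letter, schreier] using hl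
  obtain ⟨g, rfl⟩ := exists_coset p
  obtain ⟨g', rfl⟩ := exists_coset q
  cases s
  · change coset K (g * FreeGroup.of x) = coset K (g' * FreeGroup.of x) at ho
    rw [coset_eq_iff] at ho
    have : coset K g = coset K g' := coset_eq_iff.2 (by simpa [mul_assoc] using ho)
    rw [this]
  · change coset K g = coset K g' at ho
    rw [ho]

theorem freeLabel_mem_of_closed {l : List (schreier K).Arc}
    (h : (schreier K).IsWalk (schreier K).base l (schreier K).base) :
    (schreier K).freeLabel l ∈ K := by
  have := isWalk_schreier (g := 1) h
  rw [base_schreier, coset_eq_iff] at this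
  simpa using this

theorem exists_closed_of_mem {g : FreeGroup X} (hg : g ∈ K) :
    ∃ l, (schreier K).IsWalk (schreier K).base l (schreier K).base ∧
      (schreier K).NoBacktrack l ∧ (schreier K).freeLabel l = g := by
  classical
  obtain ⟨l, hl, hw⟩ := exists_walk_schreier (K := K) 1 g.toWord
  refine ⟨l, ?_, noBacktrack_of_isReduced (by rw [hw]; exact FreeGroup.isReduced_toWord), ?_⟩
  · have : coset K (1 * FreeGroup.mk g.toWord) = coset K 1 := by
      rw [FreeGroup.mk_toWord, one_mul, eq_comm, coset_eq_iff]
      simpa using hg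
    rwa [this] at hl
  · rw [freeLabel, hw, FreeGroup.mk_toWord]

theorem freeLabel_mem_of_core_closed {l : List (schreier K).core.Arc}
    (h : (schreier K).core.IsWalk (schreier K).core.base l (schreier K).core.base) :
    (schreier K).core.freeLabel l ∈ K := by
  rw [← freeLabel_map_coreArc]
  exact freeLabel_mem_of_closed (isWalk_map_coreArc h)

theorem exists_core_closed_of_mem {g : FreeGroup X} (hg : g ∈ K) :
    ∃ l, (schreier K).core.IsWalk (schreier K).core.base l (schreier K).core.base ∧
      (schreier K).core.NoBacktrack l ∧ (schreier K).core.freeLabel l = g := by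
  obtain ⟨l, hl, hn, hf⟩ := exists_closed_of_mem hg
  obtain ⟨l', hl', rfl⟩ := exists_core_closed hl hn
  exact ⟨l', hl', noBacktrack_map_coreArc.1 hn, by rw [← freeLabel_map_coreArc, hf]⟩

end Schreier

end XAutomaton

namespace EnrichedAutomaton

open XAutomaton

variable {X : Type u} {A : Type w} [AddCommGroup A]

/-! ### Petals generate the subgroup recognized by a normalized automaton -/

section Normalized

variable {Γ : EnrichedAutomaton.{u, v, w} X A}

theorem arcLabel_invArc (a : Γ.Arc) : Γ.arcLabel (Γ.invArc a) = (Γ.arcLabel a)⁻¹ := by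
  rcases a with ⟨e, _ | _⟩ <;> simp [arcLabel, invArc, mul_comm]

theorem walkLabel_append (l₁ l₂ : List Γ.Arc) :
    Γ.walkLabel (l₁ ++ l₂) = Γ.walkLabel l₁ * Γ.walkLabel l₂ := by simp [walkLabel]

theorem walkLabel_cons (a : Γ.Arc) (l : List Γ.Arc) :
    Γ.walkLabel (a :: l) = Γ.arcLabel a * Γ.walkLabel l := by simp [walkLabel]

theorem fst_arcLabel (a : Γ.Arc) :
    (Γ.arcLabel a).1 = arcVal (fun e => FreeGroup.of (Γ.lab e)) a := by
  rcases a with ⟨e, _ | _⟩ <;> simp [arcLabel, arcVal]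

theorem fst_walkLabel (l : List Γ.Arc) : (Γ.walkLabel l).1 = Γ.freeLabel l := by
  rw [freeLabel_eq_prod]
  induction l with
  | nil => rfl
  | cons a l ih => rw [walkLabel_cons, Prod.fst_mul, ih, fst_arcLabel, List.map_cons,
      List.prod_cons]

theorem walkLabel_eq_of_tree {T : Set Γ.E} (hT : ∀ e ∈ T, Γ.lab₂ e = 0) (h₁ : ∀ e, Γ.lab₁ e = 0)
    {l : List Γ.Arc} (hl : ∀ a ∈ l, a.1 ∈ T) : Γ.walkLabel l = (Γ.freeLabel l, 1) := by
  refine Prod.ext (fst_walkLabel l) ?_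
  induction l with
  | nil => rfl
  | cons a l ih =>
    rw [walkLabel_cons, Prod.snd_mul, ih fun b hb => hl b (by simp [hb])]
    have := hT a.1 (hl a (by simp))
    rcases a with ⟨e, _ | _⟩ <;> simp_all [arcLabel]

/-- A potential for the free labels along `T`. -/
def IsPotential (Γ : EnrichedAutomaton.{u, v, w} X A) (T : Set Γ.E) (τ : Γ.V → FreeGroup X) :
    Prop :=
  τ Γ.base = 1 ∧ ∀ e ∈ T, τ (Γ.src e) * FreeGroup.of (Γ.lab e) = τ (Γ.tgt e)

theorem IsNormalized.exists_isPotential [Finite X] {ord : LinearOrder (X × Bool)}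
    (h : Γ.IsNormalized ord) : ∃ τ, Γ.IsPotential (Γ.orderTree ord) τ :=
  exists_potential_orderTree h.1.1 h.1.2.exists_walk ord _

/-- The element read along the petal of `e`, when the initial labels are zero. -/
def petalLabel (Γ : EnrichedAutomaton.{u, v, w} X A) (τ : Γ.V → FreeGroup X) (e : Γ.E) :
    FreeGroup X × Multiplicative A :=
  (τ (Γ.src e) * FreeGroup.of (Γ.lab e) * (τ (Γ.tgt e))⁻¹, Multiplicative.ofAdd (Γ.lab₂ e))

theorem IsPotential.freeLabel {T : Set Γ.E} {τ : Γ.V → FreeGroup X} (hτ : Γ.IsPotential T τ)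
    {p q : Γ.V} {l : List Γ.Arc} (h : Γ.IsTreeWalk T p l q) :
    Γ.freeLabel l = (τ p)⁻¹ * τ q := by
  rw [freeLabel_eq_prod, ← h.1.potential hτ.2 h.2.2, inv_mul_cancel_left]

/-- The right-hand side does not involve `l`: all petals of an arc have the same free label. -/
theorem IsPotential.freeLabel_petal {T : Set Γ.E} {τ : Γ.V → FreeGroup X}
    (hτ : Γ.IsPotential T τ) {e : Γ.E} {l : List Γ.Arc} (h : Γ.IsPetal T e l) :
    Γ.freeLabel l = (Γ.petalLabel τ e).1 := by
  obtain ⟨l₁, l₂, h₁, h₂, rfl⟩ := h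
  rw [freeLabel_append, ← List.singleton_append, freeLabel_append, hτ.freeLabel h₁,
    hτ.freeLabel h₂, hτ.1]
  change _ * (FreeGroup.of _ * _) = τ (Γ.src e) * FreeGroup.of (Γ.lab e) * (τ (Γ.tgt e))⁻¹
  simp [mul_assoc]

theorem isWalk_of_isPetal {T : Set Γ.E} {e : Γ.E} {l : List Γ.Arc} (h : Γ.IsPetal T e l) :
    Γ.IsWalk Γ.base l Γ.base := by
  obtain ⟨l₁, l₂, h₁, h₂, rfl⟩ := h
  exact h₁.1.append ⟨rfl, h₂.1⟩

theorem walkLabel_petal {T : Set Γ.E} {τ : Γ.V → FreeGroup X}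
    (hτ : Γ.IsPotential T τ) (hN : Γ.IsNormalizedWrt T) {e : Γ.E} {l : List Γ.Arc}
    (h : Γ.IsPetal T e l) : Γ.walkLabel l = Γ.petalLabel τ e := by
  refine Prod.ext ((fst_walkLabel l).trans (hτ.freeLabel_petal h)) ?_
  obtain ⟨l₁, l₂, h₁, h₂, rfl⟩ := h
  rw [walkLabel_append, walkLabel_cons, walkLabel_eq_of_tree hN.2.2 hN.2.1 h₁.2.2,
    walkLabel_eq_of_tree hN.2.2 hN.2.1 h₂.2.2]
  simp [arcLabel, petalLabel, hN.2.1 e]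

theorem IsNormalized.exists_isPetal [Finite X] {ord : LinearOrder (X × Bool)}
    (h : Γ.IsNormalized ord) (e : Γ.E) : ∃ l, Γ.IsPetal (Γ.orderTree ord) e l := by
  obtain ⟨l₁, h₁⟩ := exists_isTreeWalk h.1.1 h.1.2.exists_walk ord (Γ.src e)
  obtain ⟨l₂, h₂⟩ := exists_isTreeWalk h.1.1 h.1.2.exists_walk ord (Γ.tgt e)
  exact ⟨_, l₁, _, h₁, h₂.reverse, rfl⟩

theorem walkLabel_mem_recognized {l : List Γ.Arc} (h : Γ.IsWalk Γ.base l Γ.base) :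
    Γ.walkLabel l ∈ Γ.recognized :=
  ⟨l, h, 0, zero_mem _, (mul_one _).symm⟩

theorem baseSubgroup_mem_recognized {c : A} (hc : c ∈ Γ.baseSubgroup) :
    ((1, Multiplicative.ofAdd c) : FreeGroup X × Multiplicative A) ∈ Γ.recognized :=
  ⟨[], rfl, c, hc, by simp [walkLabel]⟩

theorem recognized_le_of_closed {M : Subgroup (FreeGroup X × Multiplicative A)}
    (hM : ∀ l, Γ.IsWalk Γ.base l Γ.base → Γ.walkLabel l ∈ M)
    (hL : ∀ c ∈ Γ.baseSubgroup, (1, Multiplicative.ofAdd c) ∈ M) : Γ.recognized ≤ M := by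
  rintro _ ⟨l, hl, c, hc, rfl⟩
  exact mul_mem (hM l hl) (hL c hc)

/-- The argument behind Schreier generators: a walk label, conjugated by transversal elements at its
ends, telescopes into a product of conjugated arc labels. It is used both with tree potentials and
with labels of short walks. -/
theorem conj_walkLabel_mem {M : Subgroup (FreeGroup X × Multiplicative A)}
    (σ : Γ.V → FreeGroup X × Multiplicative A)
    (hσ : ∀ e, σ (Γ.src e) * Γ.arcLabel (e, true) * (σ (Γ.tgt e))⁻¹ ∈ M) {p q : Γ.V}
    {l : List Γ.Arc} (h : Γ.IsWalk p l q) : σ p * Γ.walkLabel l * (σ q)⁻¹ ∈ M := by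
  induction l generalizing p with
  | nil =>
    obtain rfl : p = q := h
    simp [walkLabel]
  | cons a l ih =>
    have key : σ (Γ.origin a) * Γ.arcLabel a * (σ (Γ.terminus a))⁻¹ ∈ M := by
      rcases a with ⟨e, _ | _⟩
      · have := inv_mem (hσ e)
        rw [mul_inv_rev, mul_inv_rev, inv_inv, ← mul_assoc, ← arcLabel_invArc] at this
        exact this
      · exact hσ e
    have := mul_mem key (ih h.2)
    rw [h.1] at this
    rw [walkLabel_cons]
    simpa [mul_assoc] using this

/-- With the potential as transversal, tree arcs contribute 1 and every other arc contributes its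
petal label. -/
theorem recognized_le {T : Set Γ.E} {τ : Γ.V → FreeGroup X}
    (hτ : Γ.IsPotential T τ) (hN : Γ.IsNormalizedWrt T)
    {M : Subgroup (FreeGroup X × Multiplicative A)} (hM : ∀ e ∉ T, Γ.petalLabel τ e ∈ M)
    (hL : ∀ c ∈ Γ.baseSubgroup, (1, Multiplicative.ofAdd c) ∈ M) : Γ.recognized ≤ M := by
  refine recognized_le_of_closed (fun l hl => ?_) hL
  have := conj_walkLabel_mem (M := M) (fun v => (τ v, 1)) (fun e => ?_) hl
  · simpa [hτ.1, ← Prod.one_eq_mk] using this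
  · have he : (τ (Γ.src e), 1) * Γ.arcLabel (e, true) * (τ (Γ.tgt e), 1)⁻¹ =
        Γ.petalLabel τ e := by
      simp [arcLabel, petalLabel, hN.2.1 e]
    rw [he]
    by_cases heT : e ∈ T
    · have : Γ.petalLabel τ e = 1 := by
        simp [petalLabel, hN.2.2 e heT, hτ.2 e heT]
      rw [this]
      exact one_mem _
    · exact hM e heT

end Normalized

/-! ### The Stallings automaton recognizes the subgroup it comes from -/

section Stallings

variable {ord : LinearOrder (X × Bool)} {H : Subgroup (FreeGroup X × Multiplicative A)}

theorem isNormalized_stallings : (stallings ord H).IsNormalized ord :=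
  ⟨⟨isDeterministic_core isDeterministic_schreier, isCore_core _⟩, fun _ => rfl,
    fun _ he => if_pos he⟩

theorem mem_baseSubgroup_stallings {c : A} :
    c ∈ (stallings ord H).baseSubgroup ↔ (1, Multiplicative.ofAdd c) ∈ H := Iff.rfl

theorem freeLabel_stallings_mem {l : List (stallings ord H).Arc}
    (hl : (stallings ord H).IsWalk (stallings ord H).base l (stallings ord H).base) :
    ∃ c : A, ((stallings ord H).freeLabel l, Multiplicative.ofAdd c) ∈ H := by
  have hu : (stallings ord H).freeLabel l ∈ H.map (MonoidHom.fst _ _) :=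
    freeLabel_mem_of_core_closed hl
  obtain ⟨⟨u, c⟩, hc, hu⟩ := hu
  exact ⟨c.toAdd, by rw [← hu]; exact hc⟩

theorem exists_closed_stallings {h : FreeGroup X × Multiplicative A} (hh : h ∈ H) :
    ∃ l : List (stallings ord H).Arc,
      (stallings ord H).IsWalk (stallings ord H).base l (stallings ord H).base ∧
      (stallings ord H).NoBacktrack l ∧ (stallings ord H).freeLabel l = h.1 := by
  have hu : h.1 ∈ H.map (MonoidHom.fst _ _) := Subgroup.mem_map_of_mem (MonoidHom.fst _ _) hh
  obtain ⟨l, hl, hn, hf⟩ := exists_core_closed_of_mem hu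
  exact ⟨l, hl, hn, hf⟩

theorem lab₂_stallings_spec {e : (stallings ord H).E}
    (he : e ∉ (stallings ord H).orderTree ord)
    (hex : ∃ c : A, ∃ l : List (stallings ord H).Arc,
      (stallings ord H).IsPetal ((stallings ord H).orderTree ord) e l ∧
        ((stallings ord H).freeLabel l, Multiplicative.ofAdd c) ∈ H) :
    ∃ l : List (stallings ord H).Arc,
      (stallings ord H).IsPetal ((stallings ord H).orderTree ord) e l ∧
        ((stallings ord H).freeLabel l, Multiplicative.ofAdd ((stallings ord H).lab₂ e)) ∈ H := by
  have h := Classical.epsilon_spec hex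
  have hlab : (stallings ord H).lab₂ e = _ := @if_neg _ (Classical.propDecidable _) he A 0
    (Classical.epsilon fun c : A => ∃ l : List (stallings ord H).Arc,
        (stallings ord H).IsPetal ((stallings ord H).orderTree ord) e l ∧
          ((stallings ord H).freeLabel l, Multiplicative.ofAdd c) ∈ H)
  rw [← hlab] at h
  exact h

/-- A petal is a closed walk, so its free label lies in the projection of `H` and some admissible
`c` exists. The petal for which the choice was made may differ from any other one, but their free
labels agree. -/
theorem petalLabel_stallings_mem [Finite X] {τ : (stallings ord H).V → FreeGroup X}
    (hτ : (stallings ord H).IsPotential ((stallings ord H).orderTree ord) τ)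
    {e : (stallings ord H).E} (he : e ∉ (stallings ord H).orderTree ord) :
    (stallings ord H).petalLabel τ e ∈ H := by
  obtain ⟨l, hl⟩ := (isNormalized_stallings (ord := ord) (H := H)).exists_isPetal e
  obtain ⟨c, hc⟩ := freeLabel_stallings_mem (isWalk_of_isPetal hl)
  obtain ⟨l', hl', hmem⟩ := lab₂_stallings_spec he ⟨c, l, hl, hc⟩
  rw [hτ.freeLabel_petal hl'] at hmem
  exact hmem

/-- One inclusion holds because all generators lie in `H`. Conversely, an element of `H` and the
label of a closed walk with the same free part differ by an element of `H ∩ A`, which is the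
basepoint subgroup. -/
theorem recognized_stallings [Finite X] : (stallings ord H).recognized = H := by
  obtain ⟨τ, hτ⟩ := (isNormalized_stallings (ord := ord) (H := H)).exists_isPotential
  have hle : (stallings ord H).recognized ≤ H :=
    recognized_le hτ isNormalized_stallings (fun e he => petalLabel_stallings_mem hτ he)
      fun c hc => hc
  refine le_antisymm hle ?_
  rintro ⟨u, c⟩ h
  obtain ⟨l, hl, -, hu⟩ := exists_closed_stallings (ord := ord) h
  have hw := walkLabel_mem_recognized hl
  obtain ⟨d, hd⟩ : ∃ d, (stallings ord H).walkLabel l = (u, d) :=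
    ⟨((stallings ord H).walkLabel l).2, Prod.ext ((fst_walkLabel l).trans hu) rfl⟩
  rw [hd] at hw
  have : (1, Multiplicative.ofAdd (c.toAdd - d.toAdd)) ∈ H := by
    simpa [ofAdd_sub, div_eq_mul_inv, mul_comm] using mul_mem (inv_mem (hle hw)) h
  have := mul_mem hw (baseSubgroup_mem_recognized (mem_baseSubgroup_stallings.2 this))
  simpa [ofAdd_sub] using this

end Stallings

end EnrichedAutomaton

/-! ### Reduced automata and the subgroup of the free group they recognize -/

namespace XAutomaton

variable {X : Type u} {Γ : XAutomaton.{u, v} X} {K : Subgroup (FreeGroup X)}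

/-- `Γ` recognizes `K` as its set of free labels of closed walks at the basepoint. -/
def Recognizes (Γ : XAutomaton.{u, v} X) (K : Subgroup (FreeGroup X)) : Prop :=
  ∀ u, u ∈ K ↔ ∃ l, Γ.IsWalk Γ.base l Γ.base ∧ Γ.freeLabel l = u

theorem Recognizes.exists_noBacktrack (hK : Γ.Recognizes K) {u : FreeGroup X} (hu : u ∈ K) :
    ∃ l, Γ.IsWalk Γ.base l Γ.base ∧ Γ.NoBacktrack l ∧ Γ.freeLabel l = u := by
  obtain ⟨l, hl, rfl⟩ := (hK u).1 hu
  obtain ⟨l', hl', hn, -, hf⟩ := hl.exists_noBacktrack_freeLabel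
  exact ⟨l', hl', hn, hf⟩

/-! ### Comparison with the core of the Schreier automaton -/

/-- The map to the arcs of the Schreier automaton determined by a choice of labels of walks from
the basepoint. -/
def toSchreierArc (K : Subgroup (FreeGroup X)) (σ : Γ.V → FreeGroup X) (a : Γ.Arc) :
    (schreier K).Arc := ((coset K (σ (Γ.src a.1)), Γ.lab a.1), a.2)

section Compare

variable {σ : Γ.V → FreeGroup X}

theorem freeLabel_toSchreierArc (l : List Γ.Arc) :
    (schreier K).freeLabel (l.map (toSchreierArc K σ)) = Γ.freeLabel l := by
  rw [freeLabel, freeLabel, List.map_map]; rfl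

/-- Going to `p`, along `l`, and back by the chosen walk of `q` closes up at the basepoint; so the
coset of a vertex does not depend on the walk leading to it. -/
theorem coset_eq_of_walk (hK : Γ.Recognizes K)
    (hσ : ∀ v, ∃ l, Γ.IsWalk Γ.base l v ∧ Γ.freeLabel l = σ v) {p q : Γ.V}
    {l : List Γ.Arc} (h : Γ.IsWalk p l q) : coset K (σ p * Γ.freeLabel l) = coset K (σ q) := by
  obtain ⟨m, hm, hp⟩ := hσ p
  obtain ⟨n, hn, hq⟩ := hσ q
  rw [coset_eq_iff, hK]
  refine ⟨n ++ ((m ++ l).map Γ.invArc).reverse, hn.append (hm.append h).reverse, ?_⟩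
  rw [freeLabel_append, freeLabel_reverse, freeLabel_append, hp, hq]

theorem coset_base (hK : Γ.Recognizes K)
    (hσ : ∀ v, ∃ l, Γ.IsWalk Γ.base l v ∧ Γ.freeLabel l = σ v) :
    coset K (σ Γ.base) = (schreier K).base := by
  obtain ⟨m, hm, hp⟩ := hσ Γ.base
  rw [base_schreier, eq_comm, coset_eq_iff, hK]
  exact ⟨m, hm, by simp [hp]⟩

/-- Equal cosets mean that the two chosen walks, after prefixing a closed walk to one of them, have
the same free label. In a deterministic automaton they then end at the same vertex. -/
theorem coset_injective (hd : Γ.IsDeterministic) (hK : Γ.Recognizes K)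
    (hσ : ∀ v, ∃ l, Γ.IsWalk Γ.base l v ∧ Γ.freeLabel l = σ v) {p q : Γ.V}
    (h : coset K (σ p) = coset K (σ q)) : p = q := by
  obtain ⟨m, hm, hp⟩ := hσ p
  obtain ⟨n, hn, hq⟩ := hσ q
  rw [coset_eq_iff, hK] at h
  obtain ⟨l, hl, hf⟩ := h
  refine (hl.append hm).end_eq_of_freeLabel hd hn ?_
  rw [freeLabel_append, hf, hp, hq, inv_mul_cancel_right]

theorem tgt_toSchreier (hK : Γ.Recognizes K)
    (hσ : ∀ v, ∃ l, Γ.IsWalk Γ.base l v ∧ Γ.freeLabel l = σ v) (e : Γ.E) :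
    (schreier K).tgt (coset K (σ (Γ.src e)), Γ.lab e) = coset K (σ (Γ.tgt e)) :=
  coset_eq_of_walk hK hσ (isWalk_singleton (e, true))

theorem isWalk_toSchreier (hK : Γ.Recognizes K)
    (hσ : ∀ v, ∃ l, Γ.IsWalk Γ.base l v ∧ Γ.freeLabel l = σ v) {p q : Γ.V}
    {l : List Γ.Arc} (h : Γ.IsWalk p l q) :
    (schreier K).IsWalk (coset K (σ p)) (l.map (toSchreierArc K σ)) (coset K (σ q)) := by
  induction l generalizing p with
  | nil => exact congrArg (fun v => coset K (σ v)) h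
  | cons a l ih =>
    have ho : (schreier K).origin (toSchreierArc K σ a) = coset K (σ (Γ.origin a)) := by
      rcases a with ⟨e, _ | _⟩
      · exact tgt_toSchreier hK hσ e
      · rfl
    have ht : (schreier K).terminus (toSchreierArc K σ a) = coset K (σ (Γ.terminus a)) := by
      rcases a with ⟨e, _ | _⟩
      · rfl
      · exact tgt_toSchreier hK hσ e
    exact ⟨by rw [ho, h.1], by rw [ht]; exact ih h.2⟩

theorem noBacktrack_toSchreier (hd : Γ.IsDeterministic) {p q : Γ.V}
    {l : List Γ.Arc} (h : Γ.IsWalk p l q) (hn : Γ.NoBacktrack l) :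
    (schreier K).NoBacktrack (l.map (toSchreierArc K σ)) := by
  refine noBacktrack_of_isReduced ?_
  rw [List.map_map]
  exact isReduced_map_letter hd h hn

theorem onReducedBaseWalk_coset (hd : Γ.IsDeterministic) (hK : Γ.Recognizes K)
    (hσ : ∀ v, ∃ l, Γ.IsWalk Γ.base l v ∧ Γ.freeLabel l = σ v) {p : Γ.V}
    (h : Γ.OnReducedBaseWalk p) : (schreier K).OnReducedBaseWalk (coset K (σ p)) := by
  obtain ⟨l₁, l₂, h₁, h₂, hn⟩ := h
  have hb := coset_base hK hσ
  refine ⟨l₁.map (toSchreierArc K σ), l₂.map (toSchreierArc K σ), ?_, ?_, ?_⟩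
  · rw [← hb]; exact isWalk_toSchreier hK hσ h₁
  · rw [← hb]; exact isWalk_toSchreier hK hσ h₂
  · rw [← List.map_append]; exact noBacktrack_toSchreier hd (h₁.append h₂) hn

/-- The label of `L` lies in `K`, so `Γ` reads it along a reduced closed walk. The image of that
walk is reduced with the same label and origin as `L`, hence it is `L`. -/
theorem exists_closed_toSchreier (hd : Γ.IsDeterministic) (hK : Γ.Recognizes K)
    (hσ : ∀ v, ∃ l, Γ.IsWalk Γ.base l v ∧ Γ.freeLabel l = σ v) {L : List (schreier K).Arc}
    (h : (schreier K).IsWalk (schreier K).base L (schreier K).base)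
    (hn : (schreier K).NoBacktrack L) :
    ∃ l, Γ.IsWalk Γ.base l Γ.base ∧ l.map (toSchreierArc K σ) = L := by
  obtain ⟨l, hl, hn', hf⟩ := hK.exists_noBacktrack (freeLabel_mem_of_closed h)
  refine ⟨l, hl, ?_⟩
  have hw := isWalk_toSchreier hK hσ hl
  rw [coset_base hK hσ] at hw
  exact hw.eq_of_freeLabel isDeterministic_schreier h (noBacktrack_toSchreier hd hl hn') hn
    (by rw [freeLabel_toSchreierArc, hf])

end Compare

/-- A reduced automaton is the core of the Schreier automaton of the subgroup that it
recognizes. -/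
theorem nonempty_iso_core_schreier (hΓ : Γ.IsReduced) (hK : Γ.Recognizes K) :
    Nonempty (Iso Γ (schreier K).core) := by
  obtain ⟨hd, hc⟩ := hΓ
  choose m hm using hc.exists_walk
  let σ : Γ.V → FreeGroup X := fun v => Γ.freeLabel (m v)
  have hσ : ∀ v, ∃ l, Γ.IsWalk Γ.base l v ∧ Γ.freeLabel l = σ v := fun v => ⟨m v, hm v, rfl⟩
  let fV : Γ.V → (schreier K).core.V := fun v =>
    ⟨coset K (σ v), onReducedBaseWalk_coset hd hK hσ (hc v)⟩
  let fE : Γ.E → (schreier K).core.E := fun e =>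
    ⟨(coset K (σ (Γ.src e)), Γ.lab e), onReducedBaseWalk_coset hd hK hσ (hc _), by
      rw [tgt_toSchreier hK hσ]; exact onReducedBaseWalk_coset hd hK hσ (hc _)⟩
  have hV : Function.Bijective fV := by
    refine ⟨fun p q h => coset_injective hd hK hσ (congrArg Subtype.val h), ?_⟩
    -- Lift a reduced closed walk through `v` and cut the lift at the corresponding place.
    rintro ⟨v, L₁, L₂, h₁, h₂, hn⟩
    obtain ⟨l, hl, he⟩ := exists_closed_toSchreier hd hK hσ (h₁.append h₂) hn
    obtain ⟨l₁, l₂, rfl, rfl, -⟩ := List.map_eq_append_iff.1 he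
    obtain ⟨q, hq, -⟩ := isWalk_append.1 hl
    have := isWalk_toSchreier hK hσ hq
    rw [coset_base hK hσ] at this
    exact ⟨q, Subtype.ext (this.end_unique h₁)⟩
  have hE : Function.Bijective fE := by
    constructor
    · intro e e' h
      have h' := congrArg Subtype.val h
      simp only [fE] at h'
      have h₁ := coset_injective hd hK hσ (congrArg Prod.fst h')
      have h₂ : Γ.lab e = Γ.lab e' := congrArg Prod.snd h'
      exact congrArg Prod.fst (hd (e, true) (e', true) h₁ (Prod.ext h₂ rfl))
    -- An arc with both ends in the core lies, up to inversion, on a reduced closed walk, and this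
    -- walk lifts.
    · rintro ⟨e, ho, ht⟩
      obtain ⟨L, hL, hn, ha⟩ := exists_closed_of_onReducedBaseWalk (a := (e, true)) ho ht
      obtain ⟨l, hl, rfl⟩ := exists_closed_toSchreier hd hK hσ hL hn
      have : ∃ a ∈ l, (toSchreierArc K σ a).1 = e := by
        rcases ha with ha | ha <;>
        · obtain ⟨a, ha, h⟩ := List.mem_map.1 ha
          exact ⟨a, ha, congrArg Prod.fst h⟩
      obtain ⟨a, -, h⟩ := this
      exact ⟨a.1, Subtype.ext h⟩
  exact ⟨{
    onV := Equiv.ofBijective fV hV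
    onE := Equiv.ofBijective fE hE
    map_base := Subtype.ext (coset_base hK hσ)
    map_src := fun e => rfl
    map_tgt := fun e => Subtype.ext (tgt_toSchreier hK hσ e)
    map_lab := fun e => rfl }⟩

/-! ### Finiteness -/

theorem finite_V_of_finite_E (hc : ∀ v, ∃ l, Γ.IsWalk Γ.base l v) [Finite Γ.E] : Finite Γ.V := by
  have : (Set.univ : Set Γ.V) ⊆ insert Γ.base (Set.range Γ.terminus) := by
    intro v _
    obtain ⟨l, hl⟩ := hc v
    rcases List.eq_nil_or_concat l with rfl | ⟨l, a, rfl⟩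
    · exact .inl (Eq.symm hl)
    · rw [List.concat_eq_append, isWalk_append] at hl
      obtain ⟨q, -, -, hl⟩ := hl
      exact .inr ⟨a, hl⟩
  exact Set.finite_univ_iff.1 (((Set.finite_range _).insert _).subset this)

/-- The free labels of closed walks at the basepoint through a given set of arcs. -/
def closedLabels (Γ : XAutomaton.{u, v} X) (S : Set Γ.E) : Subgroup (FreeGroup X) where
  carrier := {u | ∃ l, Γ.IsWalk Γ.base l Γ.base ∧ (∀ a ∈ l, a.1 ∈ S) ∧ Γ.freeLabel l = u}
  one_mem' := ⟨[], rfl, by simp, rfl⟩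
  mul_mem' := by
    rintro _ _ ⟨l, hl, h, rfl⟩ ⟨l', hl', h', rfl⟩
    refine ⟨l ++ l', hl.append hl', fun a ha => ?_, freeLabel_append _ _⟩
    exact (List.mem_append.1 ha).elim (h a) (h' a)
  inv_mem' := by
    rintro _ ⟨l, hl, h, rfl⟩
    refine ⟨_, hl.reverse, fun a ha => ?_, freeLabel_reverse _⟩
    obtain ⟨b, hb, rfl⟩ := List.mem_map.1 (List.mem_reverse.1 ha)
    exact h b hb

/-- Fix a closed walk for each generator and let `T` be the finite set of arcs used. Every element
of `K` is read within `T`, and cancellation stays within `T`; since a reduced closed walk is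
determined by its label, it lies in `T`. Every arc is on such a walk up to inversion. -/
theorem isFinite_of_fg (hΓ : Γ.IsReduced) (hK : Γ.Recognizes K) (hfg : K.FG) : Γ.IsFinite := by
  obtain ⟨S, rfl⟩ := hfg
  have hex : ∀ s : S, ∃ l, Γ.IsWalk Γ.base l Γ.base ∧ Γ.freeLabel l = s := fun s =>
    (hK s).1 (Subgroup.subset_closure s.2)
  choose m hm hf using hex
  let T : Set Γ.E := ⋃ s : S, {e | e ∈ (m s).map Prod.fst}
  have hT : T.Finite := Set.finite_iUnion fun s => List.finite_toSet _
  have hle : Subgroup.closure (S : Set (FreeGroup X)) ≤ Γ.closedLabels T := by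
    rw [Subgroup.closure_le]
    intro s hs
    exact ⟨m ⟨s, hs⟩, hm _, fun a ha => Set.mem_iUnion.2 ⟨⟨s, hs⟩, List.mem_map_of_mem ha⟩, hf _⟩
  have huniv : ∀ e, e ∈ T := by
    intro e
    obtain ⟨l, hl, hn, he⟩ := exists_closed_of_onReducedBaseWalk (a := (e, true))
      (hΓ.2 _) (hΓ.2 _)
    obtain ⟨l', hl', hT', hf'⟩ := hle ((hK _).2 ⟨l, hl, rfl⟩)
    obtain ⟨l'', hl'', hn'', hsub, hf''⟩ := hl'.exists_noBacktrack_freeLabel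
    obtain rfl := hl.eq_of_freeLabel hΓ.1 hl'' hn hn'' (by rw [hf'', hf'])
    rcases he with he | he
    · exact hT' _ (hsub he)
    · exact hT' _ (hsub he)
  have hE : Finite Γ.E := Set.finite_univ_iff.1 (hT.subset fun e _ => huniv e)
  exact ⟨finite_V_of_finite_E hΓ.2.exists_walk, hE⟩

end XAutomaton

/-! ### The bijection, and finite generation against finiteness -/

namespace EnrichedAutomaton

open XAutomaton

variable {X : Type u} {A : Type w} [AddCommGroup A]

section

variable {Γ Δ : EnrichedAutomaton.{u, v, w} X A}

theorem recognizes_map_fst : Γ.Recognizes (Γ.recognized.map (MonoidHom.fst _ _)) := by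
  intro u
  constructor
  · rintro ⟨_, ⟨l, hl, c, hc, rfl⟩, rfl⟩
    refine ⟨l, hl, ?_⟩
    rw [← fst_walkLabel]
    simp
  · rintro ⟨l, hl, rfl⟩
    exact ⟨_, walkLabel_mem_recognized hl, fst_walkLabel l⟩

/-- A closed walk with trivial free label cancels to the empty walk, and cancelling inverse arcs
does not change the enriched label. Thus closed walks contribute nothing to ⟨Γ⟩ ∩ A beyond the
basepoint subgroup. -/
theorem mem_baseSubgroup_iff (hd : Γ.IsDeterministic) {c : A} :
    c ∈ Γ.baseSubgroup ↔ (1, Multiplicative.ofAdd c) ∈ Γ.recognized := by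
  refine ⟨baseSubgroup_mem_recognized, ?_⟩
  rintro ⟨l, hl, c', hc', h⟩
  obtain ⟨l', hl', hn, -, hp⟩ := hl.exists_noBacktrack Γ.arcLabel arcLabel_invArc
  change Γ.walkLabel l' = Γ.walkLabel l at hp
  have hf : Γ.freeLabel l' = 1 := by
    rw [← fst_walkLabel, hp]
    simpa using (congrArg Prod.fst h).symm
  obtain rfl : l' = [] := hl'.eq_of_freeLabel hd (l' := []) rfl hn List.isChain_nil hf
  rw [← hp] at h
  have := congrArg Prod.snd h
  simp only [walkLabel, List.map_nil, List.prod_nil, one_mul,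
    EmbeddingLike.apply_eq_iff_eq] at this
  rwa [this]

/-- Discrepancies of arc labels lie in the common basepoint subgroup and, being central, can be
collected at the end of the walk. -/
theorem IsoModBase.recognized_le (h : IsoModBase Γ Δ) : Γ.recognized ≤ Δ.recognized := by
  obtain ⟨fV, fE, hb, hs, ht, hl, hL, h₁, h₂⟩ := h
  let f : Iso Γ.toXAutomaton Δ.toXAutomaton := ⟨fV, fE, hb, hs, ht, hl⟩
  have key : ∀ l : List Γ.Arc, ∃ c ∈ Γ.baseSubgroup,
      Γ.walkLabel l = Δ.walkLabel (l.map f.arc) * (1, Multiplicative.ofAdd c) := by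
    intro l
    induction l with
    | nil => exact ⟨0, zero_mem _, by simp [walkLabel, Prod.one_eq_mk]⟩
    | cons a l ih =>
      obtain ⟨c, hc, hw⟩ := ih
      have ha : ∃ d ∈ Γ.baseSubgroup,
          Γ.arcLabel a = Δ.arcLabel (f.arc a) * (1, Multiplicative.ofAdd d) := by
        rcases a with ⟨e, _ | _⟩
        · refine ⟨_, sub_mem (h₂ e) (h₁ e), ?_⟩
          simp only [arcLabel, Iso.arc, f, hl, Bool.false_eq_true, ↓reduceIte, Prod.mk_mul_mk,
            mul_one, ← ofAdd_add]
          congr 2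
          abel
        · refine ⟨_, sub_mem (h₁ e) (h₂ e), ?_⟩
          simp only [arcLabel, Iso.arc, f, hl, ↓reduceIte, Prod.mk_mul_mk,
            mul_one, ← ofAdd_add]
          congr 2
          abel
      obtain ⟨d, hd, hda⟩ := ha
      refine ⟨d + c, add_mem hd hc, ?_⟩
      rw [walkLabel_cons, List.map_cons, walkLabel_cons, hda, hw]
      ext1 <;> simp [mul_mul_mul_comm]
  refine recognized_le_of_closed (fun l hw => ?_) fun c hc =>
    baseSubgroup_mem_recognized (hL ▸ hc)
  obtain ⟨c, hc, hlab⟩ := key l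
  rw [hlab]
  refine mul_mem (walkLabel_mem_recognized ?_) (baseSubgroup_mem_recognized (hL ▸ hc))
  have := f.isWalk_map hw
  rwa [f.map_base] at this

theorem IsoModBase.recognized_eq (h : IsoModBase Γ Δ) : Γ.recognized = Δ.recognized :=
  le_antisymm h.recognized_le (isoModBase_equivalence.symm h).recognized_le

/-- The petals are finite in number, and the basepoint subgroup is finitely generated because `A` is
a Noetherian ℤ-module. -/
theorem fg_recognized_of_isFinite [Finite X] [AddGroup.FG A] {ord : LinearOrder (X × Bool)}
    (h : Γ.IsNormalized ord) (hfin : Γ.IsFinite) : Γ.recognized.FG := by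
  obtain ⟨τ, hτ⟩ := h.exists_isPotential
  have : Finite Γ.E := hfin.2
  have : Module.Finite ℤ A := Module.Finite.iff_addGroup_fg.2 inferInstance
  obtain ⟨S, hS⟩ : Γ.baseSubgroup.FG := by
    have := IsNoetherian.noetherian (AddSubgroup.toIntSubmodule Γ.baseSubgroup)
    rw [Submodule.fg_iff_addSubgroup_fg] at this
    simpa using this
  let R : Set (FreeGroup X × Multiplicative A) :=
    Set.range (Γ.petalLabel τ) ∪ (fun c => (1, Multiplicative.ofAdd c)) '' (S : Set A)
  have hR : R.Finite := (Set.finite_range _).union (S.finite_toSet.image _)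
  refine (Subgroup.fg_iff _).2 ⟨R, le_antisymm ?_ ?_, hR⟩
  · rw [Subgroup.closure_le]
    rintro _ (⟨e, rfl⟩ | ⟨c, hc, rfl⟩)
    · obtain ⟨l, hl⟩ := h.exists_isPetal e
      rw [← walkLabel_petal hτ h hl]
      exact walkLabel_mem_recognized (isWalk_of_isPetal hl)
    · exact baseSubgroup_mem_recognized (hS ▸ AddSubgroup.subset_closure hc)
  · refine EnrichedAutomaton.recognized_le hτ h
      (fun e _ => Subgroup.subset_closure (.inl ⟨e, rfl⟩)) fun c hc => ?_
    rw [← hS] at hc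
    induction hc using AddSubgroup.closure_induction with
    | mem c hc => exact Subgroup.subset_closure (.inr ⟨c, hc, rfl⟩)
    | zero => exact one_mem _
    | add a b _ _ ha hb => simpa using mul_mem ha hb
    | neg a _ ha => simpa using inv_mem ha

end

section

variable {ord : LinearOrder (X × Bool)} [Finite X]

/-- The skeletons agree, and with them the trees. Corresponding petals have the same free part and
both lie in ⟨Γ⟩, so their abelian parts differ by an element of ⟨Γ⟩ ∩ A, that is, of the basepoint
subgroup. -/
theorem isoModBase_stallings_recognized {Γ : EnrichedAutomaton.{u, u, w} X A}
    (h : Γ.IsNormalized ord) : IsoModBase Γ (stallings ord Γ.recognized) := by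
  obtain ⟨f₀⟩ := nonempty_iso_core_schreier h.1 (recognizes_map_fst (Γ := Γ))
  have f : Iso Γ.toXAutomaton (stallings ord Γ.recognized).toXAutomaton := f₀
  obtain ⟨τ, hτ⟩ := (isNormalized_stallings (ord := ord) (H := Γ.recognized)).exists_isPotential
  refine ⟨f.onV, f.onE, f.map_base, f.map_src, f.map_tgt, f.map_lab, ?_, fun e => ?_, fun e => ?_⟩
  · ext c
    exact mem_baseSubgroup_iff h.1.1
  · rw [h.2.1 e, isNormalized_stallings.2.1, sub_zero]
    exact zero_mem _
  · by_cases he : e ∈ Γ.orderTree ord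
    · rw [h.2.2 e he, isNormalized_stallings.2.2 _ (f.mem_orderTree he), sub_zero]
      exact zero_mem _
    · have h₁ := petalLabel_stallings_mem hτ (mt f.mem_orderTree_iff.1 he)
      -- Measuring both petals with the same potential, pulled back along `f`, makes their free
      -- parts literally equal.
      have hτ' : Γ.IsPotential (Γ.orderTree ord) (τ ∘ f.onV) := by
        refine ⟨by rw [Function.comp, f.map_base, hτ.1], fun e he => ?_⟩
        have := hτ.2 _ (f.mem_orderTree he)
        rwa [f.map_src, f.map_lab, f.map_tgt] at this
      obtain ⟨l, hl⟩ := h.exists_isPetal e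
      have h₂ := walkLabel_mem_recognized (isWalk_of_isPetal hl)
      rw [walkLabel_petal hτ' h hl] at h₂
      rw [mem_baseSubgroup_iff h.1.1]
      convert mul_mem h₁ (inv_mem h₂) using 1
      refine Prod.ext ?_ ?_
      · simp [petalLabel, f.map_src, f.map_lab, f.map_tgt]
      · simp [petalLabel, ofAdd_sub, div_eq_mul_inv]

theorem isoClass_stallings_recognized {Γ : EnrichedAutomaton.{u, u, w} X A}
    (h : Γ.IsNormalized ord) : (stallings ord Γ.recognized).isoClass = Γ.isoClass :=
  (Quotient.sound (isoModBase_stallings_recognized h)).symm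

theorem bijOn_stallings (ord : LinearOrder (X × Bool)) :
    Set.BijOn
      (fun H : Subgroup (FreeGroup X × Multiplicative A) => (stallings ord H).isoClass)
      Set.univ
      {κ | ∃ Γ : EnrichedAutomaton.{u, u, w} X A, Γ.IsNormalized ord ∧ Γ.isoClass = κ} := by
  refine ⟨fun H _ => ⟨_, isNormalized_stallings, rfl⟩, fun H _ H' _ h => ?_, ?_⟩
  · have := (Quotient.exact h : IsoModBase _ _).recognized_eq
    rwa [recognized_stallings, recognized_stallings] at this
  · rintro _ ⟨Γ, hΓ, rfl⟩
    exact ⟨Γ.recognized, trivial, isoClass_stallings_recognized hΓ⟩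

/-- For finiteness only the projection of `H` to the free group matters; for finite generation the
basepoint subgroup also has to be generated. -/
theorem fg_iff_isFinite_stallings [AddGroup.FG A]
    (H : Subgroup (FreeGroup X × Multiplicative A)) :
    H.FG ↔ (stallings ord H).IsFinite := by
  constructor
  · intro h
    refine isFinite_of_fg (isNormalized_stallings (ord := ord) (H := H)).1 recognizes_map_fst ?_
    rw [recognized_stallings]
    obtain ⟨S, hS, hfin⟩ := (Subgroup.fg_iff _).1 h
    exact (Subgroup.fg_iff _).2 ⟨_, by rw [← MonoidHom.map_closure, hS], hfin.image _⟩
  · intro h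
    rw [← recognized_stallings (ord := ord) (H := H)]
    exact fg_recognized_of_isFinite isNormalized_stallings h

end

end EnrichedAutomaton

/-! ### Primitive recursive integer vectors and words -/

section Primrec

theorem Primrec.int_natCast : Primrec (fun n : ℕ => (n : ℤ)) := by
  refine ((Primrec.ofNat ℤ).comp Primrec.nat_double).of_eq fun n => ?_
  -- Integers are encoded by interleaving: `n ≥ 0` has code `2n`, and `-(n+1)` has code `2n+1`.
  have h : Encodable.encode (n : ℤ) = 2 * n := rfl
  rw [← h, Denumerable.ofNat_encode]

theorem Primrec.int_negSucc : Primrec Int.negSucc := by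
  refine ((Primrec.ofNat ℤ).comp Primrec.nat_double_succ).of_eq fun n => ?_
  have h : Encodable.encode (Int.negSucc n) = 2 * n + 1 := rfl
  rw [← h, Denumerable.ofNat_encode]

theorem Primrec.int_toNat : Primrec Int.toNat := by
  refine (Primrec.cond (Primrec.nat_bodd.comp Primrec.encode) (Primrec.const 0)
    (Primrec.nat_div2.comp Primrec.encode)).of_eq fun z => ?_
  rcases z with n | n
  · have h : Encodable.encode (Int.ofNat n) = 2 * n := rfl
    rw [h]
    simp
  · have h : Encodable.encode (Int.negSucc n) = 2 * n + 1 := rfl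
    rw [h]
    simp

theorem Primrec.int_toNat_neg : Primrec (fun z : ℤ => (-z).toNat) := by
  refine (Primrec.cond (Primrec.nat_bodd.comp Primrec.encode)
    (Primrec.succ.comp (Primrec.nat_div2.comp Primrec.encode)) (Primrec.const 0)).of_eq fun z => ?_
  rcases z with n | n
  · have h : Encodable.encode (Int.ofNat n) = 2 * n := rfl
    rw [h]
    simp
  · have h : Encodable.encode (Int.negSucc n) = 2 * n + 1 := rfl
    rw [h]
    simp

theorem Primrec.int_subNatNat : Primrec₂ (fun a b : ℕ => (a : ℤ) - b) := by
  refine (Primrec.ite (Primrec.nat_le.comp Primrec.snd Primrec.fst)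
    (Primrec.int_natCast.comp (Primrec.nat_sub.comp Primrec.fst Primrec.snd))
    (Primrec.int_negSucc.comp (Primrec.pred.comp
      (Primrec.nat_sub.comp Primrec.snd Primrec.fst)))).of_eq fun p => ?_
  change _ = (p.1 : ℤ) - p.2
  split_ifs with h
  · omega
  · rw [Int.negSucc_eq]; simp only [Nat.pred_eq_sub_one]; omega

/-- Write each integer as the difference of its positive and negative parts and add parts
separately. -/
theorem Primrec.int_add : Primrec₂ (fun a b : ℤ => a + b) := by
  refine (Primrec.int_subNatNat.comp
    (Primrec.nat_add.comp (Primrec.int_toNat.comp Primrec.fst) (Primrec.int_toNat.comp Primrec.snd))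
    (Primrec.nat_add.comp (Primrec.int_toNat_neg.comp Primrec.fst)
      (Primrec.int_toNat_neg.comp Primrec.snd))).of_eq fun p => ?_
  push_cast
  omega

theorem Primrec.int_neg : Primrec (fun a : ℤ => -a) := by
  refine (Primrec.int_subNatNat.comp Primrec.int_toNat_neg Primrec.int_toNat).of_eq fun p => ?_
  omega

theorem Primrec.vec_add {m : ℕ} : Primrec₂ (fun a b : Fin m → ℤ => a + b) := by
  refine Primrec.fin_curry.2 ?_
  exact Primrec.int_add.comp (Primrec.fin_app.comp (Primrec.fst.comp Primrec.fst) Primrec.snd)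
    (Primrec.fin_app.comp (Primrec.snd.comp Primrec.fst) Primrec.snd)

theorem Primrec.vec_neg {m : ℕ} : Primrec (fun a : Fin m → ℤ => -a) := by
  refine Primrec.fin_curry.2 ?_
  exact Primrec.int_neg.comp (Primrec.fin_app.comp Primrec.fst Primrec.snd)

theorem Primrec.freeGroup_reduce {α : Type*} [Primcodable α] [DecidableEq α] :
    Primrec (FreeGroup.reduce : List (α × Bool) → List (α × Bool)) := by
  -- Prepend one letter, cancelling it against the first letter if possible; reduction is the right
  -- fold of this step.
  let step : (α × Bool) → List (α × Bool) → List (α × Bool) := fun a r =>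
    List.casesOn r [a] fun b t => if a.1 = b.1 ∧ a.2 = !b.2 then t else a :: b :: t
  have hstep : Primrec₂ step := by
    have ha : Primrec fun p : ((α × Bool) × List (α × Bool)) × (α × Bool) × List (α × Bool) =>
      p.1.1 := Primrec.fst.comp Primrec.fst
    have hb : Primrec fun p : ((α × Bool) × List (α × Bool)) × (α × Bool) × List (α × Bool) =>
      p.2.1 := Primrec.fst.comp Primrec.snd
    have ht : Primrec fun p : ((α × Bool) × List (α × Bool)) × (α × Bool) × List (α × Bool) =>
      p.2.2 := Primrec.snd.comp Primrec.snd
    have hnil : Primrec fun p : (α × Bool) × List (α × Bool) => [p.1] :=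
      Primrec.list_cons.comp Primrec.fst (Primrec.const [])
    refine Primrec.list_casesOn (f := Prod.snd) (g := fun p => [p.1])
      (h := fun p q => if p.1.1 = q.1.1 ∧ p.1.2 = !q.1.2 then q.2 else p.1 :: q.1 :: q.2)
      Primrec.snd hnil ?_
    exact Primrec.ite (PrimrecPred.and
      (Primrec.eq.comp (Primrec.fst.comp ha) (Primrec.fst.comp hb))
      (Primrec.eq.comp (Primrec.snd.comp ha) (Primrec.not.comp (Primrec.snd.comp hb))))
      ht (Primrec.list_cons.comp ha (Primrec.list_cons.comp hb ht))
  refine (Primrec.list_foldr .id (Primrec.const [])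
    (hstep.comp (Primrec.fst.comp Primrec.snd) (Primrec.snd.comp Primrec.snd)).to₂).of_eq fun l => ?_
  simp only [id]
  induction l with
  | nil => rfl
  | cons a l ih => rw [List.foldr_cons, ih]; rfl

theorem Primrec.freeGroup_invRev {α : Type*} [Primcodable α] :
    Primrec (FreeGroup.invRev : List (α × Bool) → List (α × Bool)) :=
  Primrec.list_reverse.comp (Primrec.list_map .id
    (Primrec.pair (Primrec.fst.comp Primrec.snd) (Primrec.not.comp (Primrec.snd.comp Primrec.snd))))

theorem PrimrecPred.isReduced {α : Type*} [Primcodable α] :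
    PrimrecPred fun w : List (α × Bool) => FreeGroup.IsReduced w := by
  classical
  exact (Primrec.eq.comp Primrec.freeGroup_reduce .id).of_eq fun w =>
    FreeGroup.isReduced_iff_reduce_eq.symm

variable {α β : Type*} [Primcodable α] [Primcodable β]

theorem PrimrecPred.exists_mem {f : β → List α} (hf : Primrec f) {p : β → α → Prop}
    (hp : PrimrecPred fun q : β × α => p q.1 q.2) : PrimrecPred fun b => ∃ a ∈ f b, p b a :=
  (PrimrecRel.exists_mem_list (PrimrecRel.swap hp)).comp hf .id

theorem PrimrecPred.forall_mem {f : β → List α} (hf : Primrec f) {p : β → α → Prop}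
    (hp : PrimrecPred fun q : β × α => p q.1 q.2) : PrimrecPred fun b => ∀ a ∈ f b, p b a :=
  (PrimrecRel.forall_mem_list (PrimrecRel.swap hp)).comp hf .id

theorem PrimrecPred.forall_lt' {f : β → ℕ} (hf : Primrec f) {p : β → ℕ → Prop}
    (hp : PrimrecPred fun q : β × ℕ => p q.1 q.2) : PrimrecPred fun b => ∀ a < f b, p b a :=
  (PrimrecPred.forall_mem (Primrec.list_range.comp hf) hp).of_eq fun _ => by simp

theorem PrimrecPred.nodup : PrimrecPred fun l : List α => l.Nodup := by
  classical
  let p : List α → α → Prop := fun l a => (l.filter (· = a)).length ≤ 1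
  have h : PrimrecPred fun q : List α × α => p q.1 q.2 :=
    Primrec.nat_le.comp (Primrec.list_length.comp
      ((PrimrecRel.listFilter Primrec.eq).comp Primrec.fst Primrec.snd)) (Primrec.const 1)
  refine (PrimrecPred.forall_mem .id h).of_eq fun l => ?_
  rw [List.nodup_iff_count_le_one]
  have : ∀ a : α, (l.filter (· = a)).length = l.count a := fun a => by
    rw [List.count_eq_length_filter]
    congr
  simp only [id, p, this]
  refine ⟨fun h a => ?_, fun h a _ => h a⟩
  by_cases ha : a ∈ l
  · exact h a ha
  · rw [List.count_eq_zero_of_not_mem ha]; exact zero_le_one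

end Primrec

/-! ### Enumeration of the walks of bounded length -/

section Visits

variable {n m : ℕ}

/-- An arc between numbered vertices, reading a word and an integer vector. -/
abbrev ArcCode (n m : ℕ) : Type := ℕ × ℕ × List (Fin n × Bool) × (Fin m → ℤ)

/-- A walk from the vertex `0`, recorded by its end and by the word and the vector it reads. -/
abbrev VisitCode (n m : ℕ) : Type := ℕ × List (Fin n × Bool) × (Fin m → ℤ)

/-- Extend a walk by an arc. -/
def VisitCode.extend (s : VisitCode n m) (b : ArcCode n m) : VisitCode n m :=
  (b.2.1, s.2.1 ++ b.2.2.1, s.2.2 + b.2.2.2)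

/-- The walks of length at most `N` from the vertex `0`. -/
def visits (B : List (ArcCode n m)) : ℕ → List (VisitCode n m)
  | 0 => [(0, [], 0)]
  | N + 1 => visits B N ++ (visits B N).flatMap fun s =>
      B.flatMap fun b => if b.1 = s.1 then [s.extend b] else []

theorem Primrec.visits : Primrec₂ (visits (n := n) (m := m)) := by
  have hext : Primrec₂ (VisitCode.extend (n := n) (m := m)) := by
    refine Primrec.pair (Primrec.fst.comp (Primrec.snd.comp Primrec.snd)) (Primrec.pair ?_ ?_)
    · exact Primrec.list_append.comp (Primrec.fst.comp (Primrec.snd.comp Primrec.fst))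
        (Primrec.fst.comp (Primrec.snd.comp (Primrec.snd.comp Primrec.snd)))
    · exact Primrec.vec_add.comp (Primrec.snd.comp (Primrec.snd.comp Primrec.fst))
        (Primrec.snd.comp (Primrec.snd.comp (Primrec.snd.comp Primrec.snd)))
  have hstep : Primrec₂ fun (B : List (ArcCode n m)) (p : ℕ × List (VisitCode n m)) =>
      p.2 ++ p.2.flatMap fun s => B.flatMap fun b => if b.1 = s.1 then [s.extend b] else [] := by
    refine Primrec.list_append.comp (Primrec.snd.comp Primrec.snd)
      (Primrec.list_flatMap (Primrec.snd.comp Primrec.snd) ?_)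
    refine Primrec.list_flatMap (Primrec.fst.comp Primrec.fst) ?_
    exact Primrec.ite (Primrec.eq.comp (Primrec.fst.comp Primrec.snd)
      (Primrec.fst.comp (Primrec.snd.comp Primrec.fst)))
      (Primrec.list_cons.comp (hext.comp (Primrec.snd.comp Primrec.fst) Primrec.snd)
        (Primrec.const [])) (Primrec.const [])
  refine (Primrec.nat_rec' Primrec.snd (Primrec.const [(0, [], 0)])
    (hstep.comp (Primrec.fst.comp Primrec.fst) Primrec.snd).to₂).of_eq fun p => ?_
  rcases p with ⟨B, N⟩
  induction N with
  | zero => rfl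
  | succ N ih =>
    simp only at ih ⊢
    rw [ih]
    rfl

theorem mem_visits_succ {B : List (ArcCode n m)} {N : ℕ} {s : VisitCode n m} :
    s ∈ visits B (N + 1) ↔ s ∈ visits B N ∨
      ∃ r ∈ visits B N, ∃ b ∈ B, b.1 = r.1 ∧ s = r.extend b := by
  simp only [visits, List.mem_append, List.mem_flatMap]
  refine or_congr_right (exists_congr fun r => and_congr_right fun _ => exists_congr fun b =>
    and_congr_right fun _ => ?_)
  split_ifs with h <;> simp [h]

theorem visits_mono {B : List (ArcCode n m)} {N N' : ℕ} (h : N ≤ N') :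
    visits B N ⊆ visits B N' := by
  induction h with
  | refl => exact fun _ h => h
  | step _ ih => exact fun _ h => mem_visits_succ.2 (.inl (ih h))

theorem start_mem_visits {B : List (ArcCode n m)} {N : ℕ} : (0, [], 0) ∈ visits B N :=
  visits_mono N.zero_le (by simp [visits])

theorem extend_mem_visits {B : List (ArcCode n m)} {N : ℕ} {s : VisitCode n m}
    (hs : s ∈ visits B N) {b : ArcCode n m} (hb : b ∈ B) (h : b.1 = s.1) :
    s.extend b ∈ visits B (N + 1) :=
  mem_visits_succ.2 (.inr ⟨s, hs, b, hb, h, rfl⟩)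

theorem visits_induction {B : List (ArcCode n m)} {P : VisitCode n m → Prop}
    (start : P (0, [], 0))
    (step : ∀ s, P s → ∀ b ∈ B, b.1 = s.1 → P (s.extend b)) {N : ℕ} {s : VisitCode n m}
    (hs : s ∈ visits B N) : P s := by
  induction N generalizing s with
  | zero =>
    obtain rfl : s = (0, [], 0) := by simpa [visits] using hs
    exact start
  | succ N ih =>
    rcases mem_visits_succ.1 hs with h | ⟨r, hr, b, hb, h, rfl⟩
    · exact ih h
    · exact step r (ih hr) b hb h

end Visits

/-! ### The search for normalized automata -/

section Codes

variable {n m : ℕ}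

/-- The arcs of the automaton, including inverse arcs: origin, end, letter, integer vector. -/
def AutomatonCode.letterArcs (c : AutomatonCode n m) :
    List (ℕ × ℕ × (Fin n × Bool) × (Fin m → ℤ)) :=
  c.2.1.flatMap fun e =>
    [(e.1 % (c.1 + 1), e.2.1 % (c.1 + 1), (e.2.2.1, true), -e.2.2.2.1 + e.2.2.2.2),
      (e.2.1 % (c.1 + 1), e.1 % (c.1 + 1), (e.2.2.1, false), -e.2.2.2.2 + e.2.2.2.1)]

/-- The arcs of the automaton, including inverse arcs, with letters as one-letter words. -/
def AutomatonCode.arcs (c : AutomatonCode n m) : List (ArcCode n m) :=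
  (AutomatonCode.letterArcs c).map fun b => (b.1, b.2.1, [b.2.2.1], b.2.2.2)

/-- The labels of the short closed walks at the basepoint, and the generators of the basepoint
subgroup. -/
def AutomatonCode.generators (c : AutomatonCode n m) : GenCode n m :=
  ((visits (AutomatonCode.arcs c) (2 * c.1 + 1)).filter fun s => s.1 = 0).map Prod.snd ++
    c.2.2.map fun z => ([], z)

/-- The given elements and their inverses, as loops at the vertex `0`. -/
def GenCode.loops (S : GenCode n m) : List (ArcCode n m) :=
  S.flatMap fun y => [(0, 0, y.1, y.2), (0, 0, FreeGroup.invRev y.1, -y.2)]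

/-- The elements of `T` are products of at most `N` elements of `S` and their inverses. -/
def GenCode.Covers (N : ℕ) (S T : GenCode n m) : Prop :=
  ∀ t ∈ T, ∃ s ∈ visits (GenCode.loops S) N,
    FreeGroup.reduce s.2.1 = FreeGroup.reduce t.1 ∧ s.2.2 = t.2

/-- A criterion for the automaton of `c` to be normalized: it is deterministic, its initial labels
are zero, its vertices are numbered in the order in which they are reached by the order tree and the
corresponding arcs have label zero, and walks of length at most `N` show that it is core. -/
def AutomatonCode.Valid (ord : LinearOrder (Fin n × Bool)) (c : AutomatonCode n m) (N : ℕ) :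
    Prop :=
  (c.2.1.map fun e => (e.1 % (c.1 + 1), e.2.2.1)).Nodup ∧
  (c.2.1.map fun e => (e.2.1 % (c.1 + 1), e.2.2.1)).Nodup ∧
  (∀ e ∈ c.2.1, e.2.2.2.1 = 0) ∧
  (∀ i < c.1, ∃ a ∈ AutomatonCode.letterArcs c, a.1 ≤ i ∧ a.2.1 = i + 1 ∧ a.2.2.2 = 0 ∧
    ∀ b ∈ AutomatonCode.letterArcs c,
      i < b.1 ∨ b.2.1 ≤ i ∨ a.1 < b.1 ∨ a.1 = b.1 ∧ ord.le a.2.2.1 b.2.2.1) ∧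
  (∀ i < c.1 + 1, ∃ s ∈ visits (AutomatonCode.arcs c) N, ∃ s' ∈ visits (AutomatonCode.arcs c) N,
    s.1 = i ∧ s'.1 = i ∧ FreeGroup.IsReduced (s.2.1 ++ FreeGroup.invRev s'.2.1))

open Primrec in
theorem AutomatonCode.primrec_letterArcs :
    Primrec (AutomatonCode.letterArcs (n := n) (m := m)) := by
  refine list_flatMap (fst.comp snd) ?_
  have k : Primrec fun p : AutomatonCode n m × (ℕ × ℕ × Fin n × (Fin m → ℤ) × (Fin m → ℤ)) =>
    p.1.1 + 1 := succ.comp (fst.comp fst)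
  have s : Primrec fun p : AutomatonCode n m × (ℕ × ℕ × Fin n × (Fin m → ℤ) × (Fin m → ℤ)) =>
    p.2.1 := fst.comp snd
  have t : Primrec fun p : AutomatonCode n m × (ℕ × ℕ × Fin n × (Fin m → ℤ) × (Fin m → ℤ)) =>
    p.2.2.1 := fst.comp (snd.comp snd)
  have r : Primrec fun p : AutomatonCode n m × (ℕ × ℕ × Fin n × (Fin m → ℤ) × (Fin m → ℤ)) =>
    p.2.2.2 := snd.comp (snd.comp snd)
  have a := fst.comp (snd.comp r)
  have b := snd.comp (snd.comp r)
  refine list_cons.comp ?_ (list_cons.comp ?_ (const []))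
  · exact pair (nat_mod.comp s k) (pair (nat_mod.comp t k) (pair (pair (fst.comp r) (const true))
      (vec_add.comp (vec_neg.comp a) b)))
  · exact pair (nat_mod.comp t k) (pair (nat_mod.comp s k) (pair (pair (fst.comp r) (const false))
      (vec_add.comp (vec_neg.comp b) a)))

open Primrec in
theorem AutomatonCode.primrec_arcs : Primrec (AutomatonCode.arcs (n := n) (m := m)) := by
  refine list_map AutomatonCode.primrec_letterArcs ?_
  have r : Primrec fun p : AutomatonCode n m × (ℕ × ℕ × (Fin n × Bool) × (Fin m → ℤ)) =>
    p.2.2.2 := snd.comp (snd.comp snd)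
  exact pair (fst.comp snd) (pair (fst.comp (snd.comp snd))
    (pair (list_cons.comp (fst.comp r) (const [])) (snd.comp r)))

open Primrec in
theorem AutomatonCode.primrec_generators :
    Primrec (AutomatonCode.generators (n := n) (m := m)) := by
  refine list_append.comp (list_map ?_ (snd.comp snd).to₂) (list_map (snd.comp snd) ?_)
  · refine (listFilter (p := fun s : VisitCode n m => s.1 = 0)
      (Primrec.eq.comp fst (const 0))).comp (visits.comp AutomatonCode.primrec_arcs ?_)
    exact succ.comp (nat_double.comp fst)
  · exact pair (const []) snd

open Primrec in
theorem GenCode.primrec_loops : Primrec (GenCode.loops (n := n) (m := m)) := by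
  refine list_flatMap .id ?_
  have a : Primrec fun p : GenCode n m × (List (Fin n × Bool) × (Fin m → ℤ)) => p.2.1 :=
    fst.comp snd
  have b : Primrec fun p : GenCode n m × (List (Fin n × Bool) × (Fin m → ℤ)) => p.2.2 :=
    snd.comp snd
  exact list_cons.comp (pair (const 0) (pair (const 0) (pair a b)))
    (list_cons.comp (pair (const 0) (pair (const 0) (pair (freeGroup_invRev.comp a)
      (vec_neg.comp b)))) (const []))

open Primrec in
theorem GenCode.primrecPred_covers :
    PrimrecPred fun p : ℕ × GenCode n m × GenCode n m => GenCode.Covers p.1 p.2.1 p.2.2 := by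
  refine PrimrecPred.forall_mem (snd.comp snd) (PrimrecPred.exists_mem (visits.comp (GenCode.primrec_loops.comp
      (fst.comp (snd.comp fst))) (fst.comp fst)) (PrimrecPred.and ?_ ?_))
  · exact Primrec.eq.comp (freeGroup_reduce.comp (fst.comp (snd.comp snd)))
      (freeGroup_reduce.comp (fst.comp (snd.comp fst)))
  · exact Primrec.eq.comp (snd.comp (snd.comp snd)) (snd.comp (snd.comp fst))

open Primrec in
theorem AutomatonCode.primrecPred_valid (ord : LinearOrder (Fin n × Bool)) :
    PrimrecPred fun p : AutomatonCode n m × ℕ => AutomatonCode.Valid ord p.1 p.2 := by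
  classical
  have hk : Primrec fun p : AutomatonCode n m × ℕ => p.1.1 := fst.comp fst
  have hl : Primrec fun p : AutomatonCode n m × ℕ => p.1.2.1 := fst.comp (snd.comp fst)
  have hA : Primrec fun p : AutomatonCode n m × ℕ => AutomatonCode.letterArcs p.1 :=
    AutomatonCode.primrec_letterArcs.comp fst
  have hV : Primrec fun p : AutomatonCode n m × ℕ => visits (AutomatonCode.arcs p.1) p.2 :=
    visits.comp (AutomatonCode.primrec_arcs.comp fst) snd
  -- Any relation on a finite type is primitive recursive, so no effectivity is required of the
  -- order.
  have hle : PrimrecRel fun y z : Fin n × Bool => ord.le y z :=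
    Primrec.primrecPred (dom_finite _)
  refine PrimrecPred.and ?_ (PrimrecPred.and ?_ (PrimrecPred.and ?_ (PrimrecPred.and ?_ ?_)))
  · refine PrimrecPred.nodup.comp (list_map hl (pair ?_ ?_))
    · exact nat_mod.comp (fst.comp snd) (succ.comp (hk.comp fst))
    · exact fst.comp (snd.comp (snd.comp snd))
  · refine PrimrecPred.nodup.comp (list_map hl (pair ?_ ?_))
    · exact nat_mod.comp (fst.comp (snd.comp snd)) (succ.comp (hk.comp fst))
    · exact fst.comp (snd.comp (snd.comp snd))
  · refine PrimrecPred.forall_mem hl ?_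
    exact Primrec.eq.comp (fst.comp (snd.comp (snd.comp (snd.comp snd)))) (const 0)
  · refine PrimrecPred.forall_lt' hk (PrimrecPred.exists_mem (hA.comp fst) (PrimrecPred.and ?_
        (PrimrecPred.and ?_ (PrimrecPred.and ?_ (PrimrecPred.forall_mem (hA.comp (fst.comp fst))
          (PrimrecPred.or ?_ (PrimrecPred.or ?_ (PrimrecPred.or ?_
            (PrimrecPred.and ?_ ?_)))))))))
    · exact nat_le.comp (fst.comp snd) (snd.comp fst)
    · exact Primrec.eq.comp (fst.comp (snd.comp snd)) (succ.comp (snd.comp fst))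
    · exact Primrec.eq.comp (snd.comp (snd.comp (snd.comp snd))) (const 0)
    · exact nat_lt.comp (snd.comp (fst.comp fst)) (fst.comp snd)
    · exact nat_le.comp (fst.comp (snd.comp snd)) (snd.comp (fst.comp fst))
    · exact nat_lt.comp (fst.comp (snd.comp fst)) (fst.comp snd)
    · exact Primrec.eq.comp (fst.comp (snd.comp fst)) (fst.comp snd)
    · exact hle.comp (fst.comp (snd.comp (snd.comp (snd.comp fst))))
        (fst.comp (snd.comp (snd.comp snd)))
  · refine PrimrecPred.forall_lt' (succ.comp hk) (PrimrecPred.exists_mem (hV.comp fst) (PrimrecPred.exists_mem (hV.comp (fst.comp fst)) (PrimrecPred.and ?_ (PrimrecPred.and ?_ (PrimrecPred.isReduced.comp ?_)))))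
    · exact Primrec.eq.comp (fst.comp (snd.comp fst)) (snd.comp (fst.comp fst))
    · exact Primrec.eq.comp (fst.comp snd) (snd.comp (fst.comp fst))
    · exact list_append.comp (fst.comp (snd.comp (snd.comp fst)))
        (freeGroup_invRev.comp (fst.comp (snd.comp snd)))

/-- The condition that ends the search: `K` is a list of relations of `A`. -/
def SearchSpec (ord : LinearOrder (Fin n × Bool)) (K : GenCode n m) (S : GenCode n m)
    (c : AutomatonCode n m) (N : ℕ) : Prop :=
  AutomatonCode.Valid ord c N ∧ GenCode.Covers N (S ++ K) (AutomatonCode.generators c) ∧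
    GenCode.Covers N (AutomatonCode.generators c ++ K) S

open Primrec in
theorem primrecPred_searchSpec (ord : LinearOrder (Fin n × Bool)) (K : GenCode n m) :
    PrimrecPred fun p : GenCode n m × AutomatonCode n m × ℕ =>
      SearchSpec ord K p.1 p.2.1 p.2.2 := by
  have hN : Primrec fun p : GenCode n m × AutomatonCode n m × ℕ => p.2.2 := snd.comp snd
  have hg : Primrec fun p : GenCode n m × AutomatonCode n m × ℕ =>
    AutomatonCode.generators p.2.1 := AutomatonCode.primrec_generators.comp (fst.comp snd)
  refine PrimrecPred.and ((AutomatonCode.primrecPred_valid ord).comp snd) (PrimrecPred.and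
    (GenCode.primrecPred_covers.comp (pair hN (pair (list_append.comp fst (const K)) hg)))
    (GenCode.primrecPred_covers.comp (pair hN (pair (list_append.comp hg (const K)) fst))))

/-- Unbounded search through the codes of `β`; the existence hypothesis makes it total. -/
theorem exists_computable_of_primrecPred {α β : Type*} [Primcodable α] [Primcodable β]
    {P : α → β → Prop} (hP : PrimrecRel P) (hex : ∀ a, ∃ b, P a b) :
    ∃ f : α → β, Computable f ∧ ∀ a, P a (f a) := by
  classical
  let s : α → ℕ → Option β := fun a N =>
    (Encodable.decode (α := β) N).bind fun b => if P a b then some b else none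
  have hs : Primrec₂ s := by
    refine Primrec.option_bind (Primrec.decode.comp Primrec.snd) ?_
    exact Primrec.ite (hP.comp (Primrec.fst.comp Primrec.fst) Primrec.snd)
      (Primrec.option_some.comp Primrec.snd) (Primrec.const none)
  have hdom : ∀ a, (Nat.rfindOpt (s a)).Dom := by
    intro a
    obtain ⟨b, hb⟩ := hex a
    exact Nat.rfindOpt_dom.2 ⟨Encodable.encode b, b, by simp [s, hb]⟩
  refine ⟨fun a => (Nat.rfindOpt (s a)).get (hdom a), ?_, fun a => ?_⟩
  · refine (Partrec.rfindOpt hs.to_comp).of_eq fun a => ?_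
    exact (Part.some_get (hdom a)).symm
  · obtain ⟨N, hN⟩ := Nat.rfindOpt_spec (Part.get_mem (hdom a))
    simp only [s, Option.mem_def, Option.bind_eq_some_iff] at hN
    obtain ⟨b, -, hb⟩ := hN
    split_ifs at hb with h
    obtain rfl := Option.some.inj hb
    exact h

end Codes

open XAutomaton EnrichedAutomaton

/-! ### Meaning of codes: words, products of generators, walks -/

section Semantics

variable {X : Type u} {A : Type w} [AddCommGroup A] {n m : ℕ}

/-- The element of `F_X × A` described by a word and an integer vector. -/
def codeValue (enum : Fin n ≃ X) (π : (Fin m → ℤ) →+ A)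
    (y : List (Fin n × Bool) × (Fin m → ℤ)) : FreeGroup X × Multiplicative A :=
  (FreeGroup.mk (y.1.map fun y => (enum y.1, y.2)), Multiplicative.ofAdd (π y.2))

variable {enum : Fin n ≃ X} {π : (Fin m → ℤ) →+ A}

theorem codeValue_nil : codeValue enum π ([], 0) = 1 := by
  simp [codeValue, ← FreeGroup.one_eq_mk, Prod.one_eq_mk]

theorem codeValue_append (w w' : List (Fin n × Bool)) (z z' : Fin m → ℤ) :
    codeValue enum π (w ++ w', z + z') = codeValue enum π (w, z) * codeValue enum π (w', z') := by
  simp [codeValue]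

theorem map_invRev {α β : Type*} (f : α → β) (w : List (α × Bool)) :
    (FreeGroup.invRev w).map (fun y => (f y.1, y.2)) =
      FreeGroup.invRev (w.map fun y => (f y.1, y.2)) := by
  simp [FreeGroup.invRev, Function.comp_def]

theorem codeValue_invRev (w : List (Fin n × Bool)) (z : Fin m → ℤ) :
    codeValue enum π (FreeGroup.invRev w, -z) = (codeValue enum π (w, z))⁻¹ := by
  simp only [codeValue, map_invRev, map_neg]
  rfl

theorem isReduced_map_iff {α β : Type*} {f : α → β} (hf : Function.Injective f)
    {w : List (α × Bool)} :
    FreeGroup.IsReduced (w.map fun y => (f y.1, y.2)) ↔ FreeGroup.IsReduced w := by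
  unfold FreeGroup.IsReduced
  rw [List.isChain_map]
  simp only [hf.eq_iff]

theorem reduce_map {α β : Type*} [DecidableEq α] [DecidableEq β] {f : α → β}
    (hf : Function.Injective f) (w : List (α × Bool)) :
    FreeGroup.reduce (w.map fun y => (f y.1, y.2)) =
      (FreeGroup.reduce w).map fun y => (f y.1, y.2) := by
  have h : FreeGroup.IsReduced ((FreeGroup.reduce w).map fun y => (f y.1, y.2)) :=
    (isReduced_map_iff hf).2 (FreeGroup.isReduced_iff_reduce_eq.2 FreeGroup.reduce.idem)
  rw [← h.reduce_eq]
  refine FreeGroup.reduce.sound ?_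
  have : ∀ v : List (α × Bool), FreeGroup.mk (v.map fun y => (f y.1, y.2)) =
      FreeGroup.map f (FreeGroup.mk v) := fun v => rfl
  rw [this, this, FreeGroup.reduce.self]

/-- Equality in the free factor is settled by reduction, but in `A` only up to the kernel of `π`.
This is why relations of `A` enter the search. -/
theorem codeValue_eq_iff {y y' : List (Fin n × Bool) × (Fin m → ℤ)} :
    codeValue enum π y = codeValue enum π y' ↔
      FreeGroup.reduce y.1 = FreeGroup.reduce y'.1 ∧ π y.2 = π y'.2 := by
  classical
  simp only [codeValue, Prod.mk.injEq, EmbeddingLike.apply_eq_iff_eq]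
  refine and_congr_left fun _ => ⟨fun h => ?_, fun h => FreeGroup.reduce.exact ?_⟩
  · have := FreeGroup.reduce.sound h
    rw [reduce_map enum.injective, reduce_map enum.injective] at this
    refine List.map_injective_iff.2 ?_ this
    intro a b hab
    simpa [Prod.ext_iff] using hab
  · rw [reduce_map enum.injective, reduce_map enum.injective, h]

/-! #### Products of generators -/

theorem codeValue_mem_subgroup {S : GenCode n m} {y : List (Fin n × Bool) × (Fin m → ℤ)}
    (h : y ∈ S) : codeValue enum π y ∈ GenCode.subgroup enum π S :=
  Subgroup.subset_closure ⟨y, h, rfl⟩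

theorem GenCode.mem_loops {S : GenCode n m} {b : ArcCode n m} :
    b ∈ GenCode.loops S ↔ ∃ y ∈ S, b = (0, 0, y.1, y.2) ∨
      b = (0, 0, FreeGroup.invRev y.1, -y.2) := by
  simp [GenCode.loops]

theorem codeValue_mem_of_mem_visits {S : GenCode n m} {N : ℕ} {s : VisitCode n m}
    (hs : s ∈ visits (GenCode.loops S) N) :
    s.1 = 0 ∧ codeValue enum π s.2 ∈ GenCode.subgroup enum π S := by
  refine visits_induction (P := fun s => s.1 = 0 ∧ codeValue enum π s.2 ∈ _) ?_ ?_ hs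
  · exact ⟨rfl, by rw [codeValue_nil]; exact one_mem _⟩
  · rintro ⟨v, w, z⟩ ⟨-, h⟩ b hb -
    obtain ⟨y, hy, rfl | rfl⟩ := GenCode.mem_loops.1 hb
    · refine ⟨rfl, ?_⟩
      change codeValue enum π (w ++ y.1, z + y.2) ∈ _
      rw [codeValue_append]
      exact mul_mem h (codeValue_mem_subgroup hy)
    · refine ⟨rfl, ?_⟩
      change codeValue enum π (w ++ FreeGroup.invRev y.1, z + -y.2) ∈ _
      rw [codeValue_append, codeValue_invRev]
      exact mul_mem h (inv_mem (codeValue_mem_subgroup hy))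

/-- A product of generators and inverses is a walk along loops. The larger list `S'` leaves room for
appending relations afterwards. -/
theorem exists_visit_of_mem_subgroup {S S' : GenCode n m} (hS : S ⊆ S')
    {g : FreeGroup X × Multiplicative A} (hg : g ∈ GenCode.subgroup enum π S) :
    ∃ N, ∃ s ∈ visits (GenCode.loops S') N, s.1 = 0 ∧ codeValue enum π s.2 = g := by
  induction hg using Subgroup.closure_induction_right with
  | one => exact ⟨0, _, start_mem_visits, rfl, codeValue_nil⟩
  | mul_right x y hx hy ih =>
    obtain ⟨N, s, hs, h0, rfl⟩ := ih
    obtain ⟨y, hy, rfl⟩ := hy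
    refine ⟨N + 1, _, extend_mem_visits hs (GenCode.mem_loops.2 ⟨y, hS hy, .inl rfl⟩) h0.symm,
      rfl, codeValue_append _ _ _ _⟩
  | mul_inv_cancel x y hx hy ih =>
    obtain ⟨N, s, hs, h0, rfl⟩ := ih
    obtain ⟨y, hy, rfl⟩ := hy
    refine ⟨N + 1, _, extend_mem_visits hs (GenCode.mem_loops.2 ⟨y, hS hy, .inr rfl⟩) h0.symm,
      rfl, ?_⟩
    exact (codeValue_append _ _ _ _).trans (congrArg _ (codeValue_invRev _ _))

/-- `K` describes a generating list of the kernel of `π`. -/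
def IsKernelCode (π : (Fin m → ℤ) →+ A) (K : GenCode n m) : Prop :=
  (∀ y ∈ K, y.1 = [] ∧ π y.2 = 0) ∧ ∀ z, π z = 0 → z ∈ AddSubgroup.closure {z | ([], z) ∈ K}

theorem exists_isKernelCode (n : ℕ) (π : (Fin m → ℤ) →+ A) :
    ∃ K : GenCode n m, IsKernelCode π K := by
  obtain ⟨S, hS⟩ : π.ker.FG := by
    have := IsNoetherian.noetherian (AddSubgroup.toIntSubmodule π.ker)
    rw [Submodule.fg_iff_addSubgroup_fg] at this
    simpa using this
  refine ⟨S.toList.map fun z => ([], z), ?_, fun z hz => ?_⟩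
  · intro y hy
    obtain ⟨z, hz, rfl⟩ := List.mem_map.1 hy
    refine ⟨rfl, ?_⟩
    have : z ∈ π.ker := hS ▸ AddSubgroup.subset_closure (Finset.mem_toList.1 hz)
    exact this
  · have : z ∈ π.ker := hz
    rw [← hS] at this
    convert this using 2
    ext z
    simp

theorem exists_visit_add_of_mem_closure {K S : GenCode n m} (hK : K ⊆ S) {N : ℕ} {s : VisitCode n m} (hs : s ∈ visits (GenCode.loops S) N)
    (h0 : s.1 = 0) {z : Fin m → ℤ} (hz : z ∈ AddSubgroup.closure {z | ([], z) ∈ K}) :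
    ∃ N', (0, s.2.1, s.2.2 + z) ∈ visits (GenCode.loops S) N' := by
  induction hz using AddSubgroup.closure_induction_right with
  | zero =>
    refine ⟨N, ?_⟩
    rw [add_zero, ← h0]
    exact hs
  | add_right x y hx hy ih =>
    obtain ⟨N', h⟩ := ih
    refine ⟨N' + 1, ?_⟩
    have := extend_mem_visits h (GenCode.mem_loops.2 ⟨_, hK hy, .inl rfl⟩) rfl
    simpa [VisitCode.extend, add_assoc] using this
  | add_neg_cancel x y hx hy ih =>
    obtain ⟨N', h⟩ := ih
    refine ⟨N' + 1, ?_⟩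
    have := extend_mem_visits h (GenCode.mem_loops.2 ⟨_, hK hy, .inr rfl⟩) rfl
    simpa [VisitCode.extend, add_assoc] using this

theorem GenCode.subgroup_append_kernel {K : GenCode n m} (hK : IsKernelCode π K)
    (S : GenCode n m) : GenCode.subgroup enum π (S ++ K) = GenCode.subgroup enum π S := by
  refine le_antisymm ((Subgroup.closure_le _).2 ?_) (Subgroup.closure_mono ?_)
  · rintro _ ⟨s, hs, rfl⟩
    rcases List.mem_append.1 hs with hs | hs
    · exact codeValue_mem_subgroup hs
    · have h := hK.1 s hs
      have : codeValue enum π s = 1 := by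
        simp [codeValue, h.1, h.2, ← FreeGroup.one_eq_mk, Prod.one_eq_mk]
      change codeValue enum π s ∈ _
      rw [this]
      exact one_mem _
  · rintro _ ⟨s, hs, rfl⟩
    exact ⟨s, List.mem_append_left _ hs, rfl⟩

/-- Loops from `K` have value 1, so the elements of `T` are products of elements of `S` and their
inverses. -/
theorem GenCode.Covers.le {K : GenCode n m} (hK : IsKernelCode π K) {N : ℕ} {S T : GenCode n m}
    (h : GenCode.Covers N (S ++ K) T) :
    GenCode.subgroup enum π T ≤ GenCode.subgroup enum π S := by
  rw [← GenCode.subgroup_append_kernel hK S]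
  refine (Subgroup.closure_le _).2 ?_
  rintro _ ⟨t, ht, rfl⟩
  obtain ⟨s, hs, h₁, h₂⟩ := h t ht
  have : codeValue enum π t = codeValue enum π s.2 :=
    codeValue_eq_iff.2 ⟨h₁.symm, by rw [h₂]⟩
  change codeValue enum π t ∈ _
  rw [this]
  exact (codeValue_mem_of_mem_visits hs).2

theorem GenCode.Covers.mono {N N' : ℕ} (hN : N ≤ N') {S T : GenCode n m}
    (h : GenCode.Covers N S T) : GenCode.Covers N' S T := fun t ht =>
  let ⟨s, hs, h⟩ := h t ht
  ⟨s, visits_mono hN hs, h⟩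

theorem exists_forall_mem_of_mono {α : Type*} {l : List α} {P : ℕ → α → Prop}
    (hP : ∀ N N' a, N ≤ N' → P N a → P N' a) (h : ∀ a ∈ l, ∃ N, P N a) :
    ∃ N, ∀ a ∈ l, P N a := by
  induction l with
  | nil => exact ⟨0, by simp⟩
  | cons a l ih =>
    obtain ⟨N, hN⟩ := ih fun b hb => h b (by simp [hb])
    obtain ⟨N', hN'⟩ := h a (by simp)
    refine ⟨max N N', fun b hb => ?_⟩
    rcases List.mem_cons.1 hb with rfl | hb
    · exact hP _ _ _ (le_max_right _ _) hN'
    · exact hP _ _ _ (le_max_left _ _) (hN b hb)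

theorem GenCode.exists_covers (enum : Fin n ≃ X) {K : GenCode n m} (hK : IsKernelCode π K)
    {S T : GenCode n m} (h : GenCode.subgroup enum π T ≤ GenCode.subgroup enum π S) :
    ∃ N, GenCode.Covers N (S ++ K) T := by
  refine exists_forall_mem_of_mono (P := fun N (t : List (Fin n × Bool) × (Fin m → ℤ)) => ∃ s ∈ visits (GenCode.loops (S ++ K)) N,
    FreeGroup.reduce s.2.1 = FreeGroup.reduce t.1 ∧ s.2.2 = t.2)
    (fun N N' t hN ⟨s, hs, h⟩ => ⟨s, visits_mono hN hs, h⟩) fun t ht => ?_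
  obtain ⟨N, s, hs, h0, hv⟩ := exists_visit_of_mem_subgroup (List.subset_append_left S K)
    (h (codeValue_mem_subgroup ht))
  obtain ⟨h₁, h₂⟩ := codeValue_eq_iff.1 hv
  -- The product found has the right value in `A` but possibly a different integer vector; the
  -- difference lies in the kernel of `π` and is corrected by loops from `K`.
  obtain ⟨N', h'⟩ := exists_visit_add_of_mem_closure (List.subset_append_right S K) hs h0 (hK.2 (t.2 - s.2.2) (by rw [map_sub, h₂, sub_self]))
  exact ⟨N', _, h', h₁, add_sub_cancel _ _⟩

/-! #### Walks in the automaton of a code -/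

section Automaton

variable {c : AutomatonCode n m}

/-- The arc of the code corresponding to an arc of the automaton. -/
def AutomatonCode.arcData (c : AutomatonCode n m) (j : Fin c.2.1.length) (s : Bool) :
    ℕ × ℕ × (Fin n × Bool) × (Fin m → ℤ) :=
  let e := c.2.1.get j
  if s then (e.1 % (c.1 + 1), e.2.1 % (c.1 + 1), (e.2.2.1, true), -e.2.2.2.1 + e.2.2.2.2)
  else (e.2.1 % (c.1 + 1), e.1 % (c.1 + 1), (e.2.2.1, false), -e.2.2.2.2 + e.2.2.2.1)

theorem AutomatonCode.mem_letterArcs {b : ℕ × ℕ × (Fin n × Bool) × (Fin m → ℤ)} :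
    b ∈ AutomatonCode.letterArcs c ↔ ∃ j s, b = AutomatonCode.arcData c j s := by
  simp only [AutomatonCode.letterArcs, List.mem_flatMap, List.mem_cons, List.not_mem_nil, or_false]
  constructor
  · rintro ⟨e, he, h⟩
    obtain ⟨j, rfl⟩ := List.get_of_mem he
    rcases h with rfl | rfl
    · exact ⟨j, true, rfl⟩
    · exact ⟨j, false, rfl⟩
  · rintro ⟨j, _ | _, rfl⟩
    · exact ⟨_, List.get_mem _ j, .inr rfl⟩
    · exact ⟨_, List.get_mem _ j, .inl rfl⟩

variable (enum π c) in
/-- The automaton of a code. -/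
abbrev codeAut : EnrichedAutomaton.{u, v, w} X A := AutomatonCode.automaton enum π c

theorem val_origin (a : (codeAut.{u, v, w} enum π c).Arc) :
    ((codeAut enum π c).origin a).down.val = (AutomatonCode.arcData c a.1.down a.2).1 := by
  rcases a with ⟨⟨j⟩, _ | _⟩ <;> rfl

theorem val_terminus (a : (codeAut.{u, v, w} enum π c).Arc) :
    ((codeAut enum π c).terminus a).down.val = (AutomatonCode.arcData c a.1.down a.2).2.1 := by
  rcases a with ⟨⟨j⟩, _ | _⟩ <;> rfl

theorem letter_codeAut (a : (codeAut.{u, v, w} enum π c).Arc) :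
    (codeAut enum π c).letter a =
      (enum (AutomatonCode.arcData c a.1.down a.2).2.2.1.1,
        (AutomatonCode.arcData c a.1.down a.2).2.2.1.2) := by
  rcases a with ⟨⟨j⟩, _ | _⟩ <;> rfl

theorem arcLabel_codeAut (a : (codeAut.{u, v, w} enum π c).Arc) :
    (codeAut enum π c).arcLabel a =
      codeValue enum π ([(AutomatonCode.arcData c a.1.down a.2).2.2.1],
        (AutomatonCode.arcData c a.1.down a.2).2.2.2) := by
  rcases a with ⟨⟨j⟩, _ | _⟩ <;>
  exact Prod.ext rfl (congrArg Multiplicative.ofAdd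
    ((map_add π _ _).trans (congrArg (· + _) (map_neg π _))).symm)

theorem exists_walk_of_mem_visits {N : ℕ} {s : VisitCode n m}
    (hs : s ∈ visits (AutomatonCode.arcs c) N) :
    ∃ (l : List (codeAut.{u, v, w} enum π c).Arc) (q : (codeAut.{u, v, w} enum π c).V),
      q.down.val = s.1 ∧ (codeAut enum π c).IsWalk (codeAut enum π c).base l q ∧
      l.map (codeAut enum π c).letter = s.2.1.map (fun y => (enum y.1, y.2)) ∧
      (codeAut enum π c).walkLabel l = codeValue enum π s.2 := by
  refine visits_induction (P := fun s => ∃ (l : List (codeAut.{u, v, w} enum π c).Arc)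
    (q : (codeAut.{u, v, w} enum π c).V), q.down.val = s.1 ∧
      (codeAut enum π c).IsWalk (codeAut enum π c).base l q ∧
      l.map (codeAut enum π c).letter = s.2.1.map (fun y => (enum y.1, y.2)) ∧
      (codeAut enum π c).walkLabel l = codeValue enum π s.2) ?_ ?_ hs
  · exact ⟨[], _, rfl, rfl, rfl, by rw [codeValue_nil]; rfl⟩
  · rintro s ⟨l, q, hq, hl, hw, hv⟩ b hb hbs
    obtain ⟨b', hb', rfl⟩ := List.mem_map.1 hb
    obtain ⟨j, t, rfl⟩ := AutomatonCode.mem_letterArcs.1 hb'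
    let a : (codeAut.{u, v, w} enum π c).Arc := (ULift.up j, t)
    refine ⟨l ++ [a], (codeAut enum π c).terminus a, val_terminus a, hl.append ⟨?_, rfl⟩, ?_, ?_⟩
    · refine ULift.ext _ _ (Fin.ext ?_)
      rw [val_origin, hq]
      exact hbs
    · rw [List.map_append, hw]
      simp only [VisitCode.extend, List.map_append, List.map_singleton, letter_codeAut]
      rfl
    · rw [walkLabel_append, hv]
      have : (codeAut enum π c).walkLabel [a] = (codeAut enum π c).arcLabel a := by
        simp [walkLabel]
      rw [this, arcLabel_codeAut]
      exact (codeValue_append _ _ _ _).symm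

theorem exists_mem_visits_of_walk {l : List (codeAut.{u, v, w} enum π c).Arc}
    {q : (codeAut.{u, v, w} enum π c).V}
    (hl : (codeAut enum π c).IsWalk (codeAut enum π c).base l q) :
    ∃ s ∈ visits (AutomatonCode.arcs c) l.length, s.1 = q.down.val ∧
      l.map (codeAut enum π c).letter = s.2.1.map (fun y => (enum y.1, y.2)) ∧
      (codeAut enum π c).walkLabel l = codeValue enum π s.2 := by
  induction l using List.reverseRecOn generalizing q with
  | nil =>
    obtain rfl : _ = q := hl
    exact ⟨_, start_mem_visits, rfl, rfl, by rw [codeValue_nil]; rfl⟩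
  | append_singleton l a ih =>
    obtain ⟨p, hp, ha, rfl⟩ := isWalk_append.1 hl
    obtain ⟨s, hs, hsp, hw, hv⟩ := ih hp
    have hb : ((AutomatonCode.arcData c a.1.down a.2).1, (AutomatonCode.arcData c a.1.down a.2).2.1,
        [(AutomatonCode.arcData c a.1.down a.2).2.2.1],
        (AutomatonCode.arcData c a.1.down a.2).2.2.2) ∈ AutomatonCode.arcs c :=
      List.mem_map.2 ⟨_, AutomatonCode.mem_letterArcs.2 ⟨_, _, rfl⟩, rfl⟩
    have hext := extend_mem_visits hs hb (by rw [hsp, ← ha, val_origin])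
    refine ⟨_, by rw [List.length_append]; exact hext, ?_, ?_, ?_⟩
    · exact (val_terminus a).symm
    · rw [List.map_append, hw]
      simp only [VisitCode.extend, List.map_append, List.map_singleton, letter_codeAut]
    · rw [walkLabel_append, hv]
      have : (codeAut enum π c).walkLabel [a] = (codeAut enum π c).arcLabel a := by
        simp [walkLabel]
      rw [this, arcLabel_codeAut]
      exact (codeValue_append _ _ _ _).symm

/-- The walk grows by at most one arc with each new vertex. This gives the length bound for the
generating closed walks. -/
theorem XAutomaton.TreeStage.exists_walk_lt {Γ : XAutomaton.{u, v} X} {ord : LinearOrder (X × Bool)}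
    {l : List Γ.V} {T : Set Γ.E} (h : Γ.TreeStage ord l T) :
    ∀ v ∈ l, ∃ k, Γ.IsWalk Γ.base k v ∧ k.length < l.length := by
  induction h with
  | start =>
    intro v hv
    obtain rfl : v = Γ.base := by simpa using hv
    exact ⟨[], rfl, Nat.one_pos⟩
  | grow l₁ l₂ p T a hst _ hp hnew _ ih =>
    intro v hv
    rcases List.mem_append.1 hv with hv | hv
    · obtain ⟨k, hk, hlt⟩ := ih v hv
      exact ⟨k, hk, hlt.trans (by rw [List.length_append]; simp)⟩
    · obtain rfl : v = Γ.terminus a := by simpa using hv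
      obtain ⟨k, hk, hlt⟩ := ih p (by simp)
      refine ⟨k ++ [a], hk.append ⟨hp, rfl⟩, ?_⟩
      rw [List.length_append, List.length_append]
      simpa using hlt

/-- The generators computed from a code generate the recognized subgroup. -/
theorem subgroup_generators [Finite X] {ord : LinearOrder (X × Bool)}
    (h : (codeAut.{u, v, w} enum π c).IsNormalized ord) :
    GenCode.subgroup enum π (AutomatonCode.generators c) =
      (codeAut.{u, v, w} enum π c).recognized := by
  have hmem : ∀ l, (codeAut.{u, v, w} enum π c).IsWalk (codeAut enum π c).base l
      (codeAut enum π c).base → l.length ≤ 2 * c.1 + 1 → (codeAut.{u, v, w} enum π c).walkLabel l ∈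
        GenCode.subgroup enum π (AutomatonCode.generators c) := by
    intro l hl hlen
    obtain ⟨s, hs, h0, -, hv⟩ := exists_mem_visits_of_walk hl
    rw [hv]
    refine codeValue_mem_subgroup (List.mem_append_left _ (List.mem_map_of_mem ?_))
    simpa using ⟨visits_mono hlen hs, h0⟩
  -- There are `c.1 + 1` vertices, so walks of length at most `c.1` reach all of them, and closing
  -- up through one further arc costs at most `2 * c.1 + 1`.
  have hshort : ∀ q, ∃ l, (codeAut.{u, v, w} enum π c).IsWalk (codeAut enum π c).base l q ∧
      l.length ≤ c.1 := by
    intro q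
    obtain ⟨L, T, hst, hq⟩ := exists_treeStage_mem h.1.1 h.1.2.exists_walk ord q
    obtain ⟨l, hl, hlt⟩ := hst.exists_walk_lt q hq
    refine ⟨l, hl, ?_⟩
    have : Fintype (codeAut.{u, v, w} enum π c).V :=
      inferInstanceAs (Fintype (ULift.{v} (Fin (c.1 + 1))))
    have h₁ := hst.nodup.length_le_card
    have h₂ : Nat.card (codeAut.{u, v, w} enum π c).V = c.1 + 1 := by
      change Nat.card (ULift.{v} (Fin (c.1 + 1))) = _
      simp
    rw [Nat.card_eq_fintype_card] at h₂
    omega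
  choose k hk hklen using hshort
  refine le_antisymm ((Subgroup.closure_le _).2 ?_) (recognized_le_of_closed (fun l hl => ?_) ?_)
  · rintro _ ⟨y, hy, rfl⟩
    rcases List.mem_append.1 hy with hy | hy
    · obtain ⟨s, hs, rfl⟩ := List.mem_map.1 hy
      simp only [List.mem_filter, decide_eq_true_eq] at hs
      obtain ⟨l, q, hq, hl, -, hv⟩ := exists_walk_of_mem_visits (enum := enum) (π := π) hs.1
      have hq0 : q = (codeAut.{u, v, w} enum π c).base :=
        ULift.ext _ _ (Fin.ext (hq.trans hs.2))
      rw [hq0] at hl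
      change codeValue enum π s.2 ∈ _
      rw [← hv]
      exact walkLabel_mem_recognized hl
    · obtain ⟨z, hz, rfl⟩ := List.mem_map.1 hy
      exact baseSubgroup_mem_recognized (AddSubgroup.subset_closure ⟨z, hz, rfl⟩)
  · let M := GenCode.subgroup enum π (AutomatonCode.generators c)
    -- The chosen walk to the basepoint need not be empty, so its label has to be removed by
    -- conjugation; it is itself one of the generators.
    have hb := hmem _ (hk (codeAut.{u, v, w} enum π c).base) ((hklen _).trans (by omega))
    have key := conj_walkLabel_mem (M := M) (fun q => (codeAut.{u, v, w} enum π c).walkLabel (k q))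
      (fun e => ?_) hl
    · have := mul_mem (mul_mem (inv_mem hb) key) hb
      simpa [mul_assoc] using this
    · have := hmem (k ((codeAut.{u, v, w} enum π c).src e) ++ (e, true) ::
        ((k ((codeAut.{u, v, w} enum π c).tgt e)).map (codeAut enum π c).invArc).reverse)
        ((hk _).append ⟨rfl, (hk _).reverse⟩) ?_
      · rw [walkLabel_append, walkLabel_cons, walkLabel_reverse, ← mul_assoc] at this
        exact this
      · have h₁ := hklen ((codeAut.{u, v, w} enum π c).src e)
        have h₂ := hklen ((codeAut.{u, v, w} enum π c).tgt e)
        simp only [List.length_append, List.length_cons, List.length_reverse, List.length_map]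
        omega
  · intro a ha
    induction ha using AddSubgroup.closure_induction with
    | mem a ha =>
      obtain ⟨z, hz, rfl⟩ := ha
      exact codeValue_mem_subgroup (y := ([], z))
        (List.mem_append_right _ (List.mem_map_of_mem hz))
    | zero => exact one_mem _
    | add a b _ _ ha hb => simpa using mul_mem ha hb
    | neg a _ ha => simpa using inv_mem ha

end Automaton

end Semantics


/-! ### Valid codes are exactly the tree-ordered descriptions of normalized automata -/

section Validity

namespace XAutomaton

variable {X : Type u} {Γ : XAutomaton.{u, v} X} {ord : LinearOrder (X × Bool)}

theorem TreeStage.getElem?_zero {l : List Γ.V} {T : Set Γ.E} (h : Γ.TreeStage ord l T) :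
    l[0]? = some Γ.base := by
  induction h with
  | start => rfl
  | grow l₁ l₂ p T a _ _ _ _ _ ih =>
    rw [List.getElem?_append_left (by simp), ih]

/-- The arcs of the order tree are lexicographically minimal. -/
theorem TreeStage.exists_min {l : List Γ.V} {T : Set Γ.E} (h : Γ.TreeStage ord l T) (i : ℕ)
    (hi : i + 1 < l.length) :
    ∃ (a : Γ.Arc) (j : ℕ), a.1 ∈ T ∧ j ≤ i ∧ l[j]? = some (Γ.origin a) ∧
      l[i + 1]? = some (Γ.terminus a) ∧ ∀ (b : Γ.Arc) (j' : ℕ), j' ≤ i →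
        l[j']? = some (Γ.origin b) → Γ.terminus b ∉ l.take (i + 1) →
          j < j' ∨ j = j' ∧ ord.le (Γ.letter a) (Γ.letter b) := by
  induction h with
  | start => simp at hi
  | grow l₁ l₂ p T a hst hold hp hnew hsm ih =>
    set L := l₁ ++ p :: l₂ with hL
    have hlen : (L ++ [Γ.terminus a]).length = L.length + 1 := by simp
    rcases Nat.lt_or_ge (i + 1) L.length with hlt | hge
    · obtain ⟨a', j, h₁, h₂, h₃, h₄, h₅⟩ := ih hlt
      refine ⟨a', j, .inr h₁, h₂, ?_, ?_, fun b j' hj' hb hb' => h₅ b j' hj' ?_ ?_⟩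
      · rwa [List.getElem?_append_left (by omega)]
      · rwa [List.getElem?_append_left (by omega)]
      · rwa [List.getElem?_append_left (by omega)] at hb
      · rwa [List.take_append_of_le_length hlt.le] at hb'
    · have hi' : i + 1 = L.length := by omega
      have hl₁ : l₁.length ≤ i := by
        have : L.length = l₁.length + (l₂.length + 1) := by simp [hL]
        omega
      refine ⟨a, l₁.length, .inl rfl, hl₁, ?_, ?_, fun b j' hj' hb hb' => ?_⟩
      · rw [List.getElem?_append_left (by omega), hL, hp]
        simp
      · rw [hi']
        simp
      · rw [hi', List.take_left'  rfl] at hb'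
        rw [List.getElem?_append_left (by omega)] at hb
        -- Arcs are compared by the position of their origin and then by letter. An earlier origin
        -- is excluded because `p` is the oldest vertex with an arc leading outside.
        rcases Nat.lt_trichotomy l₁.length j' with hlt | rfl | hgt
        · exact .inl hlt
        · refine .inr ⟨rfl, hsm b ?_ hb'⟩
          rw [hL] at hb
          simpa using hb.symm
        · rw [hL, List.getElem?_append_left hgt] at hb
          exact absurd (hold b (List.mem_of_getElem? hb)) hb'

theorem exists_treeStage_forall_mem [Finite X] (hd : Γ.IsDeterministic)
    (hc : ∀ v, ∃ l, Γ.IsWalk Γ.base l v) (ord : LinearOrder (X × Bool)) [Finite Γ.V] :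
    ∃ l T, Γ.TreeStage ord l T ∧ ∀ v, v ∈ l := by
  have key : ∀ s : List Γ.V, ∃ l T, Γ.TreeStage ord l T ∧ ∀ v ∈ s, v ∈ l := by
    intro s
    induction s with
    | nil => exact ⟨_, _, .start, by simp⟩
    | cons v s ih =>
      obtain ⟨l, T, h, hs⟩ := ih
      obtain ⟨l', T', h', hv⟩ := exists_treeStage_mem hd hc ord v
      rcases le_total l.length l'.length with hle | hle
      · have := (h.prefix hd h' hle).1.subset
        refine ⟨l', T', h', fun q hq => ?_⟩
        rcases List.mem_cons.1 hq with rfl | hq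
        · exact hv
        · exact this (hs q hq)
      · have := (h'.prefix hd h hle).1.subset
        refine ⟨l, T, h, fun q hq => ?_⟩
        rcases List.mem_cons.1 hq with rfl | hq
        · exact this hv
        · exact hs q hq
  have := Fintype.ofFinite Γ.V
  obtain ⟨l, T, h, hl⟩ := key Finset.univ.toList
  exact ⟨l, T, h, fun v => hl v (by simp)⟩

end XAutomaton

variable {X : Type u} {A : Type w} [AddCommGroup A] {n m : ℕ} {enum : Fin n ≃ X}
  {π : (Fin m → ℤ) →+ A}

/-- The order on letters transported along an enumeration of `X`. -/
abbrev letterOrder (enum : Fin n ≃ X) (ord : LinearOrder (X × Bool)) :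
    LinearOrder (Fin n × Bool) :=
  @LinearOrder.lift' _ _ ord (fun y => (enum y.1, y.2)) fun a b h => by
    simpa [Prod.ext_iff] using h

theorem nodup_map_iff_injective_get {α β : Type*} (f : α → β) (l : List α) :
    (l.map f).Nodup ↔ Function.Injective fun j : Fin l.length => f (l.get j) := by
  rw [← List.nodup_ofFn]
  have : l.map f = List.ofFn fun j : Fin l.length => f (l.get j) := by
    conv_lhs => rw [← List.ofFn_get l, List.map_ofFn]
    rfl
  rw [this]

variable {c : AutomatonCode n m}

/-- A positive and an inverse arc never carry the same letter, so it suffices to compare positive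
arcs by origin and label, and inverse arcs by end and label. -/
theorem isDeterministic_codeAut_iff :
    (codeAut.{u, v, w} enum π c).IsDeterministic ↔
      (c.2.1.map fun e => (e.1 % (c.1 + 1), e.2.2.1)).Nodup ∧
      (c.2.1.map fun e => (e.2.1 % (c.1 + 1), e.2.2.1)).Nodup := by
  rw [nodup_map_iff_injective_get, nodup_map_iff_injective_get]
  constructor
  · intro hd
    constructor
    · intro i j hij
      simp only [Prod.mk.injEq] at hij
      have := hd (ULift.up i, true) (ULift.up j, true) (ULift.ext _ _ (Fin.ext hij.1))
        (Prod.ext (congrArg enum hij.2) rfl)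
      exact congrArg (fun a => a.1.down) this
    · intro i j hij
      simp only [Prod.mk.injEq] at hij
      have := hd (ULift.up i, false) (ULift.up j, false) (ULift.ext _ _ (Fin.ext hij.1))
        (Prod.ext (congrArg enum hij.2) rfl)
      exact congrArg (fun a => a.1.down) this
  · rintro ⟨h₁, h₂⟩ ⟨⟨i⟩, s⟩ ⟨⟨j⟩, t⟩ ho hl
    obtain rfl : s = t := congrArg Prod.snd hl
    have hl' := enum.injective (congrArg Prod.fst hl)
    have ho' := congrArg (fun q => q.down.val) ho
    cases s
    · rw [h₂ (a₁ := i) (a₂ := j) (Prod.ext ho' hl')]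
    · rw [h₁ (a₁ := i) (a₂ := j) (Prod.ext ho' hl')]

theorem codeAut_V_ext {p q : (codeAut.{u, v, w} enum π c).V} (h : p.down.val = q.down.val) :
    p = q := ULift.ext _ _ (Fin.ext h)

theorem val_lt_of_codeAut (p : (codeAut.{u, v, w} enum π c).V) : p.down.val < c.1 + 1 :=
  p.down.isLt

/-- In a valid code, the vertices are numbered in the order of the order tree. -/
theorem AutomatonCode.Valid.numbered {ord : LinearOrder (X × Bool)} {N : ℕ}
    (h : AutomatonCode.Valid (letterOrder enum ord) c N)
    {l : List (codeAut.{u, v, w} enum π c).V} {T : Set (codeAut.{u, v, w} enum π c).E}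
    (hst : (codeAut enum π c).TreeStage ord l T) :
    (∀ (j : ℕ) (q : (codeAut.{u, v, w} enum π c).V), l[j]? = some q → q.down.val = j) ∧
      ∀ e ∈ T, (codeAut enum π c).lab₂ e = 0 := by
  obtain ⟨hn₁, hn₂, hz, hbfs, -⟩ := h
  have hd : (codeAut.{u, v, w} enum π c).IsDeterministic :=
    isDeterministic_codeAut_iff.2 ⟨hn₁, hn₂⟩
  induction hst with
  | start =>
    refine ⟨fun j q hj => ?_, by simp⟩
    rcases j with _ | j
    · obtain rfl : _ = q := by simpa using hj
      rfl
    · simp at hj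
  | grow l₁ l₂ p T a hst hold hp hnew hsm ih =>
    obtain ⟨ihn, ihT⟩ := ih
    set L := l₁ ++ p :: l₂ with hL
    have hlt : ∀ q ∈ L, q.down.val < L.length := by
      intro q hq
      obtain ⟨j, hj⟩ := List.getElem?_of_mem hq
      rw [ihn j q hj]
      exact (List.getElem?_eq_some_iff.1 hj).1
    have hget : ∀ q : (codeAut.{u, v, w} enum π c).V, q.down.val < L.length →
        L[q.down.val]? = some q := by
      intro q hq
      have := List.getElem?_eq_getElem hq
      rw [this, Option.some.injEq]
      exact codeAut_V_ext (ihn _ _ this)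
    have hmem : ∀ q : (codeAut.{u, v, w} enum π c).V, q.down.val < L.length → q ∈ L :=
      fun q hq => List.mem_of_getElem? (hget q hq)
    have hpval : p.down.val = l₁.length := ihn _ _ (by simp [hL])
    have hLpos : L.length = l₁.length + (l₂.length + 1) := by simp [hL]
    have hl₁ : ∀ q : (codeAut.{u, v, w} enum π c).V, q.down.val < l₁.length → q ∈ l₁ := by
      intro q hq
      have := hget q (by omega)
      rw [hL, List.getElem?_append_left hq] at this
      exact List.mem_of_getElem? this
    have hta : L.length ≤ ((codeAut enum π c).terminus a).down.val := by
      by_contra hlt'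
      exact hnew (hmem _ (by omega))
    have htk := val_lt_of_codeAut ((codeAut.{u, v, w} enum π c).terminus a)
    -- The reached vertices are those numbered below `L.length`, and `terminus a` is a further one.
    -- The criterion therefore applies to `i = L.length - 1` and supplies an arc into the vertex
    -- numbered `L.length`.
    obtain ⟨a', ha', hao, hat, haz, hmin⟩ := hbfs (L.length - 1) (by omega)
    obtain ⟨j, s, rfl⟩ := AutomatonCode.mem_letterArcs.1 ha'
    let α : (codeAut.{u, v, w} enum π c).Arc := (ULift.up j, s)
    have hαo : ((codeAut.{u, v, w} enum π c).origin α).down.val = _ := val_origin α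
    have hαt : ((codeAut.{u, v, w} enum π c).terminus α).down.val = _ := val_terminus α
    change ((codeAut.{u, v, w} enum π c).origin α).down.val =
      (AutomatonCode.arcData c j s).1 at hαo
    change ((codeAut.{u, v, w} enum π c).terminus α).down.val =
      (AutomatonCode.arcData c j s).2.1 at hαt
    have hαnew : (codeAut.{u, v, w} enum π c).terminus α ∉ L := fun hm => by
      have := hlt _ hm
      omega
    have haor := val_origin a
    have hater := val_terminus a
    rw [hp] at haor
    -- Both arcs are minimal. Comparing `α` with `a`, an origin before `p` contradicts that `p` is
    -- oldest; so the origins coincide, the letters are equal by antisymmetry, and determinism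
    -- applies.
    have hαa : α = a := by
      rcases hmin _ (AutomatonCode.mem_letterArcs.2 ⟨a.1.down, a.2, rfl⟩) with h | h | h | h
      · omega
      · omega
      · refine absurd (hold α (hl₁ _ ?_)) hαnew
        omega
      · obtain ⟨h₁, h₂⟩ := h
        have hαp : (codeAut.{u, v, w} enum π c).origin α = p := codeAut_V_ext (by omega)
        refine hd _ _ (hαp.trans hp.symm) (ord.le_antisymm _ _ ?_ (hsm α hαp hαnew))
        rw [letter_codeAut, letter_codeAut]
        exact h₂
    refine ⟨fun i q hq => ?_, ?_⟩
    · rcases Nat.lt_or_ge i L.length with hi | hi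
      · rw [List.getElem?_append_left hi] at hq
        exact ihn i q hq
      · rw [List.getElem?_append_right hi] at hq
        obtain ⟨hi', hq'⟩ := List.getElem?_eq_some_iff.1 hq
        simp only [List.length_singleton] at hi'
        simp only [List.getElem_singleton] at hq'
        rw [← hq', ← hαa, hαt, hat]
        omega
    · rintro e (rfl | he)
      · rw [← hαa]
        have h0 := hz _ (List.get_mem c.2.1 j)
        have : (c.2.1.get j).2.2.2.2 = 0 := by
          simp only [AutomatonCode.arcData, List.get_eq_getElem] at h0 haz ⊢
          cases s <;> simpa [h0] using haz
        change π (c.2.1.get j).2.2.2.2 = 0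
        rw [this, map_zero]
      · exact ihT e he

theorem map_letter_reverse {Γ : XAutomaton.{u, v} X} (l : List Γ.Arc) :
    (l.map Γ.invArc).reverse.map Γ.letter = FreeGroup.invRev (l.map Γ.letter) := by
  rw [FreeGroup.invRev, List.map_reverse, List.map_map, List.map_map]
  rfl

/-- Soundness of the certificate: of the two recorded walks to a vertex, the second is run
backwards, and the reduced word says that the resulting closed walk does not backtrack. -/
theorem AutomatonCode.Valid.isNormalized {ord : LinearOrder (X × Bool)} {N : ℕ}
    (h : AutomatonCode.Valid (letterOrder enum ord) c N) :
    (codeAut.{u, v, w} enum π c).IsNormalized ord := by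
  refine ⟨⟨isDeterministic_codeAut_iff.2 ⟨h.1, h.2.1⟩, fun p => ?_⟩, fun e => ?_, ?_⟩
  · obtain ⟨s, hs, s', hs', h₁, h₂, hred⟩ := h.2.2.2.2 p.down.val p.down.isLt
    obtain ⟨l, q, hq, hl, hw, -⟩ := exists_walk_of_mem_visits (enum := enum) (π := π) hs
    obtain ⟨l', q', hq', hl', hw', -⟩ := exists_walk_of_mem_visits (enum := enum) (π := π) hs'
    obtain rfl : q = p := codeAut_V_ext (hq.trans h₁)
    obtain rfl : q' = q := codeAut_V_ext ((hq'.trans h₂).trans rfl)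
    refine ⟨l, _, hl, hl'.reverse, noBacktrack_of_isReduced ?_⟩
    rw [List.map_append, map_letter_reverse, hw, hw', ← map_invRev, ← List.map_append,
      isReduced_map_iff enum.injective]
    exact hred
  · change π (c.2.1.get e.down).2.2.2.1 = 0
    rw [h.2.2.1 _ (List.get_mem c.2.1 e.down), map_zero]
  · rintro e ⟨l, T, hst, he⟩
    exact (h.numbered hst).2 e he

/-- Completeness of the certificate: minimality of the tree arcs is `TreeStage.exists_min`, and the
walks witnessing the core property at the finitely many vertices have a common length bound. -/
theorem AutomatonCode.exists_valid {ord : LinearOrder (X × Bool)}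
    (hr : (codeAut.{u, v, w} enum π c).IsReduced) (hz : ∀ e ∈ c.2.1, e.2.2.2.1 = 0)
    {l : List (codeAut.{u, v, w} enum π c).V} {T : Set (codeAut.{u, v, w} enum π c).E}
    (hst : (codeAut enum π c).TreeStage ord l T) (hlen : l.length = c.1 + 1)
    (hnum : ∀ (j : ℕ) (q : (codeAut.{u, v, w} enum π c).V), l[j]? = some q → q.down.val = j)
    (hT : ∀ e ∈ T, (c.2.1.get e.down).2.2.2.2 = 0) :
    ∃ N, AutomatonCode.Valid (letterOrder enum ord) c N := by
  obtain ⟨hn₁, hn₂⟩ := isDeterministic_codeAut_iff.1 hr.1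
  have hcore : ∃ N, ∀ i ∈ List.range (c.1 + 1), ∃ s ∈ visits (AutomatonCode.arcs c) N,
      ∃ s' ∈ visits (AutomatonCode.arcs c) N,
        s.1 = i ∧ s'.1 = i ∧ FreeGroup.IsReduced (s.2.1 ++ FreeGroup.invRev s'.2.1) := by
    refine exists_forall_mem_of_mono (P := fun N i => ∃ s ∈ visits (AutomatonCode.arcs c) N,
      ∃ s' ∈ visits (AutomatonCode.arcs c) N,
        s.1 = i ∧ s'.1 = i ∧ FreeGroup.IsReduced (s.2.1 ++ FreeGroup.invRev s'.2.1))
      (fun N N' i hN ⟨s, hs, s', hs', h⟩ => ⟨s, visits_mono hN hs, s', visits_mono hN hs', h⟩)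
      fun i hi => ?_
    rw [List.mem_range] at hi
    obtain ⟨l₁, l₂, h₁, h₂, hn⟩ := hr.2 (ULift.up ⟨i, hi⟩)
    have hred := isReduced_map_letter hr.1 (h₁.append h₂) hn
    obtain ⟨s, hs, hsi, hsw, -⟩ := exists_mem_visits_of_walk h₁
    obtain ⟨s', hs', hsi', hsw', -⟩ := exists_mem_visits_of_walk h₂.reverse
    refine ⟨_, s, visits_mono (le_max_left _ _) hs, s', visits_mono (le_max_right _ _) hs', hsi,
      hsi', ?_⟩
    rw [← isReduced_map_iff enum.injective, List.map_append, map_invRev, ← hsw, ← hsw',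
      map_letter_reverse, FreeGroup.invRev_invRev, ← List.map_append]
    exact hred
  obtain ⟨N, hN⟩ := hcore
  refine ⟨N, hn₁, hn₂, hz, fun i hi => ?_, fun i hi => hN i (List.mem_range.2 hi)⟩
  obtain ⟨a, j, haT, hji, ho, ht, hmin⟩ := hst.exists_min i (by omega)
  refine ⟨_, AutomatonCode.mem_letterArcs.2 ⟨a.1.down, a.2, rfl⟩, ?_, ?_, ?_, ?_⟩
  · rw [← val_origin, hnum _ _ ho]; exact hji
  · rw [← val_terminus, hnum _ _ ht]
  · have h₁ := hz _ (List.get_mem c.2.1 a.1.down)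
    have h₂ := hT _ haT
    unfold AutomatonCode.arcData
    cases a.2 <;> simp only [h₁, h₂] <;> simp
  · intro b hb
    obtain ⟨j', s, rfl⟩ := AutomatonCode.mem_letterArcs.1 hb
    let β : (codeAut.{u, v, w} enum π c).Arc := (ULift.up j', s)
    have hβo : ((codeAut.{u, v, w} enum π c).origin β).down.val =
      (AutomatonCode.arcData c j' s).1 := val_origin β
    have hβt : ((codeAut.{u, v, w} enum π c).terminus β).down.val =
      (AutomatonCode.arcData c j' s).2.1 := val_terminus β
    have hget : ∀ q : (codeAut.{u, v, w} enum π c).V, l[q.down.val]? = some q := by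
      intro q
      have hq : q.down.val < l.length := by rw [hlen]; exact q.down.isLt
      have := List.getElem?_eq_getElem hq
      rw [this, Option.some.injEq]
      exact codeAut_V_ext (hnum _ _ this)
    rw [← val_origin a, ← hβo, ← hβt]
    rcases Nat.lt_or_ge i ((codeAut.{u, v, w} enum π c).origin β).down.val with h₁ | h₁
    · exact .inl h₁
    rcases Nat.lt_or_ge i ((codeAut.{u, v, w} enum π c).terminus β).down.val with h₂ | h₂
    · have hao := hnum _ _ ho
      have := hmin β _ h₁ (hget _) (fun hm => ?_)
      · rw [← hao] at this
        refine .inr (.inr (this.imp_right fun h => ⟨h.1, ?_⟩))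
        have h' := h.2
        rw [letter_codeAut, letter_codeAut] at h'
        exact h'
      · obtain ⟨r, hr'⟩ := List.getElem?_of_mem hm
        rw [List.getElem?_take] at hr'
        split_ifs at hr' with hri
        have := hnum _ _ hr'
        omega
    · exact .inr (.inl h₂)

/-- Every finite normalized automaton is described by a valid code. -/
theorem exists_valid_code [Finite X] [AddGroup.FG A] (enum : Fin n ≃ X)
    (hπ : Function.Surjective π) {ord : LinearOrder (X × Bool)}
    {Γ : EnrichedAutomaton.{u, v, w} X A} (hΓ : Γ.IsNormalized ord) (hfin : Γ.IsFinite) :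
    ∃ (c : AutomatonCode n m) (N : ℕ), AutomatonCode.Valid (letterOrder enum ord) c N ∧
      IsoModBase (codeAut.{u, v, w} enum π c) Γ := by
  classical
  have := hfin.1
  have := hfin.2
  obtain ⟨l, T, hst, hl⟩ := exists_treeStage_forall_mem hΓ.1.1 hΓ.1.2.exists_walk ord
  obtain ⟨k, hk⟩ : ∃ k, l.length = k + 1 :=
    ⟨l.length - 1, by have := List.length_pos_of_mem hst.base_mem; omega⟩
  -- Number each vertex by its position in the final stage of the tree, so that the basepoint gets
  -- 0.
  let ε : Fin (k + 1) ≃ Γ.V :=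
    (finCongr hk.symm).trans (hst.nodup.getEquivOfForallMemList l hl)
  have hε : ∀ (j : ℕ) (hj : j < k + 1), l[j]? = some (ε ⟨j, hj⟩) := fun j hj =>
    List.getElem?_eq_getElem (by omega)
  obtain ⟨r, ⟨δ⟩⟩ : ∃ r, Nonempty (Fin r ≃ Γ.E) := ⟨_, ⟨(Finite.equivFin Γ.E).symm⟩⟩
  -- On tree arcs the vector itself must be zero, not just its image under `π`, since validity is
  -- tested on integer vectors.
  have hvec : ∀ e, ∃ z, π z = Γ.lab₂ e ∧ (e ∈ Γ.orderTree ord → z = 0) := by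
    intro e
    by_cases he : e ∈ Γ.orderTree ord
    · exact ⟨0, by rw [map_zero, hΓ.2.2 e he], fun _ => rfl⟩
    · obtain ⟨z, hz⟩ := hπ (Γ.lab₂ e)
      exact ⟨z, hz, fun h => absurd h he⟩
  choose vec hvec hvec0 using hvec
  have : Module.Finite ℤ A := Module.Finite.iff_addGroup_fg.2 inferInstance
  obtain ⟨S, hS⟩ : Γ.baseSubgroup.FG := by
    have := IsNoetherian.noetherian (AddSubgroup.toIntSubmodule Γ.baseSubgroup)
    rw [Submodule.fg_iff_addSubgroup_fg] at this
    simpa using this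
  choose lift hlift using hπ
  let F : Fin r → ℕ × ℕ × Fin n × (Fin m → ℤ) × (Fin m → ℤ) := fun j =>
    ((ε.symm (Γ.src (δ j))).val, (ε.symm (Γ.tgt (δ j))).val, enum.symm (Γ.lab (δ j)), 0,
      vec (δ j))
  let c : AutomatonCode n m := (k, List.ofFn F, S.toList.map lift)
  let ψ : Fin c.2.1.length ≃ Fin r := finCongr (List.length_ofFn (f := F))
  have hget : ∀ j, c.2.1.get j = F (ψ j) := fun j => List.get_ofFn F j
  let fE : (codeAut.{u, v, w} enum π c).E ≃ Γ.E := Equiv.ulift.trans (ψ.trans δ)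
  let fV : (codeAut.{u, v, w} enum π c).V ≃ Γ.V := Equiv.ulift.trans ε
  have hofNat : ∀ q : Γ.V, ε (Fin.ofNat (k + 1) (ε.symm q).val) = q := fun q => by
    have : Fin.ofNat (k + 1) (ε.symm q).val = ε.symm q :=
      Fin.ext (Nat.mod_eq_of_lt (ε.symm q).isLt)
    rw [this, Equiv.apply_symm_apply]
  let f : Iso (codeAut.{u, v, w} enum π c).toXAutomaton Γ.toXAutomaton :=
    { onV := fV
      onE := fE
      map_base := by
        have h₀ := hst.getElem?_zero
        rw [hε 0 (by omega), Option.some.injEq] at h₀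
        exact h₀
      map_src := fun e => by
        change Γ.src (δ (ψ e.down)) = ε (Fin.ofNat (k + 1) (c.2.1.get e.down).1)
        rw [hget]
        exact (hofNat _).symm
      map_tgt := fun e => by
        change Γ.tgt (δ (ψ e.down)) = ε (Fin.ofNat (k + 1) (c.2.1.get e.down).2.1)
        rw [hget]
        exact (hofNat _).symm
      map_lab := fun e => by
        change Γ.lab (δ (ψ e.down)) = enum (c.2.1.get e.down).2.2.1
        rw [hget]
        exact (enum.apply_symm_apply _).symm }
  have hz : ∀ e ∈ c.2.1, e.2.2.2.1 = 0 := by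
    intro e he
    obtain ⟨j, rfl⟩ := List.get_of_mem he
    rw [hget]
  have hr : (codeAut.{u, v, w} enum π c).IsReduced :=
    ⟨f.symm.isDeterministic hΓ.1.1, f.symm.isCore hΓ.1.2⟩
  have hvalid := AutomatonCode.exists_valid hr hz (f.symm.treeStage_map hst)
    (by rw [List.length_map]; exact hk) ?_ ?_
  · obtain ⟨N, hN⟩ := hvalid
    refine ⟨c, N, hN, f.onV, f.onE, f.map_base, f.map_src, f.map_tgt, f.map_lab, ?_,
      fun e => ?_, fun e => ?_⟩
    · rw [← hS]
      change AddSubgroup.closure {b | ∃ z ∈ S.toList.map lift, b = π z} = _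
      congr 1
      ext a
      simp [hlift]
    · have h₁ : (codeAut.{u, v, w} enum π c).lab₁ e = 0 := by
        change π (c.2.1.get e.down).2.2.2.1 = 0
        rw [hz _ (List.get_mem _ _), map_zero]
      rw [h₁, hΓ.2.1, sub_zero]
      exact zero_mem _
    · have h₁ : (codeAut.{u, v, w} enum π c).lab₂ e = Γ.lab₂ (f.onE e) := by
        change π (c.2.1.get e.down).2.2.2.2 = _
        rw [hget]
        exact hvec _
      rw [h₁, sub_self]
      exact zero_mem _
  · intro j q hq
    rw [List.getElem?_map, Option.map_eq_some_iff] at hq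
    obtain ⟨p, hp, rfl⟩ := hq
    have hj : j < k + 1 := by rw [← hk]; exact (List.getElem?_eq_some_iff.1 hp).1
    rw [hε j hj, Option.some.injEq] at hp
    rw [← hp]
    change (ε.symm (ε ⟨j, hj⟩)).val = j
    rw [Equiv.symm_apply_apply]
  · rintro _ ⟨e, he, rfl⟩
    rw [hget]
    refine hvec0 _ ?_
    have : δ (ψ (f.symm.onE e).down) = e := f.onE.apply_symm_apply e
    rw [this]
    exact ⟨l, T, hst, he⟩

/-- Computing normalized automata from generators. -/
theorem exists_computable_automaton [Finite X] [AddGroup.FG A] (enum : Fin n ≃ X)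
    (hπ : Function.Surjective π) (ord : LinearOrder (X × Bool)) :
    ∃ f : GenCode n m → AutomatonCode n m, Computable f ∧
      ∀ S : GenCode n m,
        ((f S).automaton enum π : EnrichedAutomaton.{u, u, w} X A).IsNormalized ord ∧
        ((f S).automaton enum π : EnrichedAutomaton.{u, u, w} X A).isoClass =
          (stallings ord (S.subgroup enum π)).isoClass := by
  obtain ⟨K, hK⟩ := exists_isKernelCode n π
  have hex : ∀ S : GenCode n m, ∃ p : AutomatonCode n m × ℕ,
      SearchSpec (letterOrder enum ord) K S p.1 p.2 := by
    intro S
    have hfg : (GenCode.subgroup enum π S).FG := by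
      refine (Subgroup.fg_iff _).2 ⟨_, rfl, ?_⟩
      refine (S.finite_toSet.image (codeValue enum π)).subset ?_
      rintro _ ⟨s, hs, rfl⟩
      exact ⟨s, hs, rfl⟩
    -- The search succeeds: a code of the Stallings automaton is valid, and its generators generate
    -- the same subgroup as `S`.
    obtain ⟨c, N, hv, hiso⟩ := exists_valid_code enum hπ (isNormalized_stallings (ord := ord))
      ((fg_iff_isFinite_stallings _).1 hfg)
    have hrec : GenCode.subgroup enum π (AutomatonCode.generators c) =
        GenCode.subgroup enum π S := by
      rw [subgroup_generators (hv.isNormalized (π := π)), hiso.recognized_eq,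
        recognized_stallings]
    obtain ⟨N₁, h₁⟩ := GenCode.exists_covers enum hK hrec.le
    obtain ⟨N₂, h₂⟩ := GenCode.exists_covers enum hK hrec.ge
    -- One bound serves all three certificates, since each of them persists when the bound grows.
    refine ⟨(c, max N (max N₁ N₂)), ?_, h₁.mono (by omega), h₂.mono (by omega)⟩
    refine ⟨hv.1, hv.2.1, hv.2.2.1, hv.2.2.2.1, fun i hi => ?_⟩
    obtain ⟨s, hs, s', hs', h⟩ := hv.2.2.2.2 i hi
    exact ⟨s, visits_mono (le_max_left _ _) hs, s', visits_mono (le_max_left _ _) hs', h⟩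
  obtain ⟨f, hf, hspec⟩ := exists_computable_of_primrecPred
    (P := fun S (p : AutomatonCode n m × ℕ) => SearchSpec (letterOrder enum ord) K S p.1 p.2)
    (primrecPred_searchSpec (letterOrder enum ord) K) hex
  refine ⟨fun S => (f S).1, Computable.fst.comp hf, fun S => ?_⟩
  obtain ⟨hv, h₁, h₂⟩ := hspec S
  have hN : (codeAut.{u, u, w} enum π (f S).1).IsNormalized ord := hv.isNormalized
  refine ⟨hN, ?_⟩
  -- The automaton found need not be the one that proved termination; mutual covering shows that it
  -- recognizes the same subgroup, and the bijection puts it in the right class.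
  have hrec : (codeAut.{u, u, w} enum π (f S).1).recognized = GenCode.subgroup enum π S := by
    rw [← subgroup_generators hN]
    exact le_antisymm (h₁.le hK) (h₂.le hK)
  rw [← hrec]
  exact (isoClass_stallings_recognized hN).symm

end Validity

/-! ### The main theorem -/

theorem mainTheorem1 {X : Type u} [Finite X] {A : Type w} [AddCommGroup A] [AddGroup.FG A]
    (ord : LinearOrder (X × Bool)) :
    -- the map `H ↦ St(H)` is a bijection onto the classes of normalized enriched automata
    Set.BijOn
      (fun H : Subgroup (FreeGroup X × Multiplicative A) =>
        (EnrichedAutomaton.stallings ord H).isoClass)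
      Set.univ
      {κ | ∃ Γ : EnrichedAutomaton.{u, u, w} X A, Γ.IsNormalized ord ∧ Γ.isoClass = κ} ∧
    -- its representatives are normalized, and its inverse is `Γ ↦ ⟨Γ⟩`
    (∀ H : Subgroup (FreeGroup X × Multiplicative A),
      (EnrichedAutomaton.stallings ord H).IsNormalized ord ∧
      (EnrichedAutomaton.stallings ord H).recognized = H) ∧
    (∀ Γ : EnrichedAutomaton.{u, u, w} X A, Γ.IsNormalized ord →
      (EnrichedAutomaton.stallings ord Γ.recognized).isoClass = Γ.isoClass) ∧
    -- finitely generated subgroups correspond precisely to finite automata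
    (∀ H : Subgroup (FreeGroup X × Multiplicative A),
      H.FG ↔ (EnrichedAutomaton.stallings ord H).IsFinite) ∧
    -- between finitely generated subgroups and finite automata the bijection is algorithmic
    (∀ (n m : ℕ) (enum : Fin n ≃ X) (π : (Fin m → ℤ) →+ A), Function.Surjective π →
      (∃ f : GenCode n m → AutomatonCode n m, Computable f ∧
        ∀ S : GenCode n m,
          ((f S).automaton enum π : EnrichedAutomaton.{u, u, w} X A).IsNormalized ord ∧
          ((f S).automaton enum π : EnrichedAutomaton.{u, u, w} X A).isoClass =
            (EnrichedAutomaton.stallings ord (S.subgroup enum π)).isoClass) ∧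
      (∃ g : AutomatonCode n m → GenCode n m, Computable g ∧
        ∀ c : AutomatonCode n m,
          (c.automaton enum π : EnrichedAutomaton.{u, u, w} X A).IsNormalized ord →
          (g c).subgroup enum π =
            (c.automaton enum π : EnrichedAutomaton.{u, u, w} X A).recognized)) := by
  exact ⟨EnrichedAutomaton.bijOn_stallings ord,
    fun H => ⟨EnrichedAutomaton.isNormalized_stallings, EnrichedAutomaton.recognized_stallings⟩,
    fun Γ hΓ => EnrichedAutomaton.isoClass_stallings_recognized hΓ,
    EnrichedAutomaton.fg_iff_isFinite_stallings,
    fun n m enum π hπ => ⟨exists_computable_automaton enum hπ ord,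
      AutomatonCode.generators, AutomatonCode.primrec_generators.to_comp,
      fun c hc => subgroup_generators hc⟩⟩
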